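/- Let $d\ge 1$, let $\beta_1,\dots,\beta_d>1$, let $T_{\beta}x=\beta x-\lfloor\beta x\rfloor$ on $[0,1)$, and let $\mathcal P=\{P_n\}_{n\ge1}$ be an arbitrary sequence of non-degenerate parallelepipeds contained in $[0,1)^d$: for some $v_n\in\mathbb R^d$ and some linearly independent vectors $\alpha_1^{(n)},\dots,\alpha_d^{(n)}\in\mathbb R^d$, the set $P_n$ lies between the interior of $v_n+\{\sum_j x_j\alpha_j^{(n)}:x\in[0,1]^d\}$ and this closed parallelepiped itself (any part of the boundary may be included or not). Put $$W(\mathcal P)=\{x\in[0,1)^d:(T_{\beta_1}\times\cdots\times T_{\beta_d})^n(x)\in P_n\text{ for infinitely many }n\}$$ and $f=\mathrm{diag}(\beta_1^{-1},\dots,\beta_d^{-1})$. For each $n\ge 1$ let $\gamma_1^{(n)},\dots,\gamma_d^{(n)}$ be obtained from $a_j=f^n\alpha_j^{(n)}$ by the pivoted Gram–Schmidt process: for $k=1,\dots,d$, $$\gamma_k^{(n)}=a_{i_k}-\sum_{j<k}\frac{(a_{i_k},\gamma_j^{(n)})}{(\gamma_j^{(n)},\gamma_j^{(n)})}\gamma_j^{(n)},$$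 where the index $i_k\notin\{i_1,\dots,i_{k-1}\}$ is chosen such that the Euclidean norm of the right-hand side is maximal (ties are broken arbitrarily). Let $\mathcal A_n=\{\beta_1^{-n},\dots,\beta_d^{-n},|\gamma_1^{(n)}|,\dots,|\gamma_d^{(n)}|\}$ and $$s_n=\min_{\tau\in\mathcal A_n}\Bigg\{\sum_{i:\,\beta_i^{-n}\le\tau}1+\sum_{i:\,\beta_i^{-n}>\tau}-\frac{n\log\beta_i}{\log\tau}+\sum_{i:\,|\gamma_i^{(n)}|\ge\tau}\Big(1-\frac{\log|\gamma_i^{(n)}|}{\log\tau}\Big)\Bigg\}$$ (for large $n$ all elements of $\mathcal A_n$ are less than $1$, so that $s_n$ is well defined). For $s\ge 0$ let $\mathscr G^{s}([0,1]^d)$ be Falconer's class of sets with large intersections, i.e. the class of all $G_\delta$-sets $F\subset[0,1]^d$ such that $\mathcal M^t_\infty(F\cap Q)=\mathcal M^t_\infty(Q)$ for all $0<t<s$ and all half-open dyadic cubes $Q\subset[0,1)^d$ of side length at most $1$; here $\mathcal M^t_\infty(E)=\inf\sum_j|Q_j|^t$ over all covers of $E$ by half-open dyadic cubes $Q_j$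 of side length $|Q_j|\le 1$. Then $s^*:=\limsup_{n\to\infty}s_n$ is finite and non-negative, and 1. $\dim_{\rm H}W(\mathcal P)=s^*$. 2. $W(\mathcal P^\circ)\in\mathscr G^{s^*}([0,1]^d)$, where $\mathcal P^\circ=\{\operatorname{int}P_n\}_{n\ge1}$. Thus $W(\mathcal P)$ contains a member of $\mathscr G^{s^*}([0,1]^d)$. Moreover $W(\mathcal P)\in\mathscr G^{s^*}([0,1]^d)$ whenever $W(\mathcal P)$ is a $G_\delta$-set, in particular when all $P_n$ are open. 3. Countable intersections of bi-Lipschitz images of $W(\mathcal P)$ have Hausdorff dimension at least $s^*$, in the following sense: if $g_1,g_2,\dots$ are maps into $\mathbb R^d$ that are bi-Lipschitz on $(0,1)^d$ (with constants that may depend on $j$), and $U$ is a non-empty open set with $U\subset g_j((0,1)^d)$ for all $j$, then $$\dim_{\rm H}\Big(U\cap\bigcap_{j}g_j\big(W(\mathcal P)\cap(0,1)^d\big)\Big)\ge s^*.$$ -/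

import Mathlib

open Filter Set
open scoped NNReal ENNReal

noncomputable section

namespace BetaTarget

variable {d : ℕ}

/-- The half-open unit cube `[0,1)^d`. -/
def unitCube (d : ℕ) : Set (EuclideanSpace ℝ (Fin d)) := {x | ∀ i, 0 ≤ x i ∧ x i < 1}

/-- The closed unit cube `[0,1]^d`. -/
def closedCube (d : ℕ) : Set (EuclideanSpace ℝ (Fin d)) := {x | ∀ i, 0 ≤ x i ∧ x i ≤ 1}

/-- The open unit cube `(0,1)^d`. -/
def openCube (d : ℕ) : Set (EuclideanSpace ℝ (Fin d)) := {x | ∀ i, 0 < x i ∧ x i < 1}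

/-- The product `T_{β₁} × ⋯ × T_{β_d}` of the `β`-transformations `T_β x = β x - ⌊β x⌋`. -/
def betaMap (β : Fin d → ℝ) (x : EuclideanSpace ℝ (Fin d)) : EuclideanSpace ℝ (Fin d) :=
  WithLp.toLp 2 (fun i => β i * x i - (⌊β i * x i⌋ : ℝ))

/-- `W(𝒫)`: the points of `[0,1)^d` whose `n`-th iterate lies in `P n` for infinitely many `n`. -/
def limsupSet (β : Fin d → ℝ) (P : ℕ → Set (EuclideanSpace ℝ (Fin d))) :
    Set (EuclideanSpace ℝ (Fin d)) :=
  {x | x ∈ unitCube d ∧ ∃ᶠ n in atTop, (betaMap β)^[n] x ∈ P n}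

/-- The closed parallelepiped with vertex `v` and edge vectors `α`:
all `v + x₁ α₁ + ⋯ + x_d α_d` with `x ∈ [0,1]^d`. -/
def closedParallelepiped (v : EuclideanSpace ℝ (Fin d)) (α : Fin d → EuclideanSpace ℝ (Fin d)) :
    Set (EuclideanSpace ℝ (Fin d)) :=
  (fun y => v + y) '' parallelepiped α

/-- `P` is a (non-degenerate) parallelepiped with vertex `v` and edge vectors `α`; any part of
the boundary may belong to `P` or not, so closed, open and half-open ones are all included. -/
def IsParallelepiped (P : Set (EuclideanSpace ℝ (Fin d))) (v : EuclideanSpace ℝ (Fin d))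
    (α : Fin d → EuclideanSpace ℝ (Fin d)) : Prop :=
  LinearIndependent ℝ α ∧
    interior (closedParallelepiped v α) ⊆ P ∧ P ⊆ closedParallelepiped v α

/-- The linear map `fⁿ`, where `f = diag(β₁⁻¹, …, β_d⁻¹)`. -/
def contraction (β : Fin d → ℝ) (n : ℕ) (x : EuclideanSpace ℝ (Fin d)) :
    EuclideanSpace ℝ (Fin d) :=
  WithLp.toLp 2 (fun i => (β i ^ n)⁻¹ * x i)

/-- What is left of the vector `a` after subtracting its projections on `γ j`, `j < k`. -/
def gsResidual (γ : Fin d → EuclideanSpace ℝ (Fin d)) (k : Fin d)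
    (a : EuclideanSpace ℝ (Fin d)) : EuclideanSpace ℝ (Fin d) :=
  a - ∑ j ∈ Finset.Iio k, (inner ℝ a (γ j) / inner ℝ (γ j) (γ j)) • γ j

/-- `γ` results from `a` by the pivoted (unnormalised) Gram–Schmidt process: the vectors are taken
in an order `a (σ 1), …, a (σ d)` in which the `k`-th one has, among all the vectors not yet used,
a residual of maximal Euclidean length. -/
def IsPivotedGramSchmidt (a γ : Fin d → EuclideanSpace ℝ (Fin d)) : Prop :=
  ∃ σ : Equiv.Perm (Fin d),
    (∀ k, γ k = gsResidual γ k (a (σ k))) ∧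
      ∀ k l, k ≤ l → ‖gsResidual γ k (a (σ l))‖ ≤ ‖γ k‖

/-- The set `{β₁⁻ⁿ, …, β_d⁻ⁿ, |γ₁|, …, |γ_d|}`. -/
def scales (β : Fin d → ℝ) (n : ℕ) (γ : Fin d → EuclideanSpace ℝ (Fin d)) : Finset ℝ :=
  Finset.univ.image (fun i => (β i ^ n)⁻¹) ∪ Finset.univ.image (fun i => ‖γ i‖)

theorem scales_nonempty [NeZero d] (β : Fin d → ℝ) (n : ℕ)
    (γ : Fin d → EuclideanSpace ℝ (Fin d)) : (scales β n γ).Nonempty :=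
  ⟨_, Finset.mem_union_left _ (Finset.mem_image_of_mem _ (Finset.mem_univ (0 : Fin d)))⟩

/-- The exponent attached to the scale `τ`. -/
def scaleExponent (β : Fin d → ℝ) (n : ℕ) (γ : Fin d → EuclideanSpace ℝ (Fin d)) (τ : ℝ) : ℝ :=
  (∑ i with (β i ^ n)⁻¹ ≤ τ, (1 : ℝ))
    + (∑ i with ¬ (β i ^ n)⁻¹ ≤ τ, -((n : ℝ) * Real.log (β i) / Real.log τ))
    + ∑ i with τ ≤ ‖γ i‖, (1 - Real.log ‖γ i‖ / Real.log τ)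

/-- `s_n`: the minimum of the exponents over all the scales. -/
def minExponent [NeZero d] (β : Fin d → ℝ) (n : ℕ) (γ : Fin d → EuclideanSpace ℝ (Fin d)) : ℝ :=
  (scales β n γ).inf' (scales_nonempty β n γ) (scaleExponent β n γ)

/-- The half-open dyadic cube `∏ [mᵢ 2⁻ᵏ, (mᵢ + 1) 2⁻ᵏ)`, coded by `c = (k, m)`. -/
def dyadicCube (c : ℕ × (Fin d → ℤ)) : Set (EuclideanSpace ℝ (Fin d)) :=
  {x | ∀ i, (c.2 i : ℝ) / 2 ^ c.1 ≤ x i ∧ x i < ((c.2 i : ℝ) + 1) / 2 ^ c.1}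

/-- The net content `ℳ^t_∞(E)`: the infimum of `∑ |Q|^t` over all covers of `E` by
(automatically countably many) dyadic cubes `Q`, with `|Q|` the side length. -/
def netContent (t : ℝ) (E : Set (EuclideanSpace ℝ (Fin d))) : ℝ≥0∞ :=
  ⨅ (C : Set (ℕ × (Fin d → ℤ))) (_ : E ⊆ ⋃ c ∈ C, dyadicCube c),
    ∑' c : C, ENNReal.ofReal ((((2 : ℝ) ^ (c : ℕ × (Fin d → ℤ)).1)⁻¹) ^ t)

/-- Falconer's class `𝒢^s([0,1]^d)` of sets with large intersections: the `G_δ` subsets of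
`[0,1]^d` that have, for all `0 < t < s`, full `t`-dimensional net content in every dyadic subcube
of the unit cube. -/
structure LargeIntersectionClass (s : ℝ) (F : Set (EuclideanSpace ℝ (Fin d))) : Prop where
  subset_cube : F ⊆ closedCube d
  isGδ : IsGδ F
  full_content : ∀ t : ℝ, 0 < t → t < s → ∀ c : ℕ × (Fin d → ℤ), dyadicCube c ⊆ unitCube d →
    netContent t (F ∩ dyadicCube c) = netContent t (dyadicCube c)

/-- `g` is bi-Lipschitz on `S`. -/
def IsBiLipschitzOn (g : EuclideanSpace ℝ (Fin d) → EuclideanSpace ℝ (Fin d))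
    (S : Set (EuclideanSpace ℝ (Fin d))) : Prop :=
  ∃ K : ℝ≥0, LipschitzOnWith K g S ∧ AntilipschitzWith K (S.domRestrict g)

/-- Every countable intersection of bi-Lipschitz images of `F` has Hausdorff dimension at least `s`
inside every non-empty open set that lies in the images of the whole cube. -/
def HasLargeIntersections (s : ℝ≥0) (F : Set (EuclideanSpace ℝ (Fin d))) : Prop :=
  ∀ g : ℕ → EuclideanSpace ℝ (Fin d) → EuclideanSpace ℝ (Fin d),
    (∀ j, IsBiLipschitzOn (g j) (openCube d)) →
    ∀ U : Set (EuclideanSpace ℝ (Fin d)), IsOpen U → U.Nonempty →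
      (∀ j, U ⊆ g j '' openCube d) →
      (s : ℝ≥0∞) ≤ dimH (U ∩ ⋂ j, g j '' (F ∩ openCube d))

end BetaTarget

end

/-! Put φ_n(r) = ∏ max(r, β_i⁻ⁿ) · ∏ min(1, r/|γ_i|), which is `scaleMass`. Up to factors polynomial
in n, the set hit at time n consists of ∏ β_iⁿ copies of the contracted target fⁿPₙ, one in each
product of branches (possibly truncated). Pivoting makes the matrix that expresses the edges in the
frame γ unimodular with entries in [-1, 1], so a full copy lies in a box with sides comparable to
|γ_i| and fills a proportion of it that depends on d only (`IsPivotedGramSchmidt.exists_matrix`).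
Hence about 1/φ_n(r) sets of size r cover the hitting set (`IsFrame.exists_cover`), and the natural
measure on its full copies gives an r-ball at most about φ_n(r) (`IsFrame.exists_measure`).

The exponent at the scale τ is log φ_n(τ) / log τ. A convexity argument between break points
(`piecewise_linear_nonpos`) shows that the minimum over the finitely many scales governs all radii:
φ_n(r) ≤ r^{s_n} for 0 < r < 1, with equality at one of the scales.

Upper bound: cover the n-th hitting set at its minimising scale. Scales decay geometrically in n, so
any exponent above s* gives a convergent sum.

Lower bound: let t < s*. For infinitely many n, s_n exceeds t by a fixed amount, and for large n
this excess absorbs the polynomial factors. Every cube then carries a probability measure on later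
hitting sets with ball masses at most C(r/ℓ)^t, where C depends on d only (`isSpreadOn_hitSet`).
Since t < d, splitting a cube into many equal subcubes replaces C by 1
(`IsDyadicSpread.exists_measure`). A Cantor construction can therefore pass through countably many
open sets without losing a constant, and yields full net content of their intersection
(`le_netContent_iInter`). The spreading property survives bi-Lipschitz maps with a new constant
(`IsBoxSpread.image`), so the same construction handles countable intersections of images. -/

namespace BetaTarget

/-! ### Branches of the iterated β-transformation -/

/-- The `β`-transformation of the line. -/
noncomputable def betaFract (b u : ℝ) : ℝ := Int.fract (b * u)

theorem betaFract_div_add {b : ℝ} (hb : 1 < b) (e : ℕ) {u : ℝ} (hu : u ∈ Ico (0 : ℝ) 1) :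
    betaFract b ((e + u) / b) = u := by
  have : b * ((e + u) / b) = u + ((e : ℤ) : ℝ) := by
    push_cast; field_simp; ring
  rw [betaFract, this, Int.fract_add_intCast, Int.fract_eq_self.2 hu]

/-- Every `x ∈ [0, 1]` that is not too close to `0` has, at distance at most `(n + 1) β⁻ⁿ` to its
left, a full branch of the `n`-th iterate of the `β`-transformation. -/
theorem exists_full_branch {b : ℝ} (hb : 1 < b) (n : ℕ) :
    ∀ x : ℝ, (b ^ n)⁻¹ ≤ x → x ≤ 1 → ∃ c : ℝ, 0 ≤ c ∧ c + (b ^ n)⁻¹ ≤ x ∧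
      x ≤ c + (n + 1) * (b ^ n)⁻¹ ∧
      ∀ y ∈ Ico (0 : ℝ) 1, (betaFract b)^[n] (c + (b ^ n)⁻¹ * y) = y := by
  have hb0 : 0 < b := by linarith
  induction n with
  | zero =>
    intro x hx hx1
    refine ⟨0, le_rfl, by simpa using hx, by simpa using hx1, fun y _ => by simp⟩
  | succ n ih =>
    -- The slack `(b ^ n)⁻¹` allows `x` to lie slightly beyond the point whose branch is used. Each
    -- induction step spends it at most once, which produces the factor `n + 1`.
    have lift : ∀ (e : ℕ) (x' x : ℝ), (b ^ n)⁻¹ ≤ x' → x' ≤ 1 → (e + x') / b ≤ x →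
        x ≤ (e + x' + (b ^ n)⁻¹) / b → ∃ c : ℝ, 0 ≤ c ∧ c + (b ^ (n + 1))⁻¹ ≤ x ∧
      x ≤ c + ((n + 1 : ℕ) + 1) * (b ^ (n + 1))⁻¹ ∧
      ∀ y ∈ Ico (0 : ℝ) 1, (betaFract b)^[n + 1] (c + (b ^ (n + 1))⁻¹ * y) = y := by
      intro e x' x h1 h2 h3 h4
      obtain ⟨c, hc0, hc1, hc2, hc3⟩ := ih x' h1 h2
      have hp : 0 < (b ^ n)⁻¹ := by positivity
      have e1 : (b ^ (n + 1))⁻¹ = (b ^ n)⁻¹ / b := by rw [pow_succ]; field_simp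
      refine ⟨(e + c) / b, by positivity, ?_, ?_, ?_⟩
      · rw [e1, ← add_div]
        refine le_trans ?_ h3
        exact (div_le_div_iff_of_pos_right hb0).2 (by linarith)
      · rw [e1, mul_div_assoc', ← add_div]
        refine h4.trans ((div_le_div_iff_of_pos_right hb0).2 ?_)
        push_cast
        linarith
      · intro y hy
        have : (e + c) / b + (b ^ (n + 1))⁻¹ * y = (e + (c + (b ^ n)⁻¹ * y)) / b := by
          rw [e1]; ring
        rw [Function.iterate_succ_apply, this, betaFract_div_add hb, hc3 y hy]
        constructor
        · have := hy.1; positivity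
        · nlinarith [hy.2]
    intro x hx hx1
    have hx0 : 0 < x := lt_of_lt_of_le (by positivity) hx
    have hbx : 0 < b * x := by positivity
    -- The ceiling, not the floor: `b * x - e` then lies in (0, 1], so a right end point belongs to
    -- the branch on its left.
    obtain ⟨e, he⟩ : ∃ e : ℕ, ⌈b * x⌉₊ = e + 1 :=
      ⟨⌈b * x⌉₊ - 1, (Nat.succ_pred_eq_of_pos (Nat.ceil_pos.2 hbx)).symm⟩
    have h1 : b * x ≤ e + 1 := by
      have := Nat.le_ceil (b * x); rw [he] at this; push_cast at this; exact this
    have h2 : (e : ℝ) < b * x := by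
      have := Nat.ceil_lt_add_one hbx.le; rw [he] at this; push_cast at this; linarith
    by_cases h : (b ^ n)⁻¹ ≤ b * x - e
    · have h0 : (e + (b * x - e)) / b = x := by field_simp; ring
      refine lift e (b * x - e) x h (by linarith) h0.le ?_
      rw [le_div_iff₀ hb0]
      have : 0 < (b ^ n)⁻¹ := by positivity
      linarith
    · push Not at h
      rcases Nat.eq_zero_or_pos e with rfl | hepos
      · exfalso
        rw [pow_succ, mul_inv] at hx
        have : x < (b ^ n)⁻¹ * b⁻¹ := by
          rw [← div_eq_mul_inv, lt_div_iff₀ hb0]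
          push_cast at h
          linarith
        linarith
      -- The remainder is too short to contain a branch of order `n`; the right end of the preceding
      -- full branch is used instead.
      · obtain ⟨e', rfl⟩ : ∃ e', e = e' + 1 := ⟨e - 1, by omega⟩
        push_cast at h h2
        refine lift e' 1 x ?_ le_rfl ?_ ?_
        · exact inv_le_one_of_one_le₀ (one_le_pow₀ hb.le)
        · rw [div_le_iff₀ hb0]; linarith
        · rw [le_div_iff₀ hb0]; linarith

/-- The number of branches of the `n`-th iterate of the `β`-transformation on `[0, a)`. -/
theorem exists_branch_finset {b : ℝ} (hb : 1 < b) (n : ℕ) :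
    ∀ a : ℝ, 0 < a → a ≤ 1 → ∃ S : Finset ℝ, (S.card : ℝ) ≤ 1 + a * n * b ^ n ∧
      ∀ x : ℝ, 0 ≤ x → x < a → b ^ n * x - (betaFract b)^[n] x ∈ S := by
  have hb0 : 0 < b := by linarith
  classical
  induction n with
  | zero =>
    intro a _ _
    exact ⟨{0}, by simp, fun x _ _ => by simp⟩
  | succ n ih =>
    intro a ha ha1
    have hba : 0 < b * a := by positivity
    obtain ⟨e, he⟩ : ∃ e : ℕ, ⌈b * a⌉₊ = e + 1 :=
      ⟨⌈b * a⌉₊ - 1, (Nat.succ_pred_eq_of_pos (Nat.ceil_pos.2 hba)).symm⟩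
    have h1 : b * a ≤ e + 1 := by
      have := Nat.le_ceil (b * a); rw [he] at this; push_cast at this; exact this
    have h2 : (e : ℝ) < b * a := by
      have := Nat.ceil_lt_add_one hba.le; rw [he] at this; push_cast at this; linarith
    obtain ⟨S1, hS1, hS1'⟩ := ih 1 one_pos le_rfl
    obtain ⟨S2, hS2, hS2'⟩ := ih (b * a - e) (by linarith) (by linarith)
    -- The value `b ^ n * x - T^n x` is constant on branches and labels them. Each of the `e` full
    -- first-level branches contributes `S1`, the truncated one only `S2`. Because the bound is
    -- linear in `a`, the two contributions combine exactly, up to an extra `e`, which is less than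
    -- `b * a`.
    refine ⟨((Finset.range e).biUnion fun j => S1.image fun s => b ^ n * j + s) ∪
      S2.image fun s => b ^ n * e + s, ?_, ?_⟩
    · have hc : ((((Finset.range e).biUnion fun j => S1.image fun s => b ^ n * j + s) ∪
          S2.image fun s => b ^ n * e + s).card : ℝ) ≤ e * S1.card + S2.card := by
        have c1 : ((Finset.range e).biUnion fun j => S1.image fun s => b ^ n * (j : ℝ) + s).card
            ≤ e * S1.card := by
          refine (Finset.card_biUnion_le_card_mul _ _ S1.card fun j _ =>
            Finset.card_image_le).trans ?_
          simp
        have c2 : (S2.image fun s => b ^ n * (e : ℝ) + s).card ≤ S2.card := Finset.card_image_le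
        exact_mod_cast (Finset.card_union_le _ _).trans (add_le_add c1 c2)
      refine hc.trans ?_
      have hbn : 1 ≤ b ^ n := one_le_pow₀ hb.le
      calc (e : ℝ) * S1.card + S2.card
          ≤ e * (1 + 1 * n * b ^ n) + (1 + (b * a - e) * n * b ^ n) := by gcongr
        _ = 1 + e + a * n * b ^ (n + 1) := by ring
        _ ≤ 1 + b * a * b ^ n + a * n * b ^ (n + 1) := by nlinarith
        _ = 1 + a * (n + 1 : ℕ) * b ^ (n + 1) := by push_cast; ring
    · intro x hx hxa
      have hbx : 0 ≤ b * x := by positivity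
      have hfl : (⌊b * x⌋₊ : ℝ) ≤ b * x := Nat.floor_le hbx
      have hfl' : b * x < ⌊b * x⌋₊ + 1 := Nat.lt_floor_add_one _
      have hT : betaFract b x = b * x - ⌊b * x⌋₊ := by
        rw [betaFract, Int.fract, natCast_floor_eq_intCast_floor hbx]
      have key : b ^ (n + 1) * x - (betaFract b)^[n + 1] x = b ^ n * ⌊b * x⌋₊ +
          (b ^ n * betaFract b x - (betaFract b)^[n] (betaFract b x)) := by
        rw [Function.iterate_succ_apply, hT]; ring
      rw [key, Finset.mem_union]
      have hle : ⌊b * x⌋₊ ≤ e := by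
        have : (⌊b * x⌋₊ : ℝ) < e + 1 := by nlinarith
        have : ⌊b * x⌋₊ < e + 1 := by exact_mod_cast this
        omega
      rcases hle.lt_or_eq with hlt | heq
      · left
        rw [Finset.mem_biUnion]
        exact ⟨_, Finset.mem_range.2 hlt, Finset.mem_image_of_mem _
          (hS1' _ (by rw [hT]; linarith) (by rw [hT]; linarith))⟩
      · right
        rw [heq]
        refine Finset.mem_image_of_mem _ (hS2' _ (by rw [hT]; linarith) ?_)
        rw [hT, heq]
        nlinarith

/-! ### The product map and its hitting sets -/

variable {d : ℕ}

theorem betaMap_iterate_apply (β : Fin d → ℝ) (n : ℕ) (x : EuclideanSpace ℝ (Fin d)) (i : Fin d) :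
    (betaMap β)^[n] x i = (betaFract (β i))^[n] (x i) := by
  induction n generalizing x with
  | zero => rfl
  | succ n ih => rw [Function.iterate_succ_apply, Function.iterate_succ_apply, ih]; rfl

theorem betaMap_mem_unitCube (β : Fin d → ℝ) (x : EuclideanSpace ℝ (Fin d)) :
    betaMap β x ∈ unitCube d :=
  fun _ => ⟨Int.fract_nonneg _, Int.fract_lt_one _⟩

theorem isOpen_openCube : IsOpen (openCube d) := by
  have : openCube d = ⋂ i, {x : EuclideanSpace ℝ (Fin d) | 0 < x i ∧ x i < 1} := by
    ext; simp [openCube]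
  rw [this]
  refine isOpen_iInter_of_finite fun i => ?_
  have hc : Continuous fun x : EuclideanSpace ℝ (Fin d) => x i := by fun_prop
  exact (isOpen_lt continuous_const hc).inter (isOpen_lt hc continuous_const)

theorem openCube_subset_unitCube : openCube d ⊆ unitCube d := fun _ hx i => ⟨(hx i).1.le, (hx i).2⟩

theorem interior_unitCube_subset : interior (unitCube d) ⊆ openCube d := by
  intro x hx i
  refine ⟨lt_of_le_of_ne (interior_subset hx i).1 fun h0 => ?_, (interior_subset hx i).2⟩
  have hc : Tendsto (fun t : ℝ => x - t • EuclideanSpace.single i (1 : ℝ)) (nhdsWithin 0 (Ioi 0))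
      (nhds x) := by
    have : Continuous (fun t : ℝ => x - t • EuclideanSpace.single i (1 : ℝ)) := by fun_prop
    simpa using (this.tendsto 0).mono_left nhdsWithin_le_nhds
  obtain ⟨t, ht, ht0⟩ := ((hc.eventually (mem_interior_iff_mem_nhds.1 hx)).and
    self_mem_nhdsWithin).exists
  have := (ht i).1
  simp [← h0] at this
  exact absurd this (not_le.2 ht0)

/-- The points of the unit cube that the `n`-th iterate sends to `O`. -/
def hitSet (β : Fin d → ℝ) (n : ℕ) (O : Set (EuclideanSpace ℝ (Fin d))) :
    Set (EuclideanSpace ℝ (Fin d)) :=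
  {x | x ∈ unitCube d ∧ (betaMap β)^[n] x ∈ O}

/-- The map can be discontinuous only where some `β i * x i` is an integer, and there a coordinate
of the image is 0. A target inside the open cube never meets these points, and its preimage is again
inside the open cube, so induction applies. -/
theorem hitSet_subset_openCube_and_isOpen (β : Fin d → ℝ) (n : ℕ)
    {O : Set (EuclideanSpace ℝ (Fin d))} (hO : IsOpen O) (hOc : O ⊆ openCube d) :
    hitSet β n O ⊆ openCube d ∧ IsOpen (hitSet β n O) := by
  have base : ∀ O : Set (EuclideanSpace ℝ (Fin d)), IsOpen O → O ⊆ openCube d →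
      hitSet β 1 O ⊆ openCube d ∧ IsOpen (hitSet β 1 O) := by
    intro O hO hOc
    have hsub : hitSet β 1 O ⊆ openCube d := by
      rintro x ⟨hx, hxO⟩ i
      refine ⟨lt_of_le_of_ne (hx i).1 fun h0 => ?_, (hx i).2⟩
      have := (hOc hxO i).1
      rw [betaMap_iterate_apply] at this
      simp [betaFract, ← h0] at this
    refine ⟨hsub, isOpen_iff_mem_nhds.2 ?_⟩
    rintro x ⟨hx, hxO⟩
    have hcont : ContinuousAt (betaMap β) x := by
      have hc : ContinuousAt (fun y : EuclideanSpace ℝ (Fin d) =>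
          (fun i => Int.fract (β i * y i) : Fin d → ℝ)) x := by
        rw [continuousAt_pi]
        intro i
        have h1 := (hOc hxO i).1
        rw [betaMap_iterate_apply] at h1
        have hne : β i * x i ≠ (⌊β i * x i⌋ : ℝ) := by
          intro h
          have h3 : Int.fract (β i * x i) = 0 := by rw [Int.fract]; linarith
          have h4 : (0 : ℝ) < Int.fract (β i * x i) := h1
          linarith
        exact ContinuousAt.comp (f := fun y : EuclideanSpace ℝ (Fin d) => β i * y i)
          (continuousAt_fract hne) (by fun_prop)
      exact (PiLp.continuous_toLp 2 _).continuousAt.comp hc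
    filter_upwards [hcont.preimage_mem_nhds (hO.mem_nhds hxO),
      isOpen_openCube.mem_nhds (hsub ⟨hx, hxO⟩)] with y hy hy'
    exact ⟨openCube_subset_unitCube hy', hy⟩
  induction n with
  | zero =>
    have : hitSet β 0 O = O := by
      ext x
      exact ⟨fun h => h.2, fun h => ⟨openCube_subset_unitCube (hOc h), h⟩⟩
    rw [this]
    exact ⟨hOc, hO⟩
  | succ n ih =>
    have : hitSet β (n + 1) O = hitSet β 1 (hitSet β n O) := by
      ext x
      simp only [hitSet, mem_ofPred_eq, Function.iterate_succ_apply, Function.iterate_zero, id]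
      exact ⟨fun h => ⟨h.1, betaMap_mem_unitCube β x, h.2⟩, fun h => ⟨h.1, h.2.2⟩⟩
    rw [this]
    exact base _ ih.2 ih.1

/-! ### Pivoted Gram–Schmidt and volumes in the orthogonal frame -/

theorem gsResidual_inner_eq {γ : Fin d → EuclideanSpace ℝ (Fin d)} {k : Fin d}
    (hγ : Pairwise fun i j => inner ℝ (γ i) (γ j) = (0 : ℝ)) (a : EuclideanSpace ℝ (Fin d)) :
    inner ℝ (gsResidual γ k a) (γ k) = (inner ℝ a (γ k) : ℝ) := by
  rw [gsResidual, inner_sub_left, sum_inner, Finset.sum_eq_zero, sub_zero]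
  intro j hj
  rw [real_inner_smul_left, hγ (Finset.mem_Iio.1 hj).ne, mul_zero]

/-- The recursion refers to earlier vectors only. Once the pivoting permutation is applied,
orthogonality, non-vanishing and triangularity are inherited from the standard process. -/
theorem eq_gramSchmidt {a γ : Fin d → EuclideanSpace ℝ (Fin d)}
    (h : ∀ k, γ k = gsResidual γ k (a k)) (k : Fin d) :
    γ k = InnerProductSpace.gramSchmidt ℝ a k := by
  induction k using WellFoundedLT.induction with
  | ind k ih =>
    rw [h, gsResidual, InnerProductSpace.gramSchmidt_def]
    congr 1
    refine Finset.sum_congr rfl fun j hj => ?_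
    rw [Submodule.starProjection_singleton, ih j (Finset.mem_Iio.1 hj), real_inner_comm,
      real_inner_self_eq_norm_sq]
    rfl

/-- The vectors entering a pivoted Gram–Schmidt process are, up to their order, obtained from the
resulting orthogonal vectors by a matrix of determinant `1` with entries in `[-1, 1]`. -/
theorem IsPivotedGramSchmidt.exists_matrix {a γ : Fin d → EuclideanSpace ℝ (Fin d)}
    (h : IsPivotedGramSchmidt a γ) (ha : LinearIndependent ℝ a) :
    (∀ k, γ k ≠ 0) ∧ (Pairwise fun i j => inner ℝ (γ i) (γ j) = (0 : ℝ)) ∧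
    (∀ k, ∃ j, ‖γ k‖ ≤ ‖a j‖) ∧
    ∃ (σ : Equiv.Perm (Fin d)) (M : Matrix (Fin d) (Fin d) ℝ), M.det = 1 ∧
      (∀ j k, |M j k| ≤ 1) ∧ ∀ k, a (σ k) = ∑ j, M j k • γ j := by
  obtain ⟨σ, h1, h2⟩ := h
  have hgs := eq_gramSchmidt (a := a ∘ σ) h1
  have hne : ∀ k, γ k ≠ 0 := fun k => by
    rw [hgs]
    exact InnerProductSpace.gramSchmidt_ne_zero k (ha.comp σ σ.injective)
  have horth : Pairwise fun i j => inner ℝ (γ i) (γ j) = (0 : ℝ) := fun i j hij => by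
    simp only [hgs]
    exact InnerProductSpace.gramSchmidt_orthogonal ℝ _ hij
  have hself : ∀ k, inner ℝ (a (σ k)) (γ k) = (inner ℝ (γ k) (γ k) : ℝ) := fun k => by
    rw [← gsResidual_inner_eq horth, ← h1]
  have hpos : ∀ k, 0 < (inner ℝ (γ k) (γ k) : ℝ) := fun k => real_inner_self_pos.2 (hne k)
  set M : Matrix (Fin d) (Fin d) ℝ :=
    fun j k => inner ℝ (a (σ k)) (γ j) / inner ℝ (γ j) (γ j) with hM
  have hdiag : ∀ k, M k k = 1 := fun k => by
    simp only [hM, hself]; exact div_self (hpos k).ne'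
  have hlow : ∀ j k, k < j → M j k = 0 := fun j k hkj => by
    have := InnerProductSpace.gramSchmidt_inv_triangular ℝ (a ∘ σ) hkj
    simp only [hM]
    rw [real_inner_comm, hgs j]
    simp only [Function.comp_apply] at this
    rw [this, zero_div]
  refine ⟨hne, horth, fun k => ⟨σ k, ?_⟩, σ, M, ?_, fun j k => ?_, fun k => ?_⟩
  · have h3 := real_inner_le_norm (a (σ k)) (γ k)
    rw [hself, real_inner_self_eq_norm_sq, sq] at h3
    exact le_of_mul_le_mul_right h3 (norm_pos_iff.2 (hne k))
  · rw [Matrix.det_of_isUpperTriangular fun i j hij => hlow i j hij]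
    simp [hdiag]
  · rcases lt_or_ge k j with hkj | hjk
    · simp [hlow j k hkj]
    · simp only [hM]
      -- The coefficient along `γ j` is that of the residual left before step `j`. Pivoting makes
      -- this residual no longer than `γ j`, and Cauchy–Schwarz concludes.
      rw [abs_div, abs_of_pos (hpos j), div_le_one (hpos j), ← gsResidual_inner_eq horth,
        real_inner_self_eq_norm_sq, sq]
      exact (abs_real_inner_le_norm _ _).trans (by gcongr; exact h2 j k hjk)
  · rw [← Finset.sum_subset (Finset.subset_univ (Finset.Iic k)), ← Finset.Iio_insert,
      Finset.sum_insert (by simp), hdiag, one_smul]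
    · nth_rewrite 1 [h1 k]
      rw [gsResidual]
      simp [hM]
    · intro j _ hj
      rw [hlow j k (by simpa using hj), zero_smul]

theorem abs_mulVec_le {M : Matrix (Fin d) (Fin d) ℝ} (hM : ∀ j k, |M j k| ≤ 1) {x : Fin d → ℝ}
    (hx : ∀ k, x k ∈ Icc (0 : ℝ) 1) (j : Fin d) : |M.mulVec x j| ≤ d := by
  rw [Matrix.mulVec, dotProduct]
  refine (Finset.abs_sum_le_sum_abs _ _).trans ?_
  calc ∑ i, |M j i * x i| ≤ ∑ _i : Fin d, (1 : ℝ) := by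
        refine Finset.sum_le_sum fun i _ => ?_
        rw [abs_mul, abs_of_nonneg (hx i).1]
        exact mul_le_one₀ (hM j i) (hx i).1 (hx i).2
    _ = d := by simp

/-- The part of the unit cube that a unimodular matrix with entries in `[-1, 1]` maps to a box. -/
theorem volume_preimage_box_le {M : Matrix (Fin d) (Fin d) ℝ} (hdet : M.det = 1)
    (hM : ∀ j k, |M j k| ≤ 1) (w ρ : Fin d → ℝ) (hρ : ∀ j, 0 ≤ ρ j) :
    MeasureTheory.volume {x : Fin d → ℝ | (∀ k, x k ∈ Icc (0 : ℝ) 1) ∧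
        ∀ j, |M.mulVec x j - w j| ≤ ρ j} ≤
      ENNReal.ofReal (∏ j, (2 * d) * min 1 (ρ j)) := by
  have hL : LinearMap.det (Matrix.toLin' M) = 1 := by rw [LinearMap.det_toLin', hdet]
  -- The matrix preserves volume and sends the unit cube into `[-d, d]^d`. In each coordinate the
  -- constraint that suits the size of `ρ j` is kept.
  set B : Set (Fin d → ℝ) := Set.pi univ fun j => Icc (-(d : ℝ)) d ∩ Icc (w j - ρ j) (w j + ρ j)
  calc MeasureTheory.volume {x : Fin d → ℝ | (∀ k, x k ∈ Icc (0 : ℝ) 1) ∧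
        ∀ j, |M.mulVec x j - w j| ≤ ρ j}
      ≤ MeasureTheory.volume (Matrix.toLin' M ⁻¹' B) := by
        refine MeasureTheory.measure_mono ?_
        rintro x ⟨hx, hx'⟩ j -
        rw [Matrix.toLin'_apply]
        have h1 := abs_le.1 (abs_mulVec_le hM hx j)
        have h2 := abs_le.1 (hx' j)
        exact ⟨h1, by linarith, by linarith⟩
    _ = MeasureTheory.volume B := by
        rw [MeasureTheory.Measure.addHaar_preimage_linearMap _ (by rw [hL]; exact one_ne_zero), hL]
        simp
    _ = ∏ j, MeasureTheory.volume (Icc (-(d : ℝ)) d ∩ Icc (w j - ρ j) (w j + ρ j)) :=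
        MeasureTheory.volume_pi_pi _
    _ ≤ ∏ j, ENNReal.ofReal ((2 * d) * min 1 (ρ j)) := by
        refine Finset.prod_le_prod' fun j _ => ?_
        have hd : (1 : ℝ) ≤ d := by exact_mod_cast Fin.pos j
        rcases le_total 1 (ρ j) with h | h
        · refine (MeasureTheory.measure_mono inter_subset_left).trans ?_
          rw [Real.volume_Icc, min_eq_left h]
          exact ENNReal.ofReal_le_ofReal (by linarith)
        · refine (MeasureTheory.measure_mono inter_subset_right).trans ?_
          rw [Real.volume_Icc, min_eq_right h]
          exact ENNReal.ofReal_le_ofReal (by nlinarith [hρ j])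
    _ = ENNReal.ofReal (∏ j, (2 * d) * min 1 (ρ j)) := by
        rw [ENNReal.ofReal_prod_of_nonneg]
        intro j _
        have := hρ j
        positivity

/-- The coordinates of a point in an orthogonal family are controlled by its distance. -/
theorem abs_sub_mul_norm_le {γ : Fin d → EuclideanSpace ℝ (Fin d)}
    (hγ : Pairwise fun i j => inner ℝ (γ i) (γ j) = (0 : ℝ)) (z : Fin d → ℝ)
    (y : EuclideanSpace ℝ (Fin d)) (j : Fin d) (hj : γ j ≠ 0) :
    |z j - inner ℝ y (γ j) / ‖γ j‖ ^ 2| ≤ ‖∑ i, z i • γ i - y‖ / ‖γ j‖ := by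
  have hp : 0 < ‖γ j‖ := norm_pos_iff.2 hj
  have h1 : inner ℝ (∑ i, z i • γ i - y) (γ j) = z j * ‖γ j‖ ^ 2 - inner ℝ y (γ j) := by
    rw [inner_sub_left, sum_inner, Finset.sum_eq_single j]
    · rw [real_inner_smul_left, real_inner_self_eq_norm_sq]
    · intro i _ hij
      rw [real_inner_smul_left, hγ hij, mul_zero]
    · simp
  have h2 := abs_real_inner_le_norm (∑ i, z i • γ i - y) (γ j)
  have h3 : z j - inner ℝ y (γ j) / ‖γ j‖ ^ 2 =
      (z j * ‖γ j‖ ^ 2 - inner ℝ y (γ j)) / ‖γ j‖ ^ 2 := by field_simp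
  rw [h3, ← h1, abs_div, abs_of_pos (pow_pos hp 2), div_le_div_iff₀ (pow_pos hp 2) hp]
  nlinarith

theorem sum_smul_perm_eq {a γ : Fin d → EuclideanSpace ℝ (Fin d)} {σ : Equiv.Perm (Fin d)}
    {M : Matrix (Fin d) (Fin d) ℝ} (h : ∀ k, a (σ k) = ∑ j, M j k • γ j) (x : Fin d → ℝ) :
    ∑ k, x k • a (σ k) = ∑ j, M.mulVec x j • γ j := by
  simp_rw [h, Finset.smul_sum, Matrix.mulVec, dotProduct, Finset.sum_smul, smul_smul]
  rw [Finset.sum_comm]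
  simp_rw [mul_comm]

/-! ### Scales and exponents -/

/-- Up to constants, the share of the scale-`r` neighbourhoods of the `n`-th hitting set inside the
unit cube that a single ball of radius `r` carries. -/
noncomputable def scaleMass (β : Fin d → ℝ) (n : ℕ) (γ : Fin d → EuclideanSpace ℝ (Fin d))
    (r : ℝ) : ℝ :=
  (∏ i, max r (β i ^ n)⁻¹) * ∏ i, min 1 (r / ‖γ i‖)

theorem scaleMass_pos {β : Fin d → ℝ} {n : ℕ} {γ : Fin d → EuclideanSpace ℝ (Fin d)} {r : ℝ}
    (hγ : ∀ i, γ i ≠ 0) (hr : 0 < r) : 0 < scaleMass β n γ r := by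
  refine mul_pos (Finset.prod_pos fun i _ => lt_max_of_lt_left hr)
    (Finset.prod_pos fun i _ => lt_min one_pos (div_pos hr (norm_pos_iff.2 (hγ i))))

theorem log_max {x y : ℝ} (hx : 0 < x) (hy : 0 < y) :
    Real.log (max x y) = max (Real.log x) (Real.log y) := by
  rcases le_total x y with h | h
  · rw [max_eq_right h, max_eq_right (Real.log_le_log hx h)]
  · rw [max_eq_left h, max_eq_left (Real.log_le_log hy h)]

theorem log_min {x y : ℝ} (hx : 0 < x) (hy : 0 < y) :
    Real.log (min x y) = min (Real.log x) (Real.log y) := by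
  rcases le_total x y with h | h
  · rw [min_eq_left h, min_eq_left (Real.log_le_log hx h)]
  · rw [min_eq_right h, min_eq_right (Real.log_le_log hy h)]

theorem log_scaleMass {β : Fin d → ℝ} (hβ : ∀ i, 1 < β i) {n : ℕ}
    {γ : Fin d → EuclideanSpace ℝ (Fin d)} {r : ℝ}
    (hγ : ∀ i, γ i ≠ 0) (hr : 0 < r) :
    Real.log (scaleMass β n γ r) = ∑ i, max (Real.log r) (Real.log (β i ^ n)⁻¹) +
      ∑ i, min 0 (Real.log r - Real.log ‖γ i‖) := by
  have h1 : ∀ i, 0 < (β i ^ n)⁻¹ := fun i => by have := hβ i; positivity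
  have h2 : ∀ i, 0 < r / ‖γ i‖ := fun i => div_pos hr (norm_pos_iff.2 (hγ i))
  rw [scaleMass, Real.log_mul, Real.log_prod, Real.log_prod]
  · congr 1
    · exact Finset.sum_congr rfl fun i _ => log_max hr (h1 i)
    · refine Finset.sum_congr rfl fun i _ => ?_
      rw [log_min one_pos (h2 i), Real.log_one, Real.log_div hr.ne' (norm_ne_zero_iff.2 (hγ i))]
  · exact fun i _ => (lt_min one_pos (h2 i)).ne'
  · exact fun i _ => (lt_max_of_lt_left hr).ne'
  · exact (Finset.prod_pos fun i _ => lt_max_of_lt_left hr).ne'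
  · exact (Finset.prod_pos fun i _ => lt_min one_pos (h2 i)).ne'

/-- Multiplying by `log τ` clears the denominators, and the case distinctions in the exponent become
the maxima and minima of logarithms in `log_scaleMass`. This is what turns the combinatorial formula
for `s_n` into a statement about the mass of balls. -/
theorem log_mul_scaleExponent {β : Fin d → ℝ} (hβ : ∀ i, 1 < β i) {n : ℕ}
    {γ : Fin d → EuclideanSpace ℝ (Fin d)} {τ : ℝ}
    (hγ : ∀ i, γ i ≠ 0) (hτ : 0 < τ) (hτ1 : τ < 1) :
    Real.log τ * scaleExponent β n γ τ = Real.log (scaleMass β n γ τ) := by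
  have hl : Real.log τ < 0 := Real.log_neg hτ hτ1
  rw [log_scaleMass hβ hγ hτ, scaleExponent, Finset.sum_filter, Finset.sum_filter,
    Finset.sum_filter, ← Finset.sum_add_distrib, mul_add, Finset.mul_sum, Finset.mul_sum]
  congr 1
  · refine Finset.sum_congr rfl fun i _ => ?_
    have hp : 0 < (β i ^ n)⁻¹ := by have := hβ i; positivity
    by_cases h : (β i ^ n)⁻¹ ≤ τ
    · rw [max_eq_left (Real.log_le_log hp h)]
      simp [h]
    · rw [max_eq_right (Real.log_le_log hτ (not_le.1 h).le)]
      simp only [h, not_false_eq_true, if_true, if_false, zero_add]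
      rw [Real.log_inv, Real.log_pow, mul_neg, mul_div_cancel₀ _ hl.ne]
  · refine Finset.sum_congr rfl fun i _ => ?_
    have hp : 0 < ‖γ i‖ := norm_pos_iff.2 (hγ i)
    split_ifs with h
    · have := Real.log_le_log hτ h
      rw [min_eq_right (by linarith), mul_sub, mul_one, mul_div_cancel₀ _ hl.ne]
    · have := Real.log_le_log hp (not_le.1 h).le
      rw [min_eq_left (by linarith), mul_zero]

theorem scaleMass_eq_rpow {β : Fin d → ℝ} (hβ : ∀ i, 1 < β i) {n : ℕ}
    {γ : Fin d → EuclideanSpace ℝ (Fin d)} {τ : ℝ}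
    (hγ : ∀ i, γ i ≠ 0) (hτ : 0 < τ) (hτ1 : τ < 1) :
    scaleMass β n γ τ = τ ^ scaleExponent β n γ τ := by
  rw [Real.rpow_def_of_pos hτ, log_mul_scaleExponent hβ hγ hτ hτ1,
    Real.exp_log (scaleMass_pos hγ hτ)]

/-- A piecewise linear function of the shape relevant here is non-positive on the negative half-line
as soon as it is so at its break points. -/
theorem piecewise_linear_nonpos [NeZero d] (b g : Fin d → ℝ) (s : ℝ) (hb : ∀ i, b i < 0)
    (hg : ∀ i, g i < 0)
    (hbH : ∀ k, ∑ i, max (b k) (b i) + ∑ i, min 0 (b k - g i) ≤ b k * s)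
    (hgH : ∀ k, ∑ i, max (g k) (b i) + ∑ i, min 0 (g k - g i) ≤ g k * s) {u : ℝ} (hu : u < 0) :
    ∑ i, max u (b i) + ∑ i, min 0 (u - g i) ≤ u * s := by
  classical
  set T : Finset ℝ := Finset.univ.image b ∪ Finset.univ.image g with hT
  have hbT : ∀ i, b i ∈ T := fun i =>
    Finset.mem_union_left _ (Finset.mem_image_of_mem _ (Finset.mem_univ i))
  have hgT : ∀ i, g i ∈ T := fun i =>
    Finset.mem_union_right _ (Finset.mem_image_of_mem _ (Finset.mem_univ i))
  have hTH : ∀ t ∈ T, t < 0 ∧ ∑ i, max t (b i) + ∑ i, min 0 (t - g i) ≤ t * s := by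
    intro t ht
    rcases Finset.mem_union.1 ht with h | h
    · obtain ⟨k, -, rfl⟩ := Finset.mem_image.1 h
      exact ⟨hb k, hbH k⟩
    · obtain ⟨k, -, rfl⟩ := Finset.mem_image.1 h
      exact ⟨hg k, hgH k⟩
  have hTne : T.Nonempty := ⟨_, hbT 0⟩
  have hbig : ∀ t, (∀ x ∈ T, x ≤ t) → ∑ i, max t (b i) + ∑ i, min 0 (t - g i) = d * t := by
    intro t ht
    rw [Finset.sum_congr rfl fun i _ => max_eq_left (ht _ (hbT i)),
      Finset.sum_congr rfl fun i _ => min_eq_left (sub_nonneg.2 (ht _ (hgT i)))]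
    simp
  -- At the largest break point `t` the left-hand side is `d * t` with `t < 0`. The inequality `s ≤
  -- d` settles everything to the right of the break points, and it makes the difference of the two
  -- sides nondecreasing to their left.
  have hsd : s ≤ d := by
    have h1 := hTH _ (T.max'_mem hTne)
    rw [hbig _ fun x hx => T.le_max' x hx] at h1
    nlinarith
  by_cases hB : ∀ x ∈ T, x ≤ u
  · rw [hbig u hB]
    nlinarith
  by_cases hA : ∀ x ∈ T, u ≤ x
  · set m := T.min' hTne
    have hm : ∀ x ∈ T, m ≤ x := fun x hx => T.min'_le x hx
    have hum : u ≤ m := hA _ (T.min'_mem hTne)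
    have h1 := (hTH _ (T.min'_mem hTne)).2
    have h2 : ∀ t, (∀ x ∈ T, t ≤ x) → ∑ i, max t (b i) + ∑ i, min 0 (t - g i) =
        ∑ i, b i + d * t - ∑ i, g i := by
      intro t ht
      rw [Finset.sum_congr rfl fun i _ => max_eq_right (ht _ (hbT i)),
        Finset.sum_congr rfl fun i _ => min_eq_right (sub_nonpos.2 (ht _ (hgT i)))]
      simp; ring
    rw [h2 u hA]
    rw [h2 _ hm] at h1
    nlinarith
  push Not at hA hB
  obtain ⟨y, hyT, hyu⟩ := hA
  obtain ⟨x, hxT, hxu⟩ := hB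
  have hne1 : (T.filter (· ≤ u)).Nonempty := ⟨y, Finset.mem_filter.2 ⟨hyT, hyu.le⟩⟩
  have hne2 : (T.filter (u ≤ ·)).Nonempty := ⟨x, Finset.mem_filter.2 ⟨hxT, hxu.le⟩⟩
  obtain ⟨p, hp, hpm⟩ : ∃ p ∈ T.filter (· ≤ u), ∀ x ∈ T.filter (· ≤ u), x ≤ p :=
    ⟨_, Finset.max'_mem _ hne1, fun x hx => Finset.le_max' _ x hx⟩
  obtain ⟨q, hq, hqm⟩ : ∃ q ∈ T.filter (u ≤ ·), ∀ x ∈ T.filter (u ≤ ·), q ≤ x :=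
    ⟨_, Finset.min'_mem _ hne2, fun x hx => Finset.min'_le _ x hx⟩
  obtain ⟨hpT, hpu⟩ := Finset.mem_filter.1 hp
  obtain ⟨hqT, huq⟩ := Finset.mem_filter.1 hq
  rcases (hpu.trans huq).eq_or_lt with heq | hlt
  · have : u = p := le_antisymm (heq ▸ huq) hpu
    rw [this]
    exact (hTH p hpT).2
  -- Between the adjacent break points `p` and `q` the max terms are convex and the min terms
  -- affine, as no `g i` lies strictly between. The sum is thus below its chord.
  have hmax : ∀ i, (q - p) * max u (b i) ≤ (q - u) * max p (b i) + (u - p) * max q (b i) := by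
    intro i
    rcases max_cases u (b i) with ⟨h, -⟩ | ⟨h, -⟩ <;> rw [h]
    · nlinarith [le_max_left p (b i), le_max_left q (b i)]
    · nlinarith [le_max_right p (b i), le_max_right q (b i)]
  have hmin : ∀ i, (q - p) * min 0 (u - g i) ≤
      (q - u) * min 0 (p - g i) + (u - p) * min 0 (q - g i) := by
    intro i
    rcases le_total (g i) u with h | h
    · have := hpm _ (Finset.mem_filter.2 ⟨hgT i, h⟩)
      rw [min_eq_left (by linarith), min_eq_left (by linarith), min_eq_left (by linarith)]
      linarith
    · have := hqm _ (Finset.mem_filter.2 ⟨hgT i, h⟩)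
      rw [min_eq_right (by linarith), min_eq_right (by linarith), min_eq_right (by linarith)]
      linarith
  have key : (q - p) * (∑ i, max u (b i) + ∑ i, min 0 (u - g i)) ≤
      (q - u) * (∑ i, max p (b i) + ∑ i, min 0 (p - g i)) +
      (u - p) * (∑ i, max q (b i) + ∑ i, min 0 (q - g i)) := by
    have e1 := Finset.sum_le_sum fun i (_ : i ∈ Finset.univ) => hmax i
    have e2 := Finset.sum_le_sum fun i (_ : i ∈ Finset.univ) => hmin i
    simp only [Finset.sum_add_distrib, ← Finset.mul_sum] at e1 e2
    linarith
  have h3 := mul_le_mul_of_nonneg_left (hTH p hpT).2 (sub_nonneg.2 huq)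
  have h4 := mul_le_mul_of_nonneg_left (hTH q hqT).2 (sub_nonneg.2 hpu)
  have h5 : (q - p) * (∑ i, max u (b i) + ∑ i, min 0 (u - g i)) ≤ (q - p) * (u * s) := by
    refine key.trans ((add_le_add h3 h4).trans (le_of_eq (by ring)))
  exact le_of_mul_le_mul_left h5 (sub_pos.2 hlt)

theorem inv_pow_mem_scales (β : Fin d → ℝ) (n : ℕ) (γ : Fin d → EuclideanSpace ℝ (Fin d))
    (i : Fin d) : (β i ^ n)⁻¹ ∈ scales β n γ :=
  Finset.mem_union_left _ (Finset.mem_image_of_mem _ (Finset.mem_univ i))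

theorem norm_mem_scales (β : Fin d → ℝ) (n : ℕ) (γ : Fin d → EuclideanSpace ℝ (Fin d))
    (i : Fin d) : ‖γ i‖ ∈ scales β n γ :=
  Finset.mem_union_right _ (Finset.mem_image_of_mem _ (Finset.mem_univ i))

theorem scales_pos {β : Fin d → ℝ} (hβ : ∀ i, 1 < β i) {n : ℕ}
    {γ : Fin d → EuclideanSpace ℝ (Fin d)} (hγ : ∀ i, γ i ≠ 0) {τ : ℝ} (hτ : τ ∈ scales β n γ) :
    0 < τ := by
  rcases Finset.mem_union.1 hτ with h | h
  · obtain ⟨k, -, rfl⟩ := Finset.mem_image.1 h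
    have := hβ k
    positivity
  · obtain ⟨k, -, rfl⟩ := Finset.mem_image.1 h
    exact norm_pos_iff.2 (hγ k)

/-- The minimum of the exponents over the scales is the minimum over all `r ∈ (0, 1)`. -/
theorem scaleMass_le_rpow [NeZero d] {β : Fin d → ℝ} (hβ : ∀ i, 1 < β i) {n : ℕ}
    {γ : Fin d → EuclideanSpace ℝ (Fin d)} (hγ : ∀ i, γ i ≠ 0) (hs : ∀ τ ∈ scales β n γ, τ < 1)
    {r : ℝ} (hr : 0 < r) (hr1 : r < 1) :
    scaleMass β n γ r ≤ r ^ minExponent β n γ := by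
  have hbr : ∀ τ ∈ scales β n γ, Real.log τ < 0 ∧
      ∑ i, max (Real.log τ) (Real.log (β i ^ n)⁻¹) + ∑ i, min 0 (Real.log τ - Real.log ‖γ i‖) ≤
        Real.log τ * minExponent β n γ := by
    intro τ hτ
    have hpos := scales_pos hβ hγ hτ
    have hl := Real.log_neg hpos (hs τ hτ)
    refine ⟨hl, ?_⟩
    rw [← log_scaleMass hβ hγ hpos, ← log_mul_scaleExponent hβ hγ hpos (hs τ hτ)]
    exact mul_le_mul_of_nonpos_left (Finset.inf'_le _ hτ) hl.le
  rw [Real.rpow_def_of_pos hr, ← Real.log_le_iff_le_exp (scaleMass_pos hγ hr),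
    log_scaleMass hβ hγ hr]
  exact piecewise_linear_nonpos _ _ _ (fun i => (hbr _ (inv_pow_mem_scales β n γ i)).1)
    (fun i => (hbr _ (norm_mem_scales β n γ i)).1)
    (fun i => (hbr _ (inv_pow_mem_scales β n γ i)).2)
    (fun i => (hbr _ (norm_mem_scales β n γ i)).2) (Real.log_neg hr hr1)

/-- The minimal exponent is attained at one of the scales. -/
theorem exists_scale_rpow_eq [NeZero d] {β : Fin d → ℝ} (hβ : ∀ i, 1 < β i) {n : ℕ}
    {γ : Fin d → EuclideanSpace ℝ (Fin d)} (hγ : ∀ i, γ i ≠ 0)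
    (hs : ∀ τ ∈ scales β n γ, τ < 1) :
    ∃ τ ∈ scales β n γ, scaleMass β n γ τ = τ ^ minExponent β n γ := by
  obtain ⟨τ, hτ, h⟩ := Finset.exists_mem_eq_inf' (scales_nonempty β n γ) (scaleExponent β n γ)
  exact ⟨τ, hτ, by
    rw [scaleMass_eq_rpow hβ hγ (scales_pos hβ hγ hτ) (hs τ hτ), minExponent, h]⟩

/-- All summands are non-negative when the scales are below 1. At the largest scale every `β i`
factor counts 1 and the `γ` terms contribute nothing in total, so the exponent there is exactly `d`.
-/
theorem minExponent_mem_Icc [NeZero d] {β : Fin d → ℝ} (hβ : ∀ i, 1 < β i) {n : ℕ}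
    {γ : Fin d → EuclideanSpace ℝ (Fin d)} (hγ : ∀ i, γ i ≠ 0)
    (hs : ∀ τ ∈ scales β n γ, τ < 1) : minExponent β n γ ∈ Icc (0 : ℝ) d := by
  constructor
  · refine Finset.le_inf' _ _ fun τ hτ => ?_
    have hpos := scales_pos hβ hγ hτ
    have hl := Real.log_neg hpos (hs τ hτ)
    refine add_nonneg (add_nonneg (Finset.sum_nonneg fun _ _ => zero_le_one)
      (Finset.sum_nonneg fun i _ => ?_)) (Finset.sum_nonneg fun i hi => ?_)
    · exact neg_nonneg.2 (div_nonpos_of_nonneg_of_nonpos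
        (mul_nonneg n.cast_nonneg (Real.log_pos (hβ i)).le) hl.le)
    · have := Real.log_le_log hpos (Finset.mem_filter.1 hi).2
      rw [sub_nonneg, div_le_one_of_neg hl]
      exact this
  · set τ := (scales β n γ).max' (scales_nonempty β n γ)
    have hτ : τ ∈ scales β n γ := Finset.max'_mem _ _
    have hpos := scales_pos hβ hγ hτ
    have hl := Real.log_neg hpos (hs τ hτ)
    have h1 : minExponent β n γ ≤ scaleExponent β n γ τ := Finset.inf'_le _ hτ
    refine h1.trans (le_of_eq ?_)
    have hle : ∀ x ∈ scales β n γ, x ≤ τ := fun x hx => Finset.le_max' _ x hx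
    have h2 := log_mul_scaleExponent (n := n) hβ hγ hpos (hs τ hτ)
    rw [log_scaleMass hβ hγ hpos, Finset.sum_congr rfl fun i _ => max_eq_left
        (Real.log_le_log (scales_pos hβ hγ (inv_pow_mem_scales β n γ i))
          (hle _ (inv_pow_mem_scales β n γ i))),
      Finset.sum_congr rfl fun i _ => min_eq_left (sub_nonneg.2
        (Real.log_le_log (scales_pos hβ hγ (norm_mem_scales β n γ i))
          (hle _ (norm_mem_scales β n γ i))))] at h2
    simp only [Finset.sum_const, Finset.card_univ, Fintype.card_fin, nsmul_eq_mul, smul_zero,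
      add_zero] at h2
    exact mul_left_cancel₀ hl.ne (by rw [h2]; ring)

/-! ### Contracted parallelepipeds in the frame -/

theorem norm_le_card_mul {x : EuclideanSpace ℝ (Fin d)} {c : ℝ} (h : ∀ i, |x i| ≤ c) :
    ‖x‖ ≤ d * c := by
  have h1 : x = ∑ i, x i • EuclideanSpace.single i (1 : ℝ) := by
    ext j
    simp [Finset.sum_apply, Pi.single_apply]
  rw [h1]
  refine (norm_sum_le _ _).trans ?_
  calc ∑ i, ‖x i • EuclideanSpace.single i (1 : ℝ)‖ ≤ ∑ _i : Fin d, c := by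
        refine Finset.sum_le_sum fun i _ => ?_
        rw [norm_smul]
        simpa using h i
    _ = d * c := by simp

/-- The linear map `fⁿ` as a bundled map. -/
noncomputable def contractionLin (β : Fin d → ℝ) (n : ℕ) :
    EuclideanSpace ℝ (Fin d) →ₗ[ℝ] EuclideanSpace ℝ (Fin d) where
  toFun := contraction β n
  map_add' x y := by ext i; simp [contraction, mul_add]
  map_smul' c x := by ext i; simp [contraction]; ring

theorem contractionLin_injective {β : Fin d → ℝ} (hβ : ∀ i, 1 < β i) (n : ℕ) :
    Function.Injective (contractionLin β n) := by
  intro x y h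
  ext i
  have h1 : (β i ^ n)⁻¹ * x i = (β i ^ n)⁻¹ * y i :=
    congrArg (fun z : EuclideanSpace ℝ (Fin d) => z i) h
  have : (β i ^ n)⁻¹ ≠ 0 := by have := hβ i; positivity
  exact mul_left_cancel₀ this h1

theorem isOpen_parallelepiped_image {α : Fin d → EuclideanSpace ℝ (Fin d)}
    (hα : LinearIndependent ℝ α) (v : EuclideanSpace ℝ (Fin d)) :
    IsOpen ((fun x : Fin d → ℝ => v + ∑ i, x i • α i) '' {x | ∀ i, x i ∈ Ioo (0 : ℝ) 1}) := by
  have hinj : Function.Injective (Fintype.linearCombination ℝ α) :=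
    linearIndependent_iff_injective_fintypeLinearCombination.1 hα
  have hsurj : Function.Surjective (Fintype.linearCombination ℝ α) :=
    (LinearMap.injective_iff_surjective_of_finrank_eq_finrank (by simp)).1 hinj
  have hopen := (Fintype.linearCombination ℝ α).isOpenMap_of_finiteDimensional hsurj
  have hU : IsOpen {x : Fin d → ℝ | ∀ i, x i ∈ Ioo (0 : ℝ) 1} := by
    have := isOpen_set_pi (s := fun _ : Fin d => Ioo (0 : ℝ) 1) (i := univ) finite_univ
      fun _ _ => isOpen_Ioo
    simpa [Set.pi] using this
  exact ((isOpenMap_add_left v).comp hopen) _ hU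

theorem IsParallelepiped.mem_interior {P : Set (EuclideanSpace ℝ (Fin d))}
    {v : EuclideanSpace ℝ (Fin d)} {α : Fin d → EuclideanSpace ℝ (Fin d)}
    (hP : IsParallelepiped P v α) {x : Fin d → ℝ} (hx : ∀ i, x i ∈ Ioo (0 : ℝ) 1) :
    v + ∑ i, x i • α i ∈ interior P := by
  refine interior_maximal hP.2.1 isOpen_interior (interior_maximal ?_
    (isOpen_parallelepiped_image hP.1 v) ⟨x, hx, rfl⟩)
  rintro _ ⟨y, hy, rfl⟩
  exact ⟨_, (mem_parallelepiped_iff _ _).2 ⟨y, ⟨fun i => (hy i).1.le, fun i => (hy i).2.le⟩, rfl⟩,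
    rfl⟩

/-- Two interior points whose `j`-th parameters are 1/4 and 3/4 differ by half the edge, and both
lie in the unit cube. Interior points avoid any question about the boundary. -/
theorem IsParallelepiped.abs_edge_le {P : Set (EuclideanSpace ℝ (Fin d))}
    {v : EuclideanSpace ℝ (Fin d)} {α : Fin d → EuclideanSpace ℝ (Fin d)}
    (hP : IsParallelepiped P v α) (hc : P ⊆ unitCube d) (j i : Fin d) : |α j i| ≤ 2 := by
  have h : ∀ t ∈ Ioo (0 : ℝ) 1, ∀ i,
      0 ≤ (v + ∑ k, Function.update (fun _ => (1 / 2 : ℝ)) j t k • α k) i ∧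
      (v + ∑ k, Function.update (fun _ => (1 / 2 : ℝ)) j t k • α k) i < 1 := by
    intro t ht
    refine hc (interior_subset (hP.mem_interior fun k => ?_))
    by_cases hk : k = j
    · subst hk; simpa using ht
    · simp [hk]; norm_num
  have e : ∀ t, (v + ∑ k, Function.update (fun _ => (1 / 2 : ℝ)) j t k • α k) i =
      v i + ∑ k ∈ Finset.univ.erase j, (1 / 2 : ℝ) * α k i + t * α j i := by
    intro t
    rw [← Finset.sum_erase_add _ _ (Finset.mem_univ j)]
    simp only [PiLp.add_apply, PiLp.smul_apply, WithLp.ofLp_sum, Finset.sum_apply, smul_eq_mul,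
      Function.update_self]
    rw [← add_assoc]
    congr 2
    refine Finset.sum_congr rfl fun k hk => ?_
    rw [Function.update_of_ne (Finset.ne_of_mem_erase hk)]
  have h1 := h (1 / 4) (by norm_num) i
  have h2 := h (3 / 4) (by norm_num) i
  rw [e] at h1 h2
  rw [abs_le]
  constructor <;> linarith [h1.1, h1.2, h2.1, h2.2]

/-- A description of the contracted target `fⁿ P` in the orthogonal frame `γ`. -/
structure IsFrame (β : Fin d → ℝ) (n : ℕ) (P : Set (EuclideanSpace ℝ (Fin d)))
    (γ : Fin d → EuclideanSpace ℝ (Fin d)) (w : EuclideanSpace ℝ (Fin d))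
    (M : Matrix (Fin d) (Fin d) ℝ) : Prop where
  ne_zero : ∀ k, γ k ≠ 0
  orthogonal : Pairwise fun i j => inner ℝ (γ i) (γ j) = (0 : ℝ)
  det_eq : M.det = 1
  abs_le : ∀ j k, |M j k| ≤ 1
  exists_mem : ∀ x : Fin d → ℝ, (∀ k, x k ∈ Ioo (0 : ℝ) 1) →
    ∃ p ∈ interior P, contraction β n p = w + ∑ j, M.mulVec x j • γ j
  exists_coord : ∀ p ∈ P, ∃ x : Fin d → ℝ, (∀ k, x k ∈ Icc (0 : ℝ) 1) ∧
    contraction β n p = w + ∑ j, M.mulVec x j • γ j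

theorem exists_isFrame {β : Fin d → ℝ} (hβ : ∀ i, 1 < β i) {n : ℕ}
    {P : Set (EuclideanSpace ℝ (Fin d))} {v : EuclideanSpace ℝ (Fin d)}
    {α γ : Fin d → EuclideanSpace ℝ (Fin d)} (hP : IsParallelepiped P v α)
    (hγ : IsPivotedGramSchmidt (fun j => contraction β n (α j)) γ) :
    ∃ w M, IsFrame β n P γ w M := by
  have hind : LinearIndependent ℝ (fun j => contraction β n (α j)) :=
    hP.1.map' (contractionLin β n) (LinearMap.ker_eq_bot.2 (contractionLin_injective hβ n))
  obtain ⟨h1, h2, -, σ, M, hdet, hM, hsum⟩ := hγ.exists_matrix hind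
  have key : ∀ x : Fin d → ℝ, contraction β n (v + ∑ k, x k • α (σ k)) =
      contraction β n v + ∑ j, M.mulVec x j • γ j := by
    intro x
    rw [← sum_smul_perm_eq (a := fun j => contraction β n (α j)) hsum x]
    change contractionLin β n _ = contractionLin β n v + ∑ k, x k • contractionLin β n _
    simp [map_add, map_sum]
  refine ⟨contraction β n v, M, h1, h2, hdet, hM, fun x hx => ?_, fun p hp => ?_⟩
  · refine ⟨_, hP.mem_interior (x := x ∘ σ.symm) fun i => hx _, ?_⟩
    rw [← key, ← Equiv.sum_comp σ]
    simp
  · obtain ⟨q, hq, rfl⟩ := hP.2.2 hp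
    obtain ⟨t, ht, rfl⟩ := (mem_parallelepiped_iff _ _).1 hq
    refine ⟨t ∘ σ, fun k => ⟨ht.1 _, ht.2 _⟩, ?_⟩
    rw [← key, ← Equiv.sum_comp σ]
    rfl

/-- Each `γ k` is no longer than some contracted edge, so all scales decay geometrically in `n`.
Eventually they are below 1 and have negative logarithms. -/
theorem scales_le {β : Fin d → ℝ} (hβ : ∀ i, 1 < β i) {n : ℕ}
    {P : Set (EuclideanSpace ℝ (Fin d))} {v : EuclideanSpace ℝ (Fin d)}
    {α γ : Fin d → EuclideanSpace ℝ (Fin d)} (hP : IsParallelepiped P v α) (hc : P ⊆ unitCube d)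
    (hγ : IsPivotedGramSchmidt (fun j => contraction β n (α j)) γ) {ρ : ℝ}
    (hρ : ∀ i, (β i)⁻¹ ≤ ρ) {τ : ℝ} (hτ : τ ∈ scales β n γ) : τ ≤ d * (2 * ρ ^ n) := by
  have hpow : ∀ i, (β i ^ n)⁻¹ ≤ ρ ^ n := fun i => by
    rw [← inv_pow]
    exact pow_le_pow_left₀ (by have := hβ i; positivity) (hρ i) n
  have hpos : ∀ i, 0 < (β i ^ n)⁻¹ := fun i => by have := hβ i; positivity
  have hind : LinearIndependent ℝ (fun j => contraction β n (α j)) :=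
    hP.1.map' (contractionLin β n) (LinearMap.ker_eq_bot.2 (contractionLin_injective hβ n))
  rcases Finset.mem_union.1 hτ with h | h
  · obtain ⟨k, -, rfl⟩ := Finset.mem_image.1 h
    have hd : (1 : ℝ) ≤ d := by exact_mod_cast Fin.pos k
    nlinarith [hpow k, hpos k]
  · obtain ⟨k, -, rfl⟩ := Finset.mem_image.1 h
    obtain ⟨j, hj⟩ := (hγ.exists_matrix hind).2.2.1 k
    refine hj.trans (norm_le_card_mul fun i => ?_)
    change |(β i ^ n)⁻¹ * α j i| ≤ _
    rw [abs_mul, abs_of_pos (hpos i), mul_comm 2]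
    exact mul_le_mul (hpow i) (hP.abs_edge_le hc j i) (abs_nonneg _) ((hpos i).le.trans (hpow i))

/-! ### Coverings of the hitting sets -/

/-- Points of the hitting set are sorted by a finite label. In each coordinate it records the branch
if `τ < β_i⁻ⁿ`, and a grid cell of side `τ` otherwise; it also records grid cells of width `τ / ‖γ
j‖` for the frame coordinates. Equal labels force distance at most `d * (d * τ)`, and the number of
labels is at most a polynomial in `n` divided by `scaleMass`. -/
theorem IsFrame.exists_cover {β : Fin d → ℝ} (hβ : ∀ i, 1 < β i) {n : ℕ}
    {P : Set (EuclideanSpace ℝ (Fin d))} {γ : Fin d → EuclideanSpace ℝ (Fin d)}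
    {w : EuclideanSpace ℝ (Fin d)} {M : Matrix (Fin d) (Fin d) ℝ} (hF : IsFrame β n P γ w M)
    {τ : ℝ} (hτ : 0 < τ) (hτ1 : τ < 1) :
    ∃ (N : ℕ) (t : Fin N → Set (EuclideanSpace ℝ (Fin d))),
      (hitSet β n P ⊆ ⋃ i, t i) ∧
      (∀ i, Metric.ediam (t i) ≤ ENNReal.ofReal (d * (d * τ))) ∧
      (N : ℝ) * scaleMass β n γ τ ≤ (2 * (n + 1) * (2 * d + 2)) ^ d := by
  classical
  have hγ0 : ∀ j, 0 < ‖γ j‖ := fun j => norm_pos_iff.2 (hF.ne_zero j)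
  have hb : ∀ i, 0 < (β i ^ n)⁻¹ := fun i => by have := hβ i; positivity
  have hz : ∀ x : EuclideanSpace ℝ (Fin d), ∃ z : Fin d → ℝ, x ∈ hitSet β n P →
      (∀ j, |z j| ≤ d) ∧ ∀ i, x i = (β i ^ n)⁻¹ * (β i ^ n * x i - (betaFract (β i))^[n] (x i)) +
        w i + (∑ j, z j • γ j) i := by
    intro x
    by_cases hx : x ∈ hitSet β n P
    · obtain ⟨u, hu, hu'⟩ := hF.exists_coord _ hx.2
      refine ⟨M.mulVec u, fun _ => ⟨fun j => abs_mulVec_le hF.abs_le hu j, fun i => ?_⟩⟩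
      have h1 := congrArg (fun q : EuclideanSpace ℝ (Fin d) => q i) hu'
      simp only [contraction, betaMap_iterate_apply, PiLp.add_apply] at h1
      have h2 : (β i ^ n)⁻¹ * (β i ^ n * x i) = x i :=
        inv_mul_cancel_left₀ (inv_pos.1 (hb i)).ne' _
      rw [mul_sub, h2]
      linarith
    · exact ⟨0, fun h => absurd h hx⟩
  choose z hz using hz
  have hF1 : ∀ i, ∃ S : Finset ℝ, (S.card : ℝ) * max τ (β i ^ n)⁻¹ ≤ 2 * (n + 1) ∧
      ∀ x ∈ Ico (0 : ℝ) 1, (if τ < (β i ^ n)⁻¹ then β i ^ n * x - (betaFract (β i))^[n] x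
        else ((⌊x / τ⌋ : ℤ) : ℝ)) ∈ S := by
    intro i
    by_cases h : τ < (β i ^ n)⁻¹
    · obtain ⟨S, hS, hS'⟩ := exists_branch_finset (hβ i) n 1 one_pos le_rfl
      refine ⟨S, ?_, fun x hx => ?_⟩
      · rw [max_eq_right h.le]
        have h1 : 1 ≤ β i ^ n := one_le_pow₀ (hβ i).le
        calc (S.card : ℝ) * (β i ^ n)⁻¹ ≤ (1 + 1 * n * β i ^ n) * (β i ^ n)⁻¹ := by
              gcongr
          _ ≤ ((n + 1) * β i ^ n) * (β i ^ n)⁻¹ := by gcongr; linarith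
          _ = n + 1 := by field_simp
          _ ≤ 2 * (n + 1) := by linarith [(n.cast_nonneg : (0 : ℝ) ≤ n)]
      · rw [if_pos h]; exact hS' x hx.1 hx.2
    · refine ⟨(Finset.Icc (0 : ℤ) ⌊1 / τ⌋).image fun k : ℤ => (k : ℝ), ?_, fun x hx => ?_⟩
      · rw [max_eq_left (not_lt.1 h)]
        have h0 : (0 : ℤ) ≤ ⌊1 / τ⌋ := Int.floor_nonneg.2 (by positivity)
        have hc : (((Finset.Icc (0 : ℤ) ⌊1 / τ⌋).image fun k : ℤ => (k : ℝ)).card : ℝ) ≤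
            1 / τ + 1 := by
          have h1 : (((Finset.Icc (0 : ℤ) ⌊1 / τ⌋).image fun k : ℤ => (k : ℝ)).card : ℝ) ≤
              ((⌊1 / τ⌋ + 1 - 0).toNat : ℝ) := by
            exact_mod_cast Finset.card_image_le.trans (by rw [Int.card_Icc])
          have h2 : ((⌊1 / τ⌋ + 1 - 0).toNat : ℝ) = (⌊1 / τ⌋ : ℝ) + 1 := by
            have : ((⌊1 / τ⌋ + 1 - 0).toNat : ℤ) = ⌊1 / τ⌋ + 1 := by
              rw [Int.toNat_of_nonneg] <;> omega
            exact_mod_cast this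
          have := Int.floor_le (1 / τ)
          linarith
        calc _ ≤ (1 / τ + 1) * τ := by gcongr
          _ = 1 + τ := by field_simp
          _ ≤ 2 * (n + 1) := by linarith [(n.cast_nonneg : (0 : ℝ) ≤ n)]
      · rw [if_neg h]
        refine Finset.mem_image_of_mem _ (Finset.mem_Icc.2 ⟨Int.floor_nonneg.2 ?_, ?_⟩)
        · exact div_nonneg hx.1 hτ.le
        · exact Int.floor_le_floor (by gcongr; exact hx.2.le)
  choose S hS hS' using hF1
  -- The frame coordinates lie in `[-d, d]`, which bounds the indices of the cells of width `τ / ‖γ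
  -- j‖`.
  set G : Fin d → Finset ℤ := fun j =>
    Finset.Icc ⌊-((d : ℝ) * (‖γ j‖ / τ))⌋ ⌊(d : ℝ) * (‖γ j‖ / τ)⌋ with hG
  have hGc : ∀ j, ((G j).card : ℝ) * min 1 (τ / ‖γ j‖) ≤ 2 * d + 2 := by
    intro j
    have hx : 0 ≤ (d : ℝ) * (‖γ j‖ / τ) := by have := hγ0 j; positivity
    set q := (d : ℝ) * (‖γ j‖ / τ)
    have hc : ((G j).card : ℝ) ≤ 2 * q + 2 := by
      rw [hG, Int.card_Icc]
      have h1 : ⌊-q⌋ ≤ ⌊q⌋ := Int.floor_le_floor (by linarith)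
      have h2 : ((⌊q⌋ + 1 - ⌊-q⌋).toNat : ℝ) = (⌊q⌋ : ℝ) + 1 - ⌊-q⌋ := by
        have : ((⌊q⌋ + 1 - ⌊-q⌋).toNat : ℤ) = ⌊q⌋ + 1 - ⌊-q⌋ := by
          rw [Int.toNat_of_nonneg]; omega
        exact_mod_cast this
      rw [h2]
      linarith [Int.floor_le q, Int.sub_one_lt_floor (-q)]
    have hm0 : 0 ≤ min 1 (τ / ‖γ j‖) := by have := hγ0 j; positivity
    calc ((G j).card : ℝ) * min 1 (τ / ‖γ j‖) ≤ (2 * q + 2) * min 1 (τ / ‖γ j‖) := by gcongr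
      _ = 2 * d * ((‖γ j‖ / τ) * min 1 (τ / ‖γ j‖)) + 2 * min 1 (τ / ‖γ j‖) := by
          simp only [q]; ring
      _ ≤ 2 * d * ((‖γ j‖ / τ) * (τ / ‖γ j‖)) + 2 * 1 := by
          gcongr
          · exact min_le_right _ _
          · exact min_le_left _ _
      _ = 2 * d + 2 := by have := hγ0 j; field_simp
  set key : EuclideanSpace ℝ (Fin d) → (Fin d → ℝ) × (Fin d → ℤ) := fun x =>
    (fun i => if τ < (β i ^ n)⁻¹ then β i ^ n * x i - (betaFract (β i))^[n] (x i)
        else ((⌊x i / τ⌋ : ℤ) : ℝ), fun j => ⌊z x j * (‖γ j‖ / τ)⌋) with hkey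
  set I := Fintype.piFinset S ×ˢ Fintype.piFinset G
  have hmem : ∀ x ∈ hitSet β n P, key x ∈ I := by
    intro x hx
    refine Finset.mem_product.2 ⟨Fintype.mem_piFinset.2 fun i => hS' i _ (hx.1 i),
      Fintype.mem_piFinset.2 fun j => ?_⟩
    have h1 := _root_.abs_le.1 ((hz x hx).1 j)
    have h2 : 0 ≤ ‖γ j‖ / τ := by have := hγ0 j; positivity
    exact Finset.mem_Icc.2 ⟨Int.floor_le_floor (by nlinarith), Int.floor_le_floor (by nlinarith)⟩
  have hfl : ∀ a b : ℝ, ⌊a⌋ = ⌊b⌋ → |a - b| ≤ 1 := fun a b h =>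
    (Int.abs_sub_lt_one_of_floor_eq_floor h).le
  have hdist : ∀ x ∈ hitSet β n P, ∀ y ∈ hitSet β n P, key x = key y →
      dist x y ≤ d * (d * τ) := by
    intro x hx y hy hxy
    rw [dist_eq_norm]
    refine norm_le_card_mul fun i => ?_
    have hd : (1 : ℝ) ≤ d := by exact_mod_cast Fin.pos i
    have h1 := congrFun (congrArg Prod.fst hxy) i
    simp only [hkey] at h1
    rw [PiLp.sub_apply]
    split_ifs at h1 with h
    -- On a common branch the displacement is the difference of the two frame vectors, whose `d`
    -- terms have length at most `τ` each.
    · have e : x i - y i = (∑ j, (z x j - z y j) • γ j) i := by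
        have e1 := (hz x hx).2 i
        have e2 := (hz y hy).2 i
        rw [h1] at e1
        simp only [sub_smul, Finset.sum_sub_distrib, PiLp.sub_apply]
        linarith
      rw [e]
      have e' := PiLp.norm_apply_le (∑ j, (z x j - z y j) • γ j) i
      rw [Real.norm_eq_abs] at e'
      refine e'.trans ((norm_sum_le _ _).trans ?_)
      calc ∑ j, ‖(z x j - z y j) • γ j‖ ≤ ∑ _j : Fin d, τ := by
            refine Finset.sum_le_sum fun j _ => ?_
            have h2 := hfl _ _ (congrFun (congrArg Prod.snd hxy) j)
            rw [← sub_mul, abs_mul, abs_of_pos (div_pos (hγ0 j) hτ), mul_div_assoc',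
              div_le_one hτ] at h2
            rwa [norm_smul, Real.norm_eq_abs]
        _ = d * τ := by simp
    · have h2 := hfl _ _ (Int.cast_injective h1)
      rw [← sub_div, abs_div, abs_of_pos hτ, div_le_one hτ] at h2
      nlinarith
  refine ⟨I.card, fun k => {x | x ∈ hitSet β n P ∧ key x = (I.equivFin.symm k : _)},
    fun x hx => ?_, fun k => Metric.ediam_le fun x hx y hy => ?_, ?_⟩
  · exact mem_iUnion.2 ⟨I.equivFin ⟨key x, hmem x hx⟩, hx, by simp⟩
  · rw [edist_dist]
    exact ENNReal.ofReal_le_ofReal (hdist x hx.1 y hy.1 (hx.2.trans hy.2.symm))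
  · have e : ((I.card : ℕ) : ℝ) * scaleMass β n γ τ =
        (∏ i, ((S i).card : ℝ) * max τ (β i ^ n)⁻¹) *
          ∏ j, ((G j).card : ℝ) * min 1 (τ / ‖γ j‖) := by
      rw [Finset.card_product, Fintype.card_piFinset, Fintype.card_piFinset, scaleMass,
        Finset.prod_mul_distrib, Finset.prod_mul_distrib]
      push_cast
      ring
    rw [e, mul_pow]
    have c1 : ∏ i, ((S i).card : ℝ) * max τ (β i ^ n)⁻¹ ≤ (2 * (n + 1)) ^ d := by
      calc _ ≤ ∏ _i : Fin d, (2 * ((n : ℝ) + 1)) :=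
            Finset.prod_le_prod (fun i _ => by positivity) fun i _ => hS i
        _ = _ := by simp
    have c2 : ∏ j, ((G j).card : ℝ) * min 1 (τ / ‖γ j‖) ≤ (2 * d + 2) ^ d := by
      calc _ ≤ ∏ _i : Fin d, (2 * (d : ℝ) + 2) :=
            Finset.prod_le_prod (fun j _ => by have := hγ0 j; positivity) fun i _ => hGc i
        _ = _ := by simp
    exact mul_le_mul c1 c2 (Finset.prod_nonneg fun j _ => by have := hγ0 j; positivity)
      (by positivity)

open MeasureTheory Measure in
/-- A covering bound for the Hausdorff dimension of an upper limit of sets. -/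
theorem dimH_frequently_le (A : ℕ → Set (EuclideanSpace ℝ (Fin d))) (s : ℝ≥0) (q r δ : ℕ → ℝ)
    (hq : Summable q) (hr : Tendsto r atTop (nhds 0)) (hra : Antitone r) (n₀ : ℕ)
    (hδ : ∀ n, n₀ ≤ n → 0 ≤ δ n ∧ δ n ≤ r n)
    (h : ∀ n, n₀ ≤ n → ∃ (N : ℕ) (t : Fin N → Set (EuclideanSpace ℝ (Fin d))),
      (A n ⊆ ⋃ i, t i) ∧ (∀ i, Metric.ediam (t i) ≤ ENNReal.ofReal (δ n)) ∧
      (N : ℝ) * δ n ^ (s : ℝ) ≤ q n) :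
    dimH {x | ∃ᶠ n in atTop, x ∈ A n} ≤ s := by
  choose! N t h1 h2 h3 using h
  refine dimH_le_of_hausdorffMeasure_ne_top
    (ne_top_of_le_ne_top (b := ∑' n, ENNReal.ofReal (q (n + n₀))) ?_ ?_)
  · have := (summable_nat_add_iff n₀).2 hq
    exact this.tsum_ofReal_ne_top
  · have hr' : Tendsto (fun m => ENNReal.ofReal (r m)) atTop (nhds 0) := by
      simpa [Function.comp_def] using (ENNReal.continuous_ofReal.tendsto 0).comp hr
    -- The covers of all `A n` with `n ≥ m` together cover the upper limit. Their mesh tends to 0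
    -- with `m`, and their cost is bounded by one convergent sum, so the measure is finite.
    refine (hausdorffMeasure_le_liminf_tsum (ι := fun m : ℕ => Σ k : ℕ, Fin (N (m + k))) (s : ℝ) _
      _ hr' (fun m p => t (m + p.1) p.2) ?_ ?_).trans ?_
    · filter_upwards [eventually_ge_atTop n₀] with m hm p
      refine (h2 _ (by omega) _).trans (ENNReal.ofReal_le_ofReal ?_)
      exact (hδ _ (by omega)).2.trans (hra (by omega))
    · filter_upwards [eventually_ge_atTop n₀] with m hm x hx
      obtain ⟨n, hn, hxn⟩ := (frequently_atTop.1 hx) m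
      obtain ⟨k, rfl⟩ := Nat.exists_eq_add_of_le hn
      obtain ⟨i, hi⟩ := mem_iUnion.1 (h1 _ (by omega) hxn)
      exact mem_iUnion.2 ⟨⟨k, i⟩, hi⟩
    · refine liminf_le_of_frequently_le' (Eventually.frequently ?_)
      filter_upwards [eventually_ge_atTop n₀] with m hm
      rw [ENNReal.tsum_sigma']
      have e1 : ∀ k, ∑' i : Fin (N (m + k)), Metric.ediam (t (m + k) i) ^ (s : ℝ) ≤
          ENNReal.ofReal (q (m + k)) := by
        intro k
        rw [tsum_fintype]
        calc ∑ i : Fin (N (m + k)), Metric.ediam (t (m + k) i) ^ (s : ℝ)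
            ≤ ∑ _i : Fin (N (m + k)), ENNReal.ofReal (δ (m + k) ^ (s : ℝ)) := by
              refine Finset.sum_le_sum fun i _ => ?_
              rw [← ENNReal.ofReal_rpow_of_nonneg (hδ _ (by omega)).1 s.coe_nonneg]
              exact ENNReal.rpow_le_rpow (h2 _ (by omega) i) s.2
          _ = ENNReal.ofReal ((N (m + k) : ℝ) * δ (m + k) ^ (s : ℝ)) := by
              rw [ENNReal.ofReal_mul (Nat.cast_nonneg _)]
              simp
          _ ≤ _ := ENNReal.ofReal_le_ofReal (h3 _ (by omega))
      refine (ENNReal.tsum_le_tsum e1).trans ?_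
      obtain ⟨j, rfl⟩ := Nat.exists_eq_add_of_le' hm
      refine (ENNReal.tsum_comp_le_tsum_of_injective (f := fun k : ℕ => k + j)
        (fun a b hab => by simpa using hab) fun n => ENNReal.ofReal (q (n + n₀))).trans' ?_
      refine ENNReal.tsum_le_tsum fun k => le_of_eq ?_
      congr 2
      omega

/-! ### Spread measures on the hitting sets -/

open MeasureTheory

/-- The half-open cube with corner `p` and side length `ℓ`. -/
def box (p : Fin d → ℝ) (ℓ : ℝ) : Set (EuclideanSpace ℝ (Fin d)) :=
  {x | ∀ i, p i ≤ x i ∧ x i < p i + ℓ}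

theorem measurableSet_box (p : Fin d → ℝ) (ℓ : ℝ) : MeasurableSet (box p ℓ) := by
  have : box p ℓ = ⋂ i, {x : EuclideanSpace ℝ (Fin d) | p i ≤ x i ∧ x i < p i + ℓ} := by
    ext; simp [box]
  rw [this]
  refine MeasurableSet.iInter fun i => ?_
  have hc : Continuous fun x : EuclideanSpace ℝ (Fin d) => x i := by fun_prop
  exact (measurableSet_le measurable_const hc.measurable).inter
    (measurableSet_lt hc.measurable measurable_const)

theorem card_filter_fin_le {m : ℕ} {a b : ℝ} (hab : 0 ≤ b - a + 1) :
    ((Finset.univ.filter fun k : Fin m => a ≤ (k : ℕ) ∧ ((k : ℕ) : ℝ) ≤ b).card : ℝ) ≤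
      b - a + 1 := by
  classical
  have h1 : (Finset.univ.filter fun k : Fin m => a ≤ (k : ℕ) ∧ ((k : ℕ) : ℝ) ≤ b).card ≤
      (Finset.Icc ⌈a⌉ ⌊b⌋).card := by
    refine Finset.card_le_card_of_injOn (fun k => ((k : ℕ) : ℤ)) (fun k hk => ?_)
      fun k _ k' _ hkk' => ?_
    · have hk' := (Finset.mem_filter.1 hk).2
      exact Finset.mem_coe.2 (Finset.mem_Icc.2 ⟨Int.ceil_le.2 (by exact_mod_cast hk'.1),
        Int.le_floor.2 (by exact_mod_cast hk'.2)⟩)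
    · exact Fin.ext (by simpa using hkk')
  rw [Int.card_Icc] at h1
  have h2 : ((⌊b⌋ + 1 - ⌈a⌉).toNat : ℝ) ≤ b - a + 1 := by
    rcases le_total 0 (⌊b⌋ + 1 - ⌈a⌉) with h | h
    · have h3 : ((⌊b⌋ + 1 - ⌈a⌉).toNat : ℝ) = (⌊b⌋ : ℝ) + 1 - ⌈a⌉ := by
        exact_mod_cast Int.toNat_of_nonneg h
      rw [h3]
      linarith [Int.floor_le b, Int.le_ceil a]
    · rw [Int.toNat_of_nonpos h]
      simpa using hab
  exact le_trans (by exact_mod_cast h1) h2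

theorem volume_openUnitCube :
    (volume : Measure (Fin d → ℝ)) {x | ∀ k, x k ∈ Ioo (0 : ℝ) 1} = 1 := by
  have : {x : Fin d → ℝ | ∀ k, x k ∈ Ioo (0 : ℝ) 1} = Set.pi univ fun _ => Ioo (0 : ℝ) 1 := by
    ext; simp
  rw [this, volume_pi_pi]
  simp

/-- Each side of the box is cut into slots of length `(n + 1) β_i⁻ⁿ`, each of which contains a full
branch. The measure is uniform over the products of these branches and, on each of them, the image
of Lebesgue measure on the parameter cube of the target. A ball's mass is bounded by the proportion
of products that it can meet, times the bound for a single copy from `volume_preimage_box_le`. -/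
theorem IsFrame.exists_measure {β : Fin d → ℝ} (hβ : ∀ i, 1 < β i) {n : ℕ}
    {P : Set (EuclideanSpace ℝ (Fin d))} (hPc : P ⊆ unitCube d)
    {γ : Fin d → EuclideanSpace ℝ (Fin d)}
    {w : EuclideanSpace ℝ (Fin d)} {M : Matrix (Fin d) (Fin d) ℝ} (hF : IsFrame β n P γ w M)
    {p : Fin d → ℝ} {ℓ : ℝ} (hp : ∀ i, 0 ≤ p i ∧ p i + ℓ ≤ 1)
    (hℓ : ∀ i, 2 * ((n + 1) * (β i ^ n)⁻¹) ≤ ℓ) :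
    ∃ ν : Measure (EuclideanSpace ℝ (Fin d)), IsProbabilityMeasure ν ∧
      ν (hitSet β n (interior P) ∩ box p ℓ)ᶜ = 0 ∧
      ∀ y r, 0 < r → ν (Metric.closedBall y r) ≤
        ENNReal.ofReal ((∏ i, 8 * max r ((n + 1) * (β i ^ n)⁻¹) / ℓ) *
          ∏ j, (2 * d) * min 1 (r / ‖γ j‖)) := by
  classical
  have hb : ∀ i, 0 < (β i ^ n)⁻¹ := fun i => by have := hβ i; positivity
  set L : Fin d → ℝ := fun i => (n + 1) * (β i ^ n)⁻¹ with hL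
  have hL0 : ∀ i, 0 < L i := fun i => by have := hb i; positivity
  have hbL : ∀ i, (β i ^ n)⁻¹ ≤ L i := fun i => by
    have h1 := hb i
    have : 0 ≤ (n : ℝ) * (β i ^ n)⁻¹ := by positivity
    simp only [hL]; linarith
  have hℓ0 : ∀ i, 0 < ℓ := fun i => by linarith [hL0 i, hℓ i]
  set m : Fin d → ℕ := fun i => ⌊ℓ / L i⌋₊ with hm
  -- Rounding down costs at most a factor 2, because at least two slots fit into the side.
  have hm2 : ∀ i, ℓ / (2 * L i) ≤ m i := fun i => by
    have h1 := Nat.lt_floor_add_one (ℓ / L i)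
    have h2 : 2 ≤ ℓ / L i := by rw [le_div_iff₀ (hL0 i)]; exact hℓ i
    have h3 : ℓ / (2 * L i) = (ℓ / L i) / 2 := by field_simp
    rw [h3]
    linarith
  have hm0 : ∀ i, 0 < (m i : ℝ) := fun i =>
    lt_of_lt_of_le (div_pos (hℓ0 i) (by linarith [hL0 i])) (hm2 i)
  have hmL : ∀ i, m i * L i ≤ ℓ := fun i => by
    rw [← le_div_iff₀ (hL0 i)]
    exact Nat.floor_le (div_nonneg (hℓ0 i).le (hL0 i).le)
  have hbranch : ∀ i, ∀ k : Fin (m i), ∃ c : ℝ, 0 ≤ c ∧ p i + (k : ℕ) * L i ≤ c ∧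
      c + (β i ^ n)⁻¹ ≤ p i + ((k : ℕ) + 1) * L i ∧
      ∀ y ∈ Ico (0 : ℝ) 1, (betaFract (β i))^[n] (c + (β i ^ n)⁻¹ * y) = y := by
    intro i k
    have hk : ((k : ℕ) : ℝ) + 1 ≤ m i := by exact_mod_cast k.2
    obtain ⟨c, hc0, hc1, hc2, hc3⟩ := exists_full_branch (hβ i) n (p i + ((k : ℕ) + 1) * L i)
      (by
        have : 0 ≤ ((k : ℕ) : ℝ) * L i := by have := hL0 i; positivity
        linarith [(hp i).1, hbL i])
      (by nlinarith [(hp i).2, hmL i, hL0 i])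
    have h2 : p i + ((k : ℕ) + 1) * L i ≤ c + L i := hc2
    exact ⟨c, hc0, by linarith, hc1, hc3⟩
  choose c hc0 hc1 hc2 hc3 using hbranch
  set J := ∀ i, Fin (m i)
  set U : Set (Fin d → ℝ) := {x | ∀ k, x k ∈ Ioo (0 : ℝ) 1} with hU
  set φ : J → (Fin d → ℝ) → EuclideanSpace ℝ (Fin d) := fun j x =>
    WithLp.toLp 2 (fun i => c i (j i)) + (w + ∑ k, M.mulVec x k • γ k) with hφ
  have hφc : ∀ j, Continuous (φ j) := fun j => by
    have h1 : ∀ k, Continuous fun x : Fin d → ℝ => M.mulVec x k := fun k =>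
      (continuous_apply k).comp (Continuous.matrix_mulVec continuous_const continuous_id)
    exact continuous_const.add (continuous_const.add (continuous_finsetSum _ fun k _ =>
      (h1 k).smul continuous_const))
  have hφU : ∀ j, ∀ x ∈ U, ∃ q ∈ interior P, ∀ i, φ j x i = c i (j i) + (β i ^ n)⁻¹ * q i := by
    intro j x hx
    obtain ⟨q, hq, hq'⟩ := hF.exists_mem x hx
    refine ⟨q, hq, fun i => ?_⟩
    simp only [hφ, ← hq']
    rfl
  have hUm : MeasurableSet U := by
    have : U = Set.pi univ fun _ => Ioo (0 : ℝ) 1 := by ext; simp [hU]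
    rw [this]
    exact MeasurableSet.univ_pi fun _ => measurableSet_Ioo
  set lam : Measure (Fin d → ℝ) := volume.restrict U
  have hlam : lam univ = 1 := by
    rw [Measure.restrict_apply_univ]; exact volume_openUnitCube
  have hJ0 : (0 : ℝ) < Fintype.card J := by
    have : (Fintype.card J : ℝ) = ∏ i, (m i : ℝ) := by simp [J, Fintype.card_pi]
    rw [this]
    exact Finset.prod_pos fun i _ => hm0 i
  have hJe : (Fintype.card J : ℝ≥0∞) ≠ 0 := by
    intro h
    rw [Nat.cast_eq_zero] at h
    rw [h] at hJ0
    simp at hJ0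
  have hJt : (Fintype.card J : ℝ≥0∞) ≠ ⊤ := ENNReal.natCast_ne_top _
  set ν : Measure (EuclideanSpace ℝ (Fin d)) :=
    ∑ j : J, (Fintype.card J : ℝ≥0∞)⁻¹ • lam.map (φ j) with hν
  have hνa : ∀ s, MeasurableSet s → ν s = ∑ j : J, (Fintype.card J : ℝ≥0∞)⁻¹ * lam (φ j ⁻¹' s) := by
    intro s hs
    rw [hν, Measure.finsetSum_apply]
    refine Finset.sum_congr rfl fun j _ => ?_
    rw [Measure.smul_apply, Measure.map_apply (hφc j).measurable hs, smul_eq_mul]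
  have hint : interior P ⊆ openCube d := (interior_mono hPc).trans interior_unitCube_subset
  have hprob : IsProbabilityMeasure ν := ⟨by
    rw [hνa _ MeasurableSet.univ]
    simp only [preimage_univ, hlam, mul_one, Finset.sum_const, Finset.card_univ, nsmul_eq_mul]
    exact ENNReal.mul_inv_cancel hJe hJt⟩
  refine ⟨ν, hprob, ?_, fun y r hr => ?_⟩
  · have hmeas : MeasurableSet (hitSet β n (interior P) ∩ box p ℓ) :=
      ((hitSet_subset_openCube_and_isOpen β n isOpen_interior hint).2.measurableSet).inter
        (measurableSet_box p ℓ)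
    rw [hνa _ hmeas.compl]
    refine Finset.sum_eq_zero fun j _ => ?_
    have : φ j ⁻¹' (hitSet β n (interior P) ∩ box p ℓ)ᶜ ⊆ Uᶜ := by
      intro x hx hxU
      refine hx ?_
      obtain ⟨q, hq, hq'⟩ := hφU j x hxU
      have hq1 := hint hq
      have hbox : φ j x ∈ box p ℓ := by
        intro i
        rw [hq' i]
        have h1 := hc1 i (j i)
        have h2 := hc2 i (j i)
        have hk : (((j i : Fin (m i)) : ℕ) : ℝ) + 1 ≤ m i := by exact_mod_cast (j i).2
        have h3 : 0 ≤ (((j i : Fin (m i)) : ℕ) : ℝ) * L i := by have := hL0 i; positivity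
        have h4 := mul_pos (hb i) (hq1 i).1
        have h5 : (β i ^ n)⁻¹ * q i < (β i ^ n)⁻¹ :=
          mul_lt_of_lt_one_right (hb i) (hq1 i).2
        have h6 := mul_le_mul_of_nonneg_right hk (hL0 i).le
        constructor
        · linarith
        · linarith [hmL i]
      refine ⟨⟨fun i => ⟨(hp i).1.trans (hbox i).1, (hbox i).2.trans_le (hp i).2⟩, ?_⟩, hbox⟩
      have : (betaMap β)^[n] (φ j x) = q := by
        ext i
        rw [betaMap_iterate_apply, hq' i]
        exact hc3 i (j i) _ ⟨(hq1 i).1.le, (hq1 i).2⟩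
      rw [this]
      exact hq
    have h0 : lam (φ j ⁻¹' (hitSet β n (interior P) ∩ box p ℓ)ᶜ) = 0 := by
      refine measure_mono_null this ?_
      rw [Measure.restrict_apply hUm.compl]
      simp
    rw [h0, mul_zero]
  · set V : ℝ := ∏ j, (2 * d) * min 1 (r / ‖γ j‖) with hV
    -- Slot `k` in direction `i` can meet the ball only if `a i ≤ k ≤ b i`; the `- 1` accounts for
    -- the length of the slot.
    set a : Fin d → ℝ := fun i => (y i - r - p i) / L i - 1
    set b : Fin d → ℝ := fun i => (y i + r - p i) / L i
    set K : Finset J := Fintype.piFinset fun i =>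
      Finset.univ.filter fun k : Fin (m i) => a i ≤ (k : ℕ) ∧ ((k : ℕ) : ℝ) ≤ b i with hK
    have hsingle : ∀ j : J, lam (φ j ⁻¹' Metric.closedBall y r) ≤
        if j ∈ K then ENNReal.ofReal V else 0 := by
      intro j
      rw [Measure.restrict_apply ((hφc j).measurable Metric.isClosed_closedBall.measurableSet)]
      split_ifs with hj
      · refine (measure_mono ?_).trans (volume_preimage_box_le hF.det_eq hF.abs_le
          (fun i => inner ℝ (y - WithLp.toLp 2 (fun i => c i (j i)) - w) (γ i) / ‖γ i‖ ^ 2)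
          (fun i => r / ‖γ i‖) fun i => by positivity)
        rintro x ⟨hx1, hx2⟩
        refine ⟨fun k => ⟨(hx2 k).1.le, (hx2 k).2.le⟩, fun i => ?_⟩
        refine (abs_sub_mul_norm_le hF.orthogonal (M.mulVec x) _ i (hF.ne_zero i)).trans ?_
        gcongr
        have : ∑ k, M.mulVec x k • γ k - (y - WithLp.toLp 2 (fun i => c i (j i)) - w) =
            φ j x - y := by
          simp only [hφ]; abel
        rw [this, ← dist_eq_norm]
        exact hx1
      · rw [nonpos_iff_eq_zero]
        convert measure_empty (μ := (volume : Measure (Fin d → ℝ)))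
        rw [eq_empty_iff_forall_notMem]
        rintro x ⟨hx1, hx2⟩
        refine hj (Fintype.mem_piFinset.2 fun i => Finset.mem_filter.2 ⟨Finset.mem_univ _, ?_⟩)
        obtain ⟨q, hq, hq'⟩ := hφU j x hx2
        have hq1 := hint hq
        have h1 : |φ j x i - y i| ≤ r := by
          have := PiLp.norm_apply_le (φ j x - y) i
          rw [← dist_eq_norm] at this
          exact this.trans hx1
        rw [hq' i, _root_.abs_le] at h1
        have h4 := mul_pos (hb i) (hq1 i).1
        have h5 : (β i ^ n)⁻¹ * q i < (β i ^ n)⁻¹ :=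
          mul_lt_of_lt_one_right (hb i) (hq1 i).2
        have h6 := hc1 i (j i)
        have h7 := hc2 i (j i)
        constructor
        · simp only [a]
          rw [sub_le_iff_le_add, div_le_iff₀ (hL0 i)]
          linarith
        · simp only [b]
          rw [le_div_iff₀ (hL0 i)]
          linarith
    have hcard : (K.card : ℝ) ≤ Fintype.card J * ∏ i, 8 * max r (L i) / ℓ := by
      have e1 : (Fintype.card J : ℝ) = ∏ i, (m i : ℝ) := by simp [J, Fintype.card_pi]
      rw [e1, ← Finset.prod_mul_distrib, hK, Fintype.card_piFinset]
      push_cast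
      refine Finset.prod_le_prod (fun i _ => by positivity) fun i _ => ?_
      have e2 : b i - a i + 1 = 2 * (r / L i) + 2 := by simp only [a, b]; ring
      have hrL : 0 < r / L i := div_pos hr (hL0 i)
      refine (card_filter_fin_le (by rw [e2]; linarith)).trans ?_
      rw [e2]
      calc 2 * (r / L i) + 2 = (2 * r + 2 * L i) / L i := by have := hL0 i; field_simp
        _ ≤ (4 * max r (L i)) / L i := by
            have := hL0 i
            gcongr
            linarith [le_max_left r (L i), le_max_right r (L i)]
        _ = ℓ / (2 * L i) * (8 * max r (L i) / ℓ) := by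
            have := hL0 i
            have := hℓ0 i
            field_simp
            ring
        _ ≤ m i * (8 * max r (L i) / ℓ) := by
            have := hℓ0 i
            have := hm2 i
            have : 0 ≤ max r (L i) := hr.le.trans (le_max_left _ _)
            gcongr
    calc ν (Metric.closedBall y r)
        = ∑ j : J, (Fintype.card J : ℝ≥0∞)⁻¹ * lam (φ j ⁻¹' Metric.closedBall y r) :=
          hνa _ Metric.isClosed_closedBall.measurableSet
      _ ≤ ∑ j : J, (Fintype.card J : ℝ≥0∞)⁻¹ * (if j ∈ K then ENNReal.ofReal V else 0) := by
          gcongr with j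
          exact hsingle j
      _ = (Fintype.card J : ℝ≥0∞)⁻¹ * (K.card * ENNReal.ofReal V) := by
          rw [← Finset.mul_sum, Finset.sum_ite_mem, Finset.univ_inter, Finset.sum_const,
            nsmul_eq_mul]
      _ ≤ (Fintype.card J : ℝ≥0∞)⁻¹ *
          ((Fintype.card J : ℝ≥0∞) * ENNReal.ofReal (∏ i, 8 * max r (L i) / ℓ) *
            ENNReal.ofReal V) := by
          gcongr
          rw [← ENNReal.ofReal_natCast, ← ENNReal.ofReal_natCast,
            ← ENNReal.ofReal_mul (Nat.cast_nonneg _)]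
          exact ENNReal.ofReal_le_ofReal hcard
      _ = ENNReal.ofReal (∏ i, 8 * max r (L i) / ℓ) * ENNReal.ofReal V := by
          rw [mul_assoc, ← mul_assoc, ENNReal.inv_mul_cancel hJe hJt, one_mul]
      _ = ENNReal.ofReal ((∏ i, 8 * max r (L i) / ℓ) * V) := by
          rw [ENNReal.ofReal_mul]
          refine Finset.prod_nonneg fun i _ => ?_
          have := hℓ0 i
          have : 0 ≤ max r (L i) := hr.le.trans (le_max_left _ _)
          positivity

/-- `A` carries a probability measure that gives mass at most `C (r / ℓ) ^ t` to balls of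
radius `r`. -/
def IsSpreadOn (t C ℓ : ℝ) (A : Set (EuclideanSpace ℝ (Fin d))) : Prop :=
  ∃ ν : Measure (EuclideanSpace ℝ (Fin d)), IsProbabilityMeasure ν ∧ ν Aᶜ = 0 ∧
    ∀ y r, 0 < r → ν (Metric.closedBall y r) ≤ ENNReal.ofReal (C * (r / ℓ) ^ t)

theorem IsSpreadOn.mono {t C ℓ : ℝ} {A B : Set (EuclideanSpace ℝ (Fin d))}
    (h : IsSpreadOn t C ℓ A) (hAB : A ⊆ B) : IsSpreadOn t C ℓ B := by
  obtain ⟨ν, h1, h2, h3⟩ := h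
  exact ⟨ν, h1, measure_mono_null (compl_subset_compl.2 hAB) h2, h3⟩

theorem exists_inv_le_lt_one [NeZero d] {β : Fin d → ℝ} (hβ : ∀ i, 1 < β i) :
    ∃ ρ : ℝ, 0 < ρ ∧ ρ < 1 ∧ ∀ i, (β i)⁻¹ ≤ ρ := by
  obtain ⟨k, -, hk⟩ := Finset.exists_max_image Finset.univ (fun i => (β i)⁻¹) ⟨0, Finset.mem_univ _⟩
  have := hβ k
  exact ⟨(β k)⁻¹, by positivity, inv_lt_one_of_one_lt₀ this, fun i => hk i (Finset.mem_univ i)⟩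

theorem tendsto_add_one_pow_mul_pow (k : ℕ) {a : ℝ} (ha : 0 < a) (ha1 : a < 1) :
    Tendsto (fun n : ℕ => ((n : ℝ) + 1) ^ k * a ^ n) atTop (nhds 0) := by
  have h := (tendsto_pow_const_mul_const_pow_of_lt_one k ha.le ha1).comp (tendsto_add_atTop_nat 1)
  have h2 := h.const_mul a⁻¹
  rw [mul_zero] at h2
  refine h2.congr fun n => ?_
  simp only [Function.comp_apply, Nat.cast_add, Nat.cast_one, pow_succ a n]
  field_simp

/-- The surplus `t' - t` in the exponent pays for the factor `K ^ N / ℓ ^ N`: since `r ≤ c`, it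
contributes at most `c ^ (t' - t)`, and `hle` says that this is small enough. -/
theorem mul_div_pow_le_rpow {c K ℓ t t' s Φ r : ℝ} {N : ℕ} (hr : 0 < r) (hrc : r ≤ c)
    (hΦ : Φ ≤ r ^ s) (hs : t' ≤ s) (hr1 : r ≤ 1) (hℓ : 0 < ℓ) (hℓ1 : ℓ ≤ 1) (ht : 0 ≤ t)
    (htt' : t ≤ t') (hK : 0 ≤ K) (hle : K ^ N * c ^ (t' - t) ≤ ℓ ^ N) :
    K ^ N * Φ / ℓ ^ N ≤ (r / ℓ) ^ t := by
  have h1 : Φ ≤ r ^ t * r ^ (t' - t) := by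
    rw [← Real.rpow_add hr, add_sub_cancel]
    exact hΦ.trans (Real.rpow_le_rpow_of_exponent_ge hr hr1 hs)
  have h2 : r ^ (t' - t) ≤ c ^ (t' - t) := Real.rpow_le_rpow hr.le hrc (sub_nonneg.2 htt')
  have h3 : 0 ≤ r ^ t := (Real.rpow_pos_of_pos hr t).le
  rw [div_le_iff₀ (pow_pos hℓ N)]
  calc K ^ N * Φ ≤ K ^ N * (r ^ t * c ^ (t' - t)) := by gcongr; exact h1.trans (by gcongr)
    _ = r ^ t * (K ^ N * c ^ (t' - t)) := by ring
    _ ≤ (r / ℓ) ^ t * ℓ ^ N := by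
      have hD0 : 0 ≤ K ^ N * c ^ (t' - t) :=
        mul_nonneg (pow_nonneg hK N) (Real.rpow_pos_of_pos (hr.trans_le hrc) _).le
      have h4 : r ≤ r / ℓ := by
        rw [le_div_iff₀ hℓ]
        nlinarith
      gcongr

/-- Inside every cube there are, for infinitely many `n`, spread measures on the `n`-th hitting
sets, with a constant depending on the dimension only. -/
theorem isSpreadOn_hitSet [NeZero d] {β : Fin d → ℝ} (hβ : ∀ i, 1 < β i)
    {P : ℕ → Set (EuclideanSpace ℝ (Fin d))} {v : ℕ → EuclideanSpace ℝ (Fin d)}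
    {α γ : ℕ → Fin d → EuclideanSpace ℝ (Fin d)}
    (hP : ∀ n, 1 ≤ n → IsParallelepiped (P n) (v n) (α n))
    (hcube : ∀ n, 1 ≤ n → P n ⊆ unitCube d)
    (hγ : ∀ n, 1 ≤ n → IsPivotedGramSchmidt (fun j => contraction β n (α n j)) (γ n))
    {t t' : ℝ} (ht : 0 ≤ t) (htt' : t < t') (hfreq : ∃ᶠ n in atTop, t' < minExponent β n (γ n))
    (N : ℕ) {p : Fin d → ℝ} {ℓ : ℝ} (hℓ : 0 < ℓ) (hp : ∀ i, 0 ≤ p i ∧ p i + ℓ ≤ 1) :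
    IsSpreadOn t ((8 * (2 * d)) ^ d) ℓ
      ((⋃ n ≥ N, hitSet β n (interior (P n))) ∩ box p ℓ) := by
  obtain ⟨ρ, hρ0, hρ1, hρ⟩ := exists_inv_le_lt_one hβ
  have hℓ1 : ℓ ≤ 1 := by linarith [(hp 0).1, (hp 0).2]
  have hd1 : (1 : ℝ) ≤ d := by exact_mod_cast NeZero.one_le
  set ε := t' - t with hε
  have hε0 : 0 < ε := sub_pos.2 htt'
  have lim1 : Tendsto (fun n : ℕ => ((n : ℝ) + 1) * ρ ^ n) atTop (nhds 0) := by
    simpa using tendsto_add_one_pow_mul_pow 1 hρ0 hρ1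
  have lim2 : Tendsto (fun n : ℕ => (d : ℝ) * (2 * ρ ^ n)) atTop (nhds 0) := by
    simpa using ((tendsto_pow_atTop_nhds_zero_of_lt_one hρ0.le hρ1).const_mul 2).const_mul (d : ℝ)
  have lim3 : Tendsto (fun n : ℕ => ((n : ℝ) + 1) ^ d * (((n : ℝ) + 1) * ρ ^ n) ^ ε) atTop
      (nhds 0) := by
    have ha : ρ ^ ε < 1 := Real.rpow_lt_one hρ0.le hρ1 hε0
    refine squeeze_zero (fun n => by positivity) (fun n => ?_)
      (tendsto_add_one_pow_mul_pow (d + ⌈ε⌉₊) (Real.rpow_pos_of_pos hρ0 ε) ha)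
    have hn : (1 : ℝ) ≤ n + 1 := by linarith [(n.cast_nonneg : (0 : ℝ) ≤ n)]
    rw [Real.mul_rpow (by positivity) (by positivity), pow_add, mul_assoc]
    have e1 : (ρ ^ n) ^ ε = (ρ ^ ε) ^ n := by
      rw [← Real.rpow_natCast, ← Real.rpow_natCast, ← Real.rpow_mul hρ0.le, ← Real.rpow_mul hρ0.le,
        mul_comm]
    rw [e1]
    gcongr
    rw [← Real.rpow_natCast]
    exact Real.rpow_le_rpow_of_exponent_le hn (Nat.le_ceil ε)
  -- The threshold for `n` may depend on `ℓ`. This is how the powers of `n + 1` and of `ℓ` disappear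
  -- from the final constant.
  have ev : ∀ᶠ n in atTop, (N ≤ n ∧ 1 ≤ n) ∧ ((n : ℝ) + 1) * ρ ^ n < ℓ / 2 ∧
      (d : ℝ) * (2 * ρ ^ n) < 1 ∧ ((n : ℝ) + 1) ^ d * (((n : ℝ) + 1) * ρ ^ n) ^ ε < ℓ ^ d :=
    ((eventually_ge_atTop N).and (eventually_ge_atTop 1)).and
      ((lim1.eventually_lt_const (by positivity)).and
      ((lim2.eventually_lt_const one_pos).and (lim3.eventually_lt_const (by positivity))))
  obtain ⟨n, hns, ⟨hnN, hn1⟩, hev1, hev2, hev3⟩ := (hfreq.and_eventually ev).exists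
  obtain ⟨w, M, hF⟩ := exists_isFrame hβ (hP n hn1) (hγ n hn1)
  have hscale : ∀ τ ∈ scales β n (γ n), τ < 1 := fun τ hτ =>
    (scales_le hβ (hP n hn1) (hcube n hn1) (hγ n hn1) hρ hτ).trans_lt hev2
  have hb : ∀ i, 0 < (β i ^ n)⁻¹ := fun i => by have := hβ i; positivity
  have hpow : ∀ i, (β i ^ n)⁻¹ ≤ ρ ^ n := fun i => by
    rw [← inv_pow]
    exact pow_le_pow_left₀ (by have := hβ i; positivity) (hρ i) n
  have hLρ : ∀ i, ((n : ℝ) + 1) * (β i ^ n)⁻¹ ≤ ((n : ℝ) + 1) * ρ ^ n := fun i => by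
    gcongr; exact hpow i
  have hn1' : (1 : ℝ) ≤ n + 1 := by linarith [(n.cast_nonneg : (0 : ℝ) ≤ n)]
  obtain ⟨ν, hν1, hν2, hν3⟩ := hF.exists_measure hβ (hcube n hn1) (p := p) (ℓ := ℓ) hp
    fun i => by linarith [hLρ i]
  have htd : t ≤ d := by
    linarith [(minExponent_mem_Icc hβ hF.ne_zero hscale).2]
  refine ⟨ν, hν1, measure_mono_null (compl_subset_compl.2 ?_) hν2, fun y r hr => ?_⟩
  · exact inter_subset_inter_left _ (subset_iUnion₂_of_subset n hnN subset_rfl)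
  have hC1 : (1 : ℝ) ≤ (8 * (2 * d)) ^ d := one_le_pow₀ (by linarith)
  -- Three ranges of radii. Above `ℓ` total mass 1 suffices; between `(n + 1) ρ ^ n` and `ℓ` the
  -- count of branches alone gives `(r / ℓ) ^ d`; below that, `scaleMass` is at most `r` to the
  -- minimal exponent.
  rcases le_total ℓ r with hrℓ | hrℓ
  · refine prob_le_one.trans (ENNReal.one_le_ofReal.2 ?_)
    have : 1 ≤ (r / ℓ) ^ t := Real.one_le_rpow ((one_le_div hℓ).2 hrℓ) ht
    nlinarith
  refine (hν3 y r hr).trans (ENNReal.ofReal_le_ofReal ?_)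
  have hmin0 : ∀ j, 0 ≤ min 1 (r / ‖γ n j‖) := fun j => by positivity
  have hmin : ∏ j, (2 * d : ℝ) * min 1 (r / ‖γ n j‖) =
      (2 * d) ^ d * ∏ j, min 1 (r / ‖γ n j‖) := by
    rw [Finset.prod_mul_distrib]; simp
  have hmax : ∏ i, 8 * max r ((n + 1) * (β i ^ n)⁻¹) / ℓ =
      8 ^ d * (∏ i, max r ((n + 1) * (β i ^ n)⁻¹)) / ℓ ^ d := by
    rw [Finset.prod_div_distrib, Finset.prod_mul_distrib]; simp
  rw [hmin, hmax]
  rcases le_total (((n : ℝ) + 1) * ρ ^ n) r with hrL | hrL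
  · have h1 : ∏ i, max r ((n + 1) * (β i ^ n)⁻¹) = r ^ d := by
      rw [Finset.prod_congr rfl fun i _ => max_eq_left ((hLρ i).trans hrL)]
      simp
    have h2 : ∏ j, min 1 (r / ‖γ n j‖) ≤ 1 :=
      Finset.prod_le_one (fun j _ => hmin0 j) fun j _ => min_le_left _ _
    rw [h1]
    calc 8 ^ d * r ^ d / ℓ ^ d * ((2 * d) ^ d * ∏ j, min 1 (r / ‖γ n j‖))
        ≤ 8 ^ d * r ^ d / ℓ ^ d * ((2 * d) ^ d * 1) := by gcongr
      _ = (8 * (2 * d)) ^ d * (r / ℓ) ^ d := by rw [mul_pow 8, div_pow]; ring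
      _ ≤ (8 * (2 * d)) ^ d * (r / ℓ) ^ t := by
          gcongr
          rw [← Real.rpow_natCast]
          exact Real.rpow_le_rpow_of_exponent_ge (by positivity) ((div_le_one hℓ).2 hrℓ) htd
  · have hr1 : r < 1 := by linarith
    have h1 : ∏ i, max r ((n + 1) * (β i ^ n)⁻¹) ≤
        ((n : ℝ) + 1) ^ d * ∏ i, max r (β i ^ n)⁻¹ := by
      have : ((n : ℝ) + 1) ^ d = ∏ _i : Fin d, ((n : ℝ) + 1) := by simp
      rw [this, ← Finset.prod_mul_distrib]
      refine Finset.prod_le_prod (fun i _ => by positivity) fun i _ => max_le ?_ ?_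
      · nlinarith [le_max_left r (β i ^ n)⁻¹]
      · gcongr
        exact le_max_right _ _
    have key := mul_div_pow_le_rpow (N := d) hr hrL
      (scaleMass_le_rpow hβ hF.ne_zero hscale hr hr1)
      hns.le hr1.le hℓ hℓ1 ht htt'.le (by positivity : (0 : ℝ) ≤ n + 1) hev3.le
    have h3 : 0 ≤ ∏ j, min 1 (r / ‖γ n j‖) := Finset.prod_nonneg fun j _ => hmin0 j
    calc 8 ^ d * (∏ i, max r ((n + 1) * (β i ^ n)⁻¹)) / ℓ ^ d *
          ((2 * d) ^ d * ∏ j, min 1 (r / ‖γ n j‖))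
        ≤ 8 ^ d * (((n : ℝ) + 1) ^ d * ∏ i, max r (β i ^ n)⁻¹) / ℓ ^ d *
          ((2 * d) ^ d * ∏ j, min 1 (r / ‖γ n j‖)) := by gcongr
      _ = (8 * (2 * d)) ^ d * (((n : ℝ) + 1) ^ d * scaleMass β n (γ n) r / ℓ ^ d) := by
          rw [scaleMass, mul_pow 8]; ring
      _ ≤ (8 * (2 * d)) ^ d * (r / ℓ) ^ t := by gcongr

/-! ### Upper bound for the dimension -/

/-- The upper bound for the Hausdorff dimension. -/
theorem dimH_limsupSet_le [NeZero d] {β : Fin d → ℝ} (hβ : ∀ i, 1 < β i)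
    {P : ℕ → Set (EuclideanSpace ℝ (Fin d))} {v : ℕ → EuclideanSpace ℝ (Fin d)}
    {α γ : ℕ → Fin d → EuclideanSpace ℝ (Fin d)}
    (hP : ∀ n, 1 ≤ n → IsParallelepiped (P n) (v n) (α n))
    (hcube : ∀ n, 1 ≤ n → P n ⊆ unitCube d)
    (hγ : ∀ n, 1 ≤ n → IsPivotedGramSchmidt (fun j => contraction β n (α n j)) (γ n))
    {t' : ℝ} {t : ℝ≥0} (htt' : t' < t) (hev : ∀ᶠ n in atTop, minExponent β n (γ n) < t') :
    dimH (limsupSet β P) ≤ t := by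
  obtain ⟨ρ, hρ0, hρ1, hρ⟩ := exists_inv_le_lt_one hβ
  have hd1 : (1 : ℝ) ≤ d := by exact_mod_cast NeZero.one_le
  set ε := (t : ℝ) - t' with hε
  have hε0 : 0 < ε := sub_pos.2 htt'
  have ha : ρ ^ ε < 1 := Real.rpow_lt_one hρ0.le hρ1 hε0
  have ha0 : 0 < ρ ^ ε := Real.rpow_pos_of_pos hρ0 ε
  have lim2 : Tendsto (fun n : ℕ => (d : ℝ) * (2 * ρ ^ n)) atTop (nhds 0) := by
    simpa using ((tendsto_pow_atTop_nhds_zero_of_lt_one hρ0.le hρ1).const_mul 2).const_mul (d : ℝ)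
  obtain ⟨n₀, hn₀⟩ := eventually_atTop.1 ((eventually_ge_atTop 1).and
    (hev.and (lim2.eventually_lt_const one_pos)))
  have hscale : ∀ n, n₀ ≤ n → ∀ τ ∈ scales β n (γ n), τ < 1 := fun n hn τ hτ =>
    (scales_le hβ (hP n (hn₀ n hn).1) (hcube n (hn₀ n hn).1) (hγ n (hn₀ n hn).1) hρ hτ).trans_lt
      (hn₀ n hn).2.2
  have hex : ∀ n, n₀ ≤ n → ∃ τ, 0 < τ ∧ τ < 1 ∧ τ ≤ d * (2 * ρ ^ n) ∧
      ∃ (N : ℕ) (u : Fin N → Set (EuclideanSpace ℝ (Fin d))),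
      (hitSet β n (P n) ⊆ ⋃ i, u i) ∧
      (∀ i, Metric.ediam (u i) ≤ ENNReal.ofReal (d * (d * τ))) ∧
      (N : ℝ) * τ ^ t' ≤ (2 * (n + 1) * (2 * d + 2)) ^ d := by
    intro n hn
    have hn1 := (hn₀ n hn).1
    obtain ⟨w, M, hF⟩ := exists_isFrame hβ (hP n hn1) (hγ n hn1)
    -- At the minimising scale the covering number is at most a polynomial in `n` times `τ` to the
    -- power minus `s_n`.
    obtain ⟨τ, hτ, hτe⟩ := exists_scale_rpow_eq hβ hF.ne_zero (hscale n hn)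
    have hτ0 := scales_pos hβ hF.ne_zero hτ
    obtain ⟨N, u, h1, h2, h3⟩ := hF.exists_cover hβ hτ0 (hscale n hn τ hτ)
    refine ⟨τ, hτ0, hscale n hn τ hτ, scales_le hβ (hP n hn1) (hcube n hn1) (hγ n hn1) hρ hτ,
      N, u, h1, h2, le_trans ?_ h3⟩
    rw [hτe]
    exact mul_le_mul_of_nonneg_left (Real.rpow_le_rpow_of_exponent_ge hτ0 (hscale n hn τ hτ).le
      (hn₀ n hn).2.1.le) (Nat.cast_nonneg _)
  choose! τ h0 h1 h2 h3 using hex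
  set C : ℝ := (2 * (2 * d + 2)) ^ d * ((d * d : ℝ) ^ (t : ℝ) * (d * 2) ^ ε) with hC
  have hsum : Summable fun n : ℕ => C * (((n : ℝ) + 1) ^ d * (ρ ^ ε) ^ n) := by
    refine Summable.mul_left _ ?_
    have h := (summable_nat_add_iff 1).2 (summable_pow_mul_geometric_of_norm_lt_one d
      (r := ρ ^ ε) (by rwa [Real.norm_eq_abs, abs_of_pos ha0]))
    refine (h.mul_left (ρ ^ ε)⁻¹).congr fun n => ?_
    push_cast
    rw [pow_succ (ρ ^ ε) n]
    field_simp
  have hset : limsupSet β P ⊆ {x | ∃ᶠ n in atTop, x ∈ hitSet β n (P n)} := fun x hx =>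
    hx.2.mono fun n hn => ⟨hx.1, hn⟩
  refine (dimH_mono hset).trans (dimH_frequently_le _ t _
    (fun n => d * (d * (d * (2 * ρ ^ n)))) (fun n => d * (d * τ n)) hsum ?_ ?_ n₀ ?_ ?_)
  · simpa using (lim2.const_mul (d : ℝ)).const_mul (d : ℝ)
  · intro m n hmn
    have := pow_le_pow_of_le_one hρ0.le hρ1.le hmn
    dsimp only
    gcongr
  · intro n hn
    have := h0 n hn
    refine ⟨by positivity, ?_⟩
    gcongr
    exact h2 n hn
  · intro n hn
    obtain ⟨N, u, hu1, hu2, hu3⟩ := h3 n hn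
    refine ⟨N, u, hu1, hu2, ?_⟩
    have hτ := h0 n hn
    have e1 : (d * (d * τ n) : ℝ) ^ (t : ℝ) = (d * d : ℝ) ^ (t : ℝ) * (τ n ^ t' * τ n ^ ε) := by
      rw [← mul_assoc, Real.mul_rpow (by positivity) hτ.le, ← Real.rpow_add hτ]
      congr 2
      rw [hε]; ring
    -- The surplus `ε` of the exponent gives geometric decay, which beats the polynomial number of
    -- labels.
    have e2 : (τ n) ^ ε ≤ (d * 2) ^ ε * (ρ ^ ε) ^ n := by
      have : (ρ ^ ε) ^ n = (ρ ^ n) ^ ε := by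
        rw [← Real.rpow_natCast, ← Real.rpow_natCast, ← Real.rpow_mul hρ0.le,
          ← Real.rpow_mul hρ0.le, mul_comm]
      rw [this, ← Real.mul_rpow (by positivity) (by positivity), mul_assoc]
      exact Real.rpow_le_rpow hτ.le (h2 n hn) hε0.le
    have hX : 0 ≤ (d * d : ℝ) ^ (t : ℝ) := by positivity
    calc (N : ℝ) * (d * (d * τ n)) ^ (t : ℝ)
        = ((N : ℝ) * τ n ^ t') * ((d * d : ℝ) ^ (t : ℝ) * τ n ^ ε) := by rw [e1]; ring
      _ ≤ (2 * (n + 1) * (2 * d + 2)) ^ d *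
          ((d * d : ℝ) ^ (t : ℝ) * ((d * 2) ^ ε * (ρ ^ ε) ^ n)) := by
          gcongr
      _ = C * (((n : ℝ) + 1) ^ d * (ρ ^ ε) ^ n) := by
          rw [hC, mul_right_comm 2, mul_pow (2 * (2 * (d : ℝ) + 2))]; ring

/-! ### Dyadic cubes -/

theorem mem_dyadicCube_iff {k : ℕ} {z : Fin d → ℤ} {x : EuclideanSpace ℝ (Fin d)} :
    x ∈ dyadicCube (k, z) ↔ ∀ i, ⌊x i * 2 ^ k⌋ = z i := by
  refine forall_congr' fun i => ?_
  rw [Int.floor_eq_iff, div_le_iff₀ (by positivity), lt_div_iff₀ (by positivity)]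

theorem mem_dyadicCube_floor (k : ℕ) (x : EuclideanSpace ℝ (Fin d)) :
    x ∈ dyadicCube (k, fun i => ⌊x i * 2 ^ k⌋) := mem_dyadicCube_iff.2 fun _ => rfl

theorem eq_of_mem_dyadicCube {k : ℕ} {z z' : Fin d → ℤ} {x : EuclideanSpace ℝ (Fin d)}
    (h : x ∈ dyadicCube (k, z)) (h' : x ∈ dyadicCube (k, z')) : z = z' :=
  funext fun i => (mem_dyadicCube_iff.1 h i).symm.trans (mem_dyadicCube_iff.1 h' i)

/-- The subcubes of `(k, z)` of level `k + j`. -/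
noncomputable def children (j : ℕ) (z : Fin d → ℤ) : Finset (Fin d → ℤ) :=
  Fintype.piFinset fun i => Finset.Ico (z i * 2 ^ j) ((z i + 1) * 2 ^ j)

theorem card_children (j : ℕ) (z : Fin d → ℤ) : (children j z).card = (2 ^ j) ^ d := by
  have h : ∀ i, (Finset.Ico (z i * 2 ^ j) ((z i + 1) * 2 ^ j)).card = 2 ^ j := by
    intro i
    rw [Int.card_Ico, add_mul, one_mul, add_sub_cancel_left]
    exact Int.toNat_natCast (2 ^ j)
  simp [children, Fintype.card_piFinset, h]

/-- Passing to a coarser dyadic level is integer division of the address by a power of 2; the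
nesting of dyadic cubes follows from this. -/
theorem floor_mul_pow_add (a : ℝ) (k j : ℕ) : ⌊a * 2 ^ k⌋ = ⌊a * 2 ^ (k + j)⌋ / 2 ^ j := by
  have := Int.floor_div_natCast (a * 2 ^ (k + j)) (2 ^ j)
  push_cast at this
  rw [← this, pow_add]
  congr 1
  field_simp

theorem mem_children_iff {k j : ℕ} {z u : Fin d → ℤ} {x : EuclideanSpace ℝ (Fin d)}
    (hx : x ∈ dyadicCube (k + j, u)) : u ∈ children j z ↔ x ∈ dyadicCube (k, z) := by
  rw [mem_dyadicCube_iff, children, Fintype.mem_piFinset]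
  refine forall_congr' fun i => ?_
  have hp : (0 : ℤ) < 2 ^ j := by positivity
  rw [floor_mul_pow_add _ k j, mem_dyadicCube_iff.1 hx i, Finset.mem_Ico,
    Int.ediv_eq_iff_of_pos hp, add_mul, one_mul]

theorem dyadicCube_nonempty (c : ℕ × (Fin d → ℤ)) : (dyadicCube c).Nonempty := by
  refine ⟨WithLp.toLp 2 fun i => (c.2 i : ℝ) / 2 ^ c.1, fun i => ⟨le_rfl, ?_⟩⟩
  exact (div_lt_div_iff_of_pos_right (by positivity)).2 (by linarith)

theorem dyadicCube_subset_of_mem_children {k j : ℕ} {z u : Fin d → ℤ} (hu : u ∈ children j z) :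
    dyadicCube (k + j, u) ⊆ dyadicCube (k, z) := fun _ hx => (mem_children_iff hx).1 hu

theorem dyadicCube_subset_of_mem {k k' : ℕ} {z u : Fin d → ℤ} {x : EuclideanSpace ℝ (Fin d)}
    (hk : k ≤ k') (hx : x ∈ dyadicCube (k, z)) (hx' : x ∈ dyadicCube (k', u)) :
    dyadicCube (k', u) ⊆ dyadicCube (k, z) := by
  obtain ⟨j, rfl⟩ := Nat.exists_eq_add_of_le hk
  exact dyadicCube_subset_of_mem_children ((mem_children_iff hx').2 hx)

/-- The closed dyadic cube. -/
def closedDyadic (c : ℕ × (Fin d → ℤ)) : Set (EuclideanSpace ℝ (Fin d)) :=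
  {x | ∀ i, (c.2 i : ℝ) / 2 ^ c.1 ≤ x i ∧ x i ≤ ((c.2 i : ℝ) + 1) / 2 ^ c.1}

theorem dyadicCube_subset_closedDyadic (c : ℕ × (Fin d → ℤ)) : dyadicCube c ⊆ closedDyadic c :=
  fun _ hx i => ⟨(hx i).1, (hx i).2.le⟩

theorem dist_le_of_mem_closedDyadic {c : ℕ × (Fin d → ℤ)} {x y : EuclideanSpace ℝ (Fin d)}
    (hx : x ∈ closedDyadic c) (hy : y ∈ closedDyadic c) : dist x y ≤ d * (2 ^ c.1)⁻¹ := by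
  rw [dist_eq_norm]
  refine norm_le_card_mul fun i => ?_
  have h1 := hx i
  have h2 := hy i
  have h3 : ((c.2 i : ℝ) + 1) / 2 ^ c.1 = (c.2 i : ℝ) / 2 ^ c.1 + (2 ^ c.1)⁻¹ := by
    rw [add_div, one_div]
  rw [h3] at h1 h2
  rw [PiLp.sub_apply, abs_le]
  constructor <;> linarith [h1.1, h1.2, h2.1, h2.2]

theorem isCompact_closedDyadic (c : ℕ × (Fin d → ℤ)) : IsCompact (closedDyadic c) := by
  refine Metric.isCompact_of_isClosed_isBounded ?_ ?_
  · have : closedDyadic c = ⋂ i, {x : EuclideanSpace ℝ (Fin d) |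
        (c.2 i : ℝ) / 2 ^ c.1 ≤ x i ∧ x i ≤ ((c.2 i : ℝ) + 1) / 2 ^ c.1} := by
      ext; simp [closedDyadic]
    rw [this]
    refine isClosed_iInter fun i => ?_
    have hc : Continuous fun x : EuclideanSpace ℝ (Fin d) => x i := by fun_prop
    exact (isClosed_le continuous_const hc).inter (isClosed_le hc continuous_const)
  · exact Metric.isBounded_iff.2 ⟨_, fun x hx y hy => dist_le_of_mem_closedDyadic hx hy⟩

theorem dyadicCube_eq_box (c : ℕ × (Fin d → ℤ)) :
    dyadicCube c = box (fun i => (c.2 i : ℝ) / 2 ^ c.1) (2 ^ c.1)⁻¹ := by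
  ext x
  simp only [dyadicCube, box, add_div, one_div]

theorem measurableSet_dyadicCube (c : ℕ × (Fin d → ℤ)) : MeasurableSet (dyadicCube c) := by
  rw [dyadicCube_eq_box]
  exact measurableSet_box _ _

/-! ### Cantor construction and net content -/

/-- Inner regularity gives a compact set of mass more than one half, and conditioning on it at most
doubles the constant. Compactness leaves room for refinement inside an open set. -/
theorem IsSpreadOn.exists_isCompact {t C ℓ : ℝ} {U : Set (EuclideanSpace ℝ (Fin d))}
    (h : IsSpreadOn t C ℓ U) (hU : IsOpen U) : ∃ K ⊆ U, IsCompact K ∧ IsSpreadOn t (2 * C) ℓ K := by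
  obtain ⟨ν, hν, hν0, hνb⟩ := h
  have hU1 : ν U = 1 := by
    rw [← prob_compl_eq_zero_iff hU.measurableSet]; exact hν0
  obtain ⟨K, hKU, hK, hKν⟩ := hU.exists_lt_isCompact (μ := ν) (r := 2⁻¹)
    (by rw [hU1]; exact ENNReal.inv_lt_one.2 (by norm_num))
  have hK0 : ν K ≠ 0 := (lt_of_le_of_lt bot_le hKν).ne'
  refine ⟨K, hKU, hK, ProbabilityTheory.cond ν K, ProbabilityTheory.cond_isProbabilityMeasure hK0,
    ?_, fun y r hr => ?_⟩
  · rw [ProbabilityTheory.cond_apply hK.measurableSet]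
    simp
  · rw [ProbabilityTheory.cond_apply hK.measurableSet, mul_assoc 2,
      ENNReal.ofReal_mul (by norm_num)]
    gcongr
    · rw [ENNReal.inv_le_iff_inv_le]
      simpa using hKν.le
    · exact (measure_mono inter_subset_right).trans (hνb y r hr)

theorem measure_dyadicCube_le {t C ℓ : ℝ} {ν : Measure (EuclideanSpace ℝ (Fin d))} [NeZero d]
    (h : ∀ y r, 0 < r → ν (Metric.closedBall y r) ≤ ENNReal.ofReal (C * (r / ℓ) ^ t))
    (c : ℕ × (Fin d → ℤ)) :
    ν (dyadicCube c) ≤ ENNReal.ofReal (C * (d * (2 ^ c.1)⁻¹ / ℓ) ^ t) := by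
  obtain ⟨x, hx⟩ := dyadicCube_nonempty c
  have hd : (0 : ℝ) < d := by exact_mod_cast Nat.pos_of_neZero d
  refine (measure_mono fun y hy => ?_).trans (h x (d * (2 ^ c.1)⁻¹) (by positivity))
  exact dist_le_of_mem_closedDyadic (dyadicCube_subset_closedDyadic c hy)
    (dyadicCube_subset_closedDyadic c hx)

/-- `V` carries spread measures in all small dyadic subcubes of `c₀`. -/
def IsDyadicSpread (t : ℝ) (c₀ : ℕ × (Fin d → ℤ)) (V : Set (EuclideanSpace ℝ (Fin d))) : Prop :=
  ∃ (C : ℝ) (k₀ : ℕ), ∀ k, k₀ ≤ k → ∀ z : Fin d → ℤ, dyadicCube (k, z) ⊆ dyadicCube c₀ →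
    IsSpreadOn t C (2 ^ k)⁻¹ (V ∩ interior (dyadicCube (k, z)))

theorem tendsto_inv_two_pow : Tendsto (fun k : ℕ => ((2 : ℝ) ^ k)⁻¹) atTop (nhds 0) := by
  refine (tendsto_pow_atTop_nhds_zero_of_lt_one (r := (2 : ℝ)⁻¹) (by norm_num)
    (by norm_num)).congr fun k => ?_
  rw [inv_pow]

theorem exists_pow_le (C : ℝ) (k₀ : ℕ) {s : ℝ} (hs : 0 < s) :
    ∃ j, k₀ ≤ j ∧ C ≤ ((2 : ℝ) ^ s) ^ j := by
  have h : Tendsto (fun j : ℕ => ((2 : ℝ) ^ s) ^ j) atTop atTop :=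
    tendsto_pow_atTop_atTop_of_one_lt (Real.one_lt_rpow (by norm_num) hs)
  obtain ⟨j, h1, h2⟩ := ((eventually_ge_atTop k₀).and (h.eventually_ge_atTop C)).exists
  exact ⟨j, h1, h2⟩

/-- After splitting a cube into many equal parts, the constant in the spreading condition can be
taken to be `1`. -/
theorem IsDyadicSpread.exists_measure [NeZero d] {t : ℝ} (htd : t < d)
    {c₀ : ℕ × (Fin d → ℤ)} {V : Set (EuclideanSpace ℝ (Fin d))} (hV : IsOpen V)
    (h : IsDyadicSpread t c₀ V) {k : ℕ} {z : Fin d → ℤ}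
    (hk : dyadicCube (k, z) ⊆ dyadicCube c₀) :
    ∃ ν : Measure (EuclideanSpace ℝ (Fin d)), IsProbabilityMeasure ν ∧
      ∃ K ⊆ V ∩ interior (dyadicCube (k, z)), IsCompact K ∧ ν Kᶜ = 0 ∧
      ∀ c : ℕ × (Fin d → ℤ), k ≤ c.1 →
        ν (dyadicCube c) ≤ ENNReal.ofReal (((2 ^ c.1)⁻¹ / (2 ^ k)⁻¹) ^ t) := by
  classical
  obtain ⟨C, k₀, hC⟩ := h
  have hd : (0 : ℝ) < d := by exact_mod_cast Nat.pos_of_neZero d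
  -- Averaging over `2 ^ (j d)` children divides masses by this number, while rescaling the radii
  -- costs only `2 ^ (j t)`. For large `j` the gain beats `2 * C * d ^ t`.
  obtain ⟨j, hj, hjC⟩ := exists_pow_le (2 * C * d ^ t) k₀ (sub_pos.2 htd)
  have hch : ∀ u : Fin d → ℤ, ∃ (ν : Measure (EuclideanSpace ℝ (Fin d))) (K : Set _),
      u ∈ children j z → K ⊆ V ∩ interior (dyadicCube (k + j, u)) ∧ IsCompact K ∧
        IsProbabilityMeasure ν ∧ ν Kᶜ = 0 ∧ ∀ y r, 0 < r →
          ν (Metric.closedBall y r) ≤ ENNReal.ofReal (2 * C * (r / (2 ^ (k + j))⁻¹) ^ t) := by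
    intro u
    by_cases hu : u ∈ children j z
    · obtain ⟨K, hK, hK', ν, h1, h2, h3⟩ := (hC (k + j) (by omega) u
        ((dyadicCube_subset_of_mem_children hu).trans hk)).exists_isCompact
          (hV.inter isOpen_interior)
      exact ⟨ν, K, fun _ => ⟨hK, hK', h1, h2, h3⟩⟩
    · exact ⟨0, ∅, fun h => absurd h hu⟩
  choose ν K hνK using hch
  have hcard0 : ((children j z).card : ℝ≥0∞) ≠ 0 := by
    rw [card_children]; simp
  have hcardt : ((children j z).card : ℝ≥0∞) ≠ ⊤ := ENNReal.natCast_ne_top _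
  have hdisj : ∀ u ∈ children j z, ∀ s : Set (EuclideanSpace ℝ (Fin d)),
      Disjoint s (dyadicCube (k + j, u)) → ν u s = 0 := by
    intro u hu s hs
    refine measure_mono_null (t := (K u)ᶜ) (fun x hx hxK => ?_) (hνK u hu).2.2.2.1
    exact hs.notMem_of_mem_left hx (interior_subset ((hνK u hu).1 hxK).2)
  have hone : ∀ u ∈ children j z, ∀ s, ν u s ≤ 1 := fun u hu s => by
    have := (hνK u hu).2.2.1
    exact prob_le_one
  set μ : Measure (EuclideanSpace ℝ (Fin d)) :=
    ((children j z).card : ℝ≥0∞)⁻¹ • ∑ u ∈ children j z, ν u with hμ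
  have hμa : ∀ s, μ s = ((children j z).card : ℝ≥0∞)⁻¹ * ∑ u ∈ children j z, ν u s := by
    intro s
    rw [hμ, Measure.smul_apply, Measure.finsetSum_apply, smul_eq_mul]
  refine ⟨μ, ⟨?_⟩, ⋃ u ∈ children j z, K u, ?_, ?_, ?_, ?_⟩
  · have : ∀ u ∈ children j z, ν u univ = 1 := fun u hu => by
      have := (hνK u hu).2.2.1
      exact measure_univ
    rw [hμa, Finset.sum_congr rfl this, Finset.sum_const, nsmul_eq_mul, mul_one]
    exact ENNReal.inv_mul_cancel hcard0 hcardt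
  · exact iUnion₂_subset fun u hu => (hνK u hu).1.trans (inter_subset_inter_right _
      (interior_mono (dyadicCube_subset_of_mem_children hu)))
  · exact (children j z).isCompact_biUnion fun u hu => (hνK u hu).2.1
  · rw [hμa, Finset.sum_eq_zero, mul_zero]
    intro u hu
    exact measure_mono_null (compl_subset_compl.2 (subset_iUnion₂_of_subset u hu subset_rfl))
      (hνK u hu).2.2.2.1
  · rintro ⟨k', z'⟩ hk'
    have hcardR : ((children j z).card : ℝ) = (2 ^ j) ^ d := by rw [card_children]; push_cast; rfl
    have hinv : ((children j z).card : ℝ≥0∞)⁻¹ = ENNReal.ofReal ((2 ^ j) ^ d)⁻¹ := by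
      rw [← ENNReal.ofReal_natCast, hcardR, ENNReal.ofReal_inv_of_pos (by positivity)]
    rw [hμa]
    -- A cube at or below the level of the children meets at most one of them. A coarser one, of
    -- level at least `k`, contains at most `(2 ^ q) ^ d` children, and `t < d` suffices.
    rcases le_total (k + j) k' with hkk | hkk
    · by_cases hex : ∃ u ∈ children j z, ¬ Disjoint (dyadicCube (k', z')) (dyadicCube (k + j, u))
      · obtain ⟨u, hu, hdu⟩ := hex
        rw [Set.not_disjoint_iff] at hdu
        obtain ⟨x, hx1, hx2⟩ := hdu
        have hsub := dyadicCube_subset_of_mem hkk hx2 hx1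
        rw [Finset.sum_eq_single_of_mem u hu, hinv]
        · calc ENNReal.ofReal ((2 ^ j) ^ d)⁻¹ * ν u (dyadicCube (k', z'))
              ≤ ENNReal.ofReal ((2 ^ j) ^ d)⁻¹ *
                ENNReal.ofReal (2 * C * (d * (2 ^ k')⁻¹ / (2 ^ (k + j))⁻¹) ^ t) := by
                gcongr
                exact measure_dyadicCube_le (hνK u hu).2.2.2.2 (k', z')
            _ = ENNReal.ofReal (((2 ^ j) ^ d)⁻¹ *
                (2 * C * (d * (2 ^ k')⁻¹ / (2 ^ (k + j))⁻¹) ^ t)) :=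
                (ENNReal.ofReal_mul (by positivity)).symm
            _ ≤ _ := by
                refine ENNReal.ofReal_le_ofReal ?_
                have e1 : (d * (2 ^ k')⁻¹ / (2 ^ (k + j))⁻¹ : ℝ) ^ t =
                    d ^ t * ((2 ^ j) ^ t * ((2 ^ k')⁻¹ / (2 ^ k)⁻¹) ^ t) := by
                  rw [← Real.mul_rpow (by positivity) (by positivity),
                    ← Real.mul_rpow (by positivity) (by positivity)]
                  congr 1
                  rw [pow_add]
                  field_simp
                have e2 : (((2 : ℝ) ^ ((d : ℝ) - t)) ^ j) * (2 ^ j) ^ t = (2 ^ j) ^ d := by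
                  rw [← Real.rpow_natCast, ← Real.rpow_natCast, ← Real.rpow_natCast,
                    ← Real.rpow_mul (by norm_num), ← Real.rpow_mul (by norm_num),
                    ← Real.rpow_mul (by norm_num), ← Real.rpow_add (by norm_num)]
                  congr 1
                  ring
                rw [e1]
                calc ((2 ^ j) ^ d)⁻¹ * (2 * C * (d ^ t * ((2 ^ j) ^ t *
                      ((2 ^ k')⁻¹ / (2 ^ k)⁻¹ : ℝ) ^ t)))
                    = ((2 ^ j) ^ d)⁻¹ * ((2 * C * d ^ t) * (2 ^ j) ^ t) *
                      ((2 ^ k')⁻¹ / (2 ^ k)⁻¹ : ℝ) ^ t := by ring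
                  _ ≤ ((2 ^ j) ^ d)⁻¹ * ((((2 : ℝ) ^ ((d : ℝ) - t)) ^ j) * (2 ^ j) ^ t) *
                      ((2 ^ k')⁻¹ / (2 ^ k)⁻¹ : ℝ) ^ t := by gcongr
                  _ = ((2 ^ k')⁻¹ / (2 ^ k)⁻¹ : ℝ) ^ t := by
                      rw [e2, inv_mul_cancel₀ (by positivity), one_mul]
        · intro u' hu' hne
          refine hdisj u' hu' _ (Disjoint.mono_left hsub ?_)
          rw [Set.disjoint_left]
          exact fun y hy hy' => hne (eq_of_mem_dyadicCube hy' hy)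
      · push Not at hex
        rw [Finset.sum_eq_zero fun u hu => hdisj u hu _ (hex u hu), mul_zero]
        exact bot_le
    · obtain ⟨q, hq⟩ := Nat.exists_eq_add_of_le hkk
      have hsum : ∑ u ∈ children j z, ν u (dyadicCube (k', z')) ≤ ((2 ^ q) ^ d : ℕ) := by
        calc ∑ u ∈ children j z, ν u (dyadicCube (k', z'))
            ≤ ∑ u ∈ children j z, if u ∈ children q z' then 1 else 0 := by
              refine Finset.sum_le_sum fun u hu => ?_
              split_ifs with hu'
              · exact hone u hu _
              · refine (hdisj u hu _ (Set.disjoint_left.2 fun x hx hx' => hu' ?_)).le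
                rw [hq] at hx'
                exact (mem_children_iff hx').2 hx
          _ ≤ ((2 ^ q) ^ d : ℕ) := by
              rw [← card_children q z', Finset.sum_ite_mem, Finset.sum_const, nsmul_eq_mul, mul_one]
              exact_mod_cast Finset.card_le_card Finset.inter_subset_right
      calc _ ≤ ENNReal.ofReal ((2 ^ j) ^ d)⁻¹ * ((2 ^ q) ^ d : ℕ) := by rw [hinv]; gcongr
        _ = ENNReal.ofReal (((2 ^ j) ^ d)⁻¹ * (2 ^ q) ^ d) := by
            rw [ENNReal.ofReal_mul (by positivity), ← ENNReal.ofReal_natCast]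
            push_cast
            rfl
        _ ≤ _ := by
            refine ENNReal.ofReal_le_ofReal ?_
            have hr1 : ((2 ^ k')⁻¹ / (2 ^ k)⁻¹ : ℝ) ≤ 1 := by
              rw [div_le_one (by positivity)]
              gcongr
              · norm_num
            have e : (((2 ^ j) ^ d)⁻¹ * (2 ^ q) ^ d : ℝ) = ((2 ^ k')⁻¹ / (2 ^ k)⁻¹) ^ (d : ℝ) := by
              rw [Real.rpow_natCast, ← inv_pow, ← mul_pow]
              congr 1
              have : (2 : ℝ) ^ k * 2 ^ j = 2 ^ k' * 2 ^ q := by rw [← pow_add, ← pow_add, hq]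
              field_simp
              linarith
            rw [e]
            exact Real.rpow_le_rpow_of_exponent_ge (by positivity) hr1 htd.le

/-- A stage in the construction of a Cantor set inside the dyadic cube `c₀`: a probability measure
`μ` carried by finitely many dyadic cubes `(k, z)`, `z ∈ S`. -/
structure IsCantorStage (t : ℝ) (c₀ : ℕ × (Fin d → ℤ))
    (μ : Measure (EuclideanSpace ℝ (Fin d))) (k : ℕ) (S : Finset (Fin d → ℤ)) : Prop where
  isProb : IsProbabilityMeasure μ
  null_compl : μ (⋃ z ∈ S, dyadicCube (k, z))ᶜ = 0
  subset : ∀ z ∈ S, dyadicCube (k, z) ⊆ dyadicCube c₀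
  measure_le : ∀ c : ℕ × (Fin d → ℤ),
    μ (dyadicCube c) ≤ ENNReal.ofReal (((2 ^ c.1)⁻¹ / (2 ^ c₀.1)⁻¹) ^ t)

theorem isCantorStage_start [NeZero d] {t : ℝ} (ht : 0 ≤ t) (htd : t < d)
    {c₀ : ℕ × (Fin d → ℤ)} {V : Set (EuclideanSpace ℝ (Fin d))} (hV : IsOpen V)
    (h : IsDyadicSpread t c₀ V) : ∃ μ, IsCantorStage t c₀ μ c₀.1 {c₀.2} := by
  obtain ⟨μ, hμ, K, hK, -, hK0, hle⟩ := h.exists_measure htd hV (k := c₀.1) (z := c₀.2) subset_rfl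
  refine ⟨μ, hμ, ?_, ?_, fun c => ?_⟩
  · refine measure_mono_null (compl_subset_compl.2 ?_) hK0
    simpa using hK.trans (inter_subset_right.trans interior_subset)
  · simp
  · rcases le_total c₀.1 c.1 with hc | hc
    · exact hle c hc
    · refine prob_le_one.trans (ENNReal.one_le_ofReal.2 (Real.one_le_rpow ?_ ht))
      rw [one_le_div (by positivity)]
      gcongr
      norm_num

/-- The mass of each cube is redistributed inside it by a spread measure with constant 1 carried by
a compact part of `V`. The constants multiply to 1, so the bound on masses is preserved through any
number of stages. -/
theorem IsCantorStage.exists_next [NeZero d] {t : ℝ} (htd : t < d)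
    {c₀ : ℕ × (Fin d → ℤ)} {V : Set (EuclideanSpace ℝ (Fin d))} (hV : IsOpen V)
    (h : IsDyadicSpread t c₀ V) {μ : Measure (EuclideanSpace ℝ (Fin d))} {k : ℕ}
    {S : Finset (Fin d → ℤ)} (hS : IsCantorStage t c₀ μ k S) :
    ∃ μ' k' S', IsCantorStage t c₀ μ' k' S' ∧ k < k' ∧
      (⋃ z ∈ S', closedDyadic (k', z)) ⊆ V ∩ ⋃ z ∈ S, interior (dyadicCube (k, z)) := by
  classical
  have hd : (0 : ℝ) < d := by exact_mod_cast Nat.pos_of_neZero d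
  have hμp := hS.isProb
  have hex : ∀ z : Fin d → ℤ, ∃ (ν : Measure (EuclideanSpace ℝ (Fin d))) (K : Set _), z ∈ S →
      IsProbabilityMeasure ν ∧ K ⊆ V ∩ interior (dyadicCube (k, z)) ∧ IsCompact K ∧ ν Kᶜ = 0 ∧
      ∀ c : ℕ × (Fin d → ℤ), k ≤ c.1 →
        ν (dyadicCube c) ≤ ENNReal.ofReal (((2 ^ c.1)⁻¹ / (2 ^ k)⁻¹) ^ t) := by
    intro z
    by_cases hz : z ∈ S
    · obtain ⟨ν, h1, K, h2, h3, h4, h5⟩ := h.exists_measure htd hV (hS.subset z hz)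
      exact ⟨ν, K, fun _ => ⟨h1, h2, h3, h4, h5⟩⟩
    · exact ⟨0, ∅, fun h => absurd h hz⟩
  choose ν K hνK using hex
  have hdisj : ∀ z ∈ S, ∀ s : Set (EuclideanSpace ℝ (Fin d)),
      Disjoint s (dyadicCube (k, z)) → ν z s = 0 := by
    intro z hz s hs
    refine measure_mono_null (t := (K z)ᶜ) (fun x hx hxK => ?_) (hνK z hz).2.2.2.1
    exact hs.notMem_of_mem_left hx (interior_subset ((hνK z hz).2.1 hxK).2)
  have hone : ∀ z ∈ S, ∀ s, ν z s ≤ 1 := fun z hz s => by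
    have := (hνK z hz).1
    exact prob_le_one
  have hpair : ∀ s : Set (Fin d → ℤ), s.PairwiseDisjoint fun z => dyadicCube (k, z) := by
    intro s z _ z' _ hne
    exact Set.disjoint_left.2 fun x hx hx' => hne (eq_of_mem_dyadicCube hx hx')
  have hsumμ : ∀ T : Finset (Fin d → ℤ),
      ∑ z ∈ T, μ (dyadicCube (k, z)) = μ (⋃ z ∈ T, dyadicCube (k, z)) := fun T =>
    (measure_biUnion_finset (hpair T) fun z _ => measurableSet_dyadicCube _).symm
  set K' : Set (EuclideanSpace ℝ (Fin d)) := ⋃ z ∈ S, K z with hK'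
  have hK'c : IsCompact K' := S.isCompact_biUnion fun z hz => (hνK z hz).2.2.1
  set O : Set (EuclideanSpace ℝ (Fin d)) := V ∩ ⋃ z ∈ S, interior (dyadicCube (k, z)) with hO
  have hOo : IsOpen O := hV.inter (isOpen_biUnion fun _ _ => isOpen_interior)
  have hK'O : K' ⊆ O := iUnion₂_subset fun z hz x hx =>
    ⟨((hνK z hz).2.1 hx).1, mem_iUnion₂.2 ⟨z, hz, ((hνK z hz).2.1 hx).2⟩⟩
  obtain ⟨δ, hδ, hδO⟩ := hK'c.exists_thickening_subset_open hOo hK'O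
  -- At this level closed cubes that meet `K'` stay in `O`; `1 ≤ j` makes the levels strictly
  -- increasing.
  obtain ⟨j, hj1, hjδ⟩ : ∃ j : ℕ, 1 ≤ j ∧ (d : ℝ) * (2 ^ (k + j))⁻¹ < δ := by
    have h1 : Tendsto (fun j : ℕ => (d : ℝ) * (2 ^ (k + j))⁻¹) atTop (nhds 0) := by
      have := (tendsto_inv_two_pow.comp (tendsto_add_atTop_nat k)).const_mul (d : ℝ)
      rw [mul_zero] at this
      refine this.congr fun j => ?_
      simp [add_comm]
    exact ((eventually_ge_atTop 1).and (h1.eventually_lt_const hδ)).exists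
  set S' : Finset (Fin d → ℤ) :=
    (S.biUnion fun z => children j z).filter fun u => (dyadicCube (k + j, u) ∩ K').Nonempty
  set μ' : Measure (EuclideanSpace ℝ (Fin d)) := ∑ z ∈ S, μ (dyadicCube (k, z)) • ν z with hμ'
  have hμa : ∀ s, μ' s = ∑ z ∈ S, μ (dyadicCube (k, z)) * ν z s := by
    intro s
    rw [hμ', Measure.finsetSum_apply]
    rfl
  have hμS : μ (⋃ z ∈ S, dyadicCube (k, z)) = 1 := by
    rw [← prob_compl_eq_zero_iff (S.measurableSet_biUnion fun z _ => measurableSet_dyadicCube _)]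
    exact hS.null_compl
  have hK'0 : μ' K'ᶜ = 0 := by
    rw [hμa, Finset.sum_eq_zero]
    intro z hz
    rw [measure_mono_null (compl_subset_compl.2 (subset_iUnion₂_of_subset z hz subset_rfl))
      (hνK z hz).2.2.2.1, mul_zero]
  refine ⟨μ', k + j, S', ⟨⟨?_⟩, ?_, ?_, ?_⟩, by omega, ?_⟩
  · have : ∀ z ∈ S, μ (dyadicCube (k, z)) * ν z univ = μ (dyadicCube (k, z)) := fun z hz => by
      have := (hνK z hz).1
      rw [measure_univ, mul_one]
    rw [hμa, Finset.sum_congr rfl this, hsumμ, hμS]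
  · refine measure_mono_null (compl_subset_compl.2 fun x hx => ?_) hK'0
    have hxu := mem_dyadicCube_floor (k + j) x
    obtain ⟨z, hz, hxz⟩ := mem_iUnion₂.1 hx
    refine mem_iUnion₂.2 ⟨_, Finset.mem_filter.2 ⟨Finset.mem_biUnion.2 ⟨z, hz, ?_⟩,
      x, hxu, hx⟩, hxu⟩
    exact (mem_children_iff hxu).2 (interior_subset ((hνK z hz).2.1 hxz).2)
  · intro u hu
    obtain ⟨z, hz, huz⟩ := Finset.mem_biUnion.1 (Finset.mem_filter.1 hu).1
    exact (dyadicCube_subset_of_mem_children huz).trans (hS.subset z hz)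
  · intro c
    rw [hμa]
    rcases le_total k c.1 with hc | hc
    · by_cases hex : ∃ z ∈ S, ¬ Disjoint (dyadicCube c) (dyadicCube (k, z))
      · obtain ⟨z, hz, hdz⟩ := hex
        rw [Set.not_disjoint_iff] at hdz
        obtain ⟨x, hx1, hx2⟩ := hdz
        have hsub : dyadicCube c ⊆ dyadicCube (k, z) := dyadicCube_subset_of_mem hc hx2 hx1
        rw [Finset.sum_eq_single_of_mem z hz]
        -- The bound for the cube of level `k` and the relative bound inside it telescope.
        · refine (mul_le_mul' (hS.measure_le (k, z)) ((hνK z hz).2.2.2.2 c hc)).trans ?_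
          rw [← ENNReal.ofReal_mul (by positivity),
            ← Real.mul_rpow (by positivity) (by positivity)]
          refine ENNReal.ofReal_le_ofReal (le_of_eq ?_)
          congr 1
          field_simp
        · intro z' hz' hne
          rw [hdisj z' hz' _ (Disjoint.mono_left hsub ?_), mul_zero]
          exact Set.disjoint_left.2 fun y hy hy' => hne (eq_of_mem_dyadicCube hy' hy)
      · push Not at hex
        rw [Finset.sum_eq_zero fun z hz => by rw [hdisj z hz _ (hex z hz), mul_zero]]
        exact bot_le
    -- No mass moves between cubes of level `k`, so coarser cubes gain none.
    · refine le_trans ?_ (hS.measure_le c)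
      calc ∑ z ∈ S, μ (dyadicCube (k, z)) * ν z (dyadicCube c)
          ≤ ∑ z ∈ S, if dyadicCube (k, z) ⊆ dyadicCube c then μ (dyadicCube (k, z)) else 0 := by
            refine Finset.sum_le_sum fun z hz => ?_
            split_ifs with hzc
            · exact mul_le_of_le_one_right' (hone z hz _)
            · rw [hdisj z hz _ (Set.disjoint_left.2 fun x hx hx' =>
                hzc (dyadicCube_subset_of_mem (k := c.1) (z := c.2) hc hx hx')), mul_zero]
        _ = μ (⋃ z ∈ S.filter (fun z => dyadicCube (k, z) ⊆ dyadicCube c), dyadicCube (k, z)) := by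
            rw [← hsumμ, Finset.sum_filter]
        _ ≤ μ (dyadicCube c) :=
            measure_mono (iUnion₂_subset fun z hz => (Finset.mem_filter.1 hz).2)
  · refine iUnion₂_subset fun u hu x hx => hδO ?_
    obtain ⟨y, hy1, hy2⟩ := (Finset.mem_filter.1 hu).2
    exact Metric.mem_thickening_iff.2 ⟨y, hy2, (dist_le_of_mem_closedDyadic hx
      (dyadicCube_subset_closedDyadic _ hy1)).trans_lt hjδ⟩

/-- Countable intersections of open sets that carry spread measures in all small cubes have full net
content. -/
theorem le_netContent_iInter [NeZero d] {t : ℝ} (ht : 0 ≤ t) (htd : t < d)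
    {c₀ : ℕ × (Fin d → ℤ)} {V : ℕ → Set (EuclideanSpace ℝ (Fin d))} (hV : ∀ n, IsOpen (V n))
    (h : ∀ n, IsDyadicSpread t c₀ (V n)) :
    ENNReal.ofReal (((2 ^ c₀.1)⁻¹ : ℝ) ^ t) ≤ netContent t ((⋂ n, V n) ∩ dyadicCube c₀) := by
  classical
  obtain ⟨μ₀, h₀⟩ := isCantorStage_start ht htd (hV 0) (h 0)
  let Stage := {p : Measure (EuclideanSpace ℝ (Fin d)) × ℕ × Finset (Fin d → ℤ) //
    IsCantorStage t c₀ p.1 p.2.1 p.2.2}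
  have hnext : ∀ (n : ℕ) (p : Stage), ∃ q : Stage, p.1.2.1 < q.1.2.1 ∧
      (⋃ z ∈ q.1.2.2, closedDyadic (q.1.2.1, z)) ⊆
        V n ∩ ⋃ z ∈ p.1.2.2, interior (dyadicCube (p.1.2.1, z)) := by
    rintro n ⟨⟨μ, k, S⟩, hp⟩
    obtain ⟨μ', k', S', h1, h2, h3⟩ := hp.exists_next htd (hV n) (h n)
    exact ⟨⟨⟨μ', k', S'⟩, h1⟩, h2, h3⟩
  choose next hnk hnS using hnext
  let st : ℕ → Stage := fun n => Nat.rec ⟨⟨μ₀, c₀.1, {c₀.2}⟩, h₀⟩ (fun n p => next n p) n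
  set k : ℕ → ℕ := fun n => (st n).1.2.1 with hk
  set S : ℕ → Finset (Fin d → ℤ) := fun n => (st n).1.2.2 with hS
  set K : ℕ → Set (EuclideanSpace ℝ (Fin d)) := fun n => ⋃ z ∈ S n, closedDyadic (k n, z) with hK
  have hkm : StrictMono k := strictMono_nat_of_lt_succ fun n => hnk n (st n)
  have hKn : ∀ n, K (n + 1) ⊆ V n ∩ ⋃ z ∈ S n, interior (dyadicCube (k n, z)) :=
    fun n => hnS n (st n)
  have hKint : ∀ n, (⋃ z ∈ S n, interior (dyadicCube (k n, z))) ⊆ K n := fun n =>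
    iUnion₂_mono fun z _ => interior_subset.trans (dyadicCube_subset_closedDyadic _)
  have hKanti : Antitone K := antitone_nat_of_succ_le fun n x hx => hKint n (hKn n hx).2
  have hKc : ∀ n, IsCompact (K n) := fun n => (S n).isCompact_biUnion fun z _ =>
    isCompact_closedDyadic _
  refine le_iInf₂ fun C hC => ?_
  -- A point of the Cantor set that lies in a cube `c` of the cover also lies in the interior of a
  -- stage cube at least as fine, hence in the interior of `c`. The half-open cover can thus be
  -- treated as an open one.
  have hKcov : (⋂ n, K n) ⊆ ⋃ c : C, interior (dyadicCube (c : ℕ × (Fin d → ℤ))) := by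
    intro x hx
    rw [mem_iInter] at hx
    have hx0 : x ∈ (⋂ n, V n) ∩ dyadicCube c₀ := by
      refine ⟨mem_iInter.2 fun n => (hKn n (hx (n + 1))).1, ?_⟩
      obtain ⟨z, hz, hxz⟩ := mem_iUnion₂.1 (hKn 0 (hx 1)).2
      exact (st 0).2.subset z hz (interior_subset hxz)
    obtain ⟨c, hc, hxc⟩ := mem_iUnion₂.1 (hC hx0)
    obtain ⟨z, hz, hxz⟩ := mem_iUnion₂.1 (hKn c.1 (hx (c.1 + 1))).2
    exact mem_iUnion.2 ⟨⟨c, hc⟩, interior_mono (dyadicCube_subset_of_mem (k := c.1) (z := c.2)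
      (hkm.le_apply) hxc (interior_subset hxz)) hxz⟩
  -- Compactness brings the cover back to a single stage, so that the measure of that stage decides
  -- and no limit measure is needed.
  obtain ⟨n, hn⟩ := exists_subset_nhds_of_isCompact' (directed_of_isDirected_le fun m n hmn =>
    hKanti hmn) hKc (fun n => (hKc n).isClosed)
    fun x hx => (isOpen_iUnion fun c : C => isOpen_interior).mem_nhds (hKcov hx)
  obtain ⟨T, hT⟩ := (hKc n).elim_finite_subcover _ (fun c : C => isOpen_interior) hn
  have hst := (st n).2
  have hp := hst.isProb
  have h1 : (1 : ℝ≥0∞) ≤ ∑ c ∈ T, ENNReal.ofReal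
      (((2 ^ (c : ℕ × (Fin d → ℤ)).1)⁻¹ / (2 ^ c₀.1)⁻¹ : ℝ) ^ t) := by
    calc (1 : ℝ≥0∞) = (st n).1.1 (⋃ z ∈ S n, dyadicCube (k n, z)) := by
          symm
          rw [← prob_compl_eq_zero_iff
            ((S n).measurableSet_biUnion fun z _ => measurableSet_dyadicCube _)]
          exact hst.null_compl
      _ ≤ (st n).1.1 (⋃ c ∈ T, dyadicCube (c : ℕ × (Fin d → ℤ))) := by
          refine measure_mono (((iUnion₂_mono fun z _ =>
            dyadicCube_subset_closedDyadic _).trans hT).trans ?_)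
          exact iUnion₂_mono fun c _ => interior_subset
      _ ≤ ∑ c ∈ T, (st n).1.1 (dyadicCube (c : ℕ × (Fin d → ℤ))) :=
          measure_biUnion_finset_le _ _
      _ ≤ _ := Finset.sum_le_sum fun c _ => hst.measure_le _
  calc ENNReal.ofReal (((2 ^ c₀.1)⁻¹ : ℝ) ^ t)
      ≤ ENNReal.ofReal (((2 ^ c₀.1)⁻¹ : ℝ) ^ t) * ∑ c ∈ T, ENNReal.ofReal
          (((2 ^ (c : ℕ × (Fin d → ℤ)).1)⁻¹ / (2 ^ c₀.1)⁻¹ : ℝ) ^ t) := le_mul_of_one_le_right' h1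
    _ = ∑ c ∈ T, ENNReal.ofReal (((2 ^ (c : ℕ × (Fin d → ℤ)).1)⁻¹ : ℝ) ^ t) := by
        rw [Finset.mul_sum]
        refine Finset.sum_congr rfl fun c _ => ?_
        rw [← ENNReal.ofReal_mul (by positivity), ← Real.mul_rpow (by positivity) (by positivity),
          mul_div_cancel₀ _ (by positivity)]
    _ ≤ ∑' c : C, ENNReal.ofReal ((((2 : ℝ) ^ (c : ℕ × (Fin d → ℤ)).1)⁻¹) ^ t) :=
        ENNReal.sum_le_tsum _

/-! ### Net content and Hausdorff dimension -/

theorem netContent_dyadicCube_le (t : ℝ) (c : ℕ × (Fin d → ℤ)) :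
    netContent t (dyadicCube c) ≤ ENNReal.ofReal (((2 ^ c.1)⁻¹ : ℝ) ^ t) := by
  refine (iInf₂_le {c} (by simp)).trans (le_of_eq ?_)
  rw [tsum_singleton c fun c : ℕ × (Fin d → ℤ) => ENNReal.ofReal (((2 ^ c.1)⁻¹ : ℝ) ^ t)]

theorem netContent_mono (t : ℝ) {E F : Set (EuclideanSpace ℝ (Fin d))} (h : E ⊆ F) :
    netContent t E ≤ netContent t F :=
  le_iInf₂ fun C hC => iInf₂_le C (h.trans hC)

/-- Rounding a positive diameter up to a power of 1/2 costs at most `2 ^ t`. Diameter 0 has no such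
rounding and takes a cube of cost below `ε`. -/
theorem exists_dyadic_scale {δ t : ℝ} (ht : 0 < t) (hδ : 0 ≤ δ) (hδ1 : δ ≤ 1) {ε : ℝ≥0∞}
    (hε : ε ≠ 0) : ∃ k : ℕ, δ ≤ (2 ^ k)⁻¹ ∧
      ENNReal.ofReal (((2 ^ k)⁻¹ : ℝ) ^ t) ≤
        ENNReal.ofReal (2 ^ t) * ENNReal.ofReal (δ ^ t) + ε := by
  rcases hδ.eq_or_lt with rfl | hpos
  · have h1 : Tendsto (fun k : ℕ => ENNReal.ofReal (((2 ^ k)⁻¹ : ℝ) ^ t)) atTop (nhds 0) := by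
      have h3 := (ENNReal.continuous_ofReal.tendsto _).comp
        (tendsto_inv_two_pow.rpow_const (Or.inr ht.le))
      rw [Real.zero_rpow ht.ne', ENNReal.ofReal_zero] at h3
      exact h3
    obtain ⟨k, hk⟩ := (h1.eventually_lt_const (bot_lt_iff_ne_bot.2 hε)).exists
    exact ⟨k, by positivity, hk.le.trans le_add_self⟩
  · obtain ⟨k, hk1, hk2⟩ := exists_nat_pow_near_of_lt_one hpos hδ1 (y := (2 : ℝ)⁻¹) (by norm_num)
      (by norm_num)
    rw [inv_pow] at hk1 hk2
    refine ⟨k, hk2, le_add_right ?_⟩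
    rw [← ENNReal.ofReal_mul (by positivity), ← Real.mul_rpow (by norm_num) hδ]
    refine ENNReal.ofReal_le_ofReal (Real.rpow_le_rpow (by positivity) ?_ ht.le)
    rw [pow_succ, mul_inv] at hk1
    linarith

/-- The dyadic cubes of level `k` that touch the one containing `x`. -/
noncomputable def neighbours (k : ℕ) (x : EuclideanSpace ℝ (Fin d)) :
    Finset (ℕ × (Fin d → ℤ)) :=
  {k} ×ˢ Fintype.piFinset fun i => Finset.Icc (⌊x i * 2 ^ k⌋ - 1) (⌊x i * 2 ^ k⌋ + 1)

theorem card_neighbours (k : ℕ) (x : EuclideanSpace ℝ (Fin d)) :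
    (neighbours k x).card = 3 ^ d := by
  have h : ∀ i, (Finset.Icc (⌊x i * 2 ^ k⌋ - 1) (⌊x i * 2 ^ k⌋ + 1)).card = 3 := fun i => by
    rw [Int.card_Icc]; omega
  simp only [neighbours, Finset.card_product, Fintype.card_piFinset, h]
  simp

theorem exists_mem_neighbours {k : ℕ} {x y : EuclideanSpace ℝ (Fin d)}
    (h : dist x y ≤ (2 ^ k)⁻¹) : ∃ c ∈ neighbours k x, y ∈ dyadicCube c := by
  refine ⟨(k, fun i => ⌊y i * 2 ^ k⌋), ?_, mem_dyadicCube_floor k y⟩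
  rw [neighbours, Finset.mem_product, Fintype.mem_piFinset]
  refine ⟨by simp, fun i => ?_⟩
  have h1 : |x i - y i| ≤ (2 ^ k)⁻¹ := by
    have := PiLp.norm_apply_le (x - y) i
    rw [← dist_eq_norm] at this
    exact this.trans h
  have hp : (0 : ℝ) < 2 ^ k := by positivity
  have h2 : |x i * 2 ^ k - y i * 2 ^ k| ≤ 1 := by
    rw [← sub_mul, abs_mul, abs_of_pos hp, ← le_div_iff₀ hp, one_div]
    exact h1
  rw [abs_le] at h2
  have e1 : ⌊x i * 2 ^ k⌋ - 1 = ⌊x i * 2 ^ k - 1⌋ := (Int.floor_sub_one _).symm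
  have e2 : ⌊x i * 2 ^ k⌋ + 1 = ⌊x i * 2 ^ k + 1⌋ := (Int.floor_add_one _).symm
  rw [Finset.mem_Icc, e1, e2]
  exact ⟨Int.floor_le_floor (by linarith [h2.2]), Int.floor_le_floor (by linarith [h2.1])⟩

-- If the dimension were below `t`, the set would have covers of arbitrarily small `t`-cost.
-- Replacing each member by `3 ^ d` neighbouring dyadic cubes of comparable size would then make the
-- net content vanish.
open Measure in
theorem le_dimH_of_netContent_ne_zero {t : ℝ≥0} (ht : 0 < t) {E : Set (EuclideanSpace ℝ (Fin d))}
    (hE : netContent t E ≠ 0) : (t : ℝ≥0∞) ≤ dimH E := by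
  classical
  by_contra hlt
  have ht' : (0 : ℝ) < t := ht
  have h0 : μH[(t : ℝ)] E = 0 := hausdorffMeasure_of_dimH_lt (not_le.1 hlt)
  set D : ℝ≥0∞ := 3 ^ d * (ENNReal.ofReal (2 ^ (t : ℝ)) + 1) with hD
  have hDt : D ≠ ⊤ := ENNReal.mul_ne_top (by simp) (by simp)
  obtain ⟨ε, hε, hεD⟩ := ENNReal.exists_nnreal_pos_mul_lt hDt hE
  have hε' : (ε : ℝ≥0∞) ≠ 0 := by simpa using hε.ne'
  obtain ⟨η, hη, hηs⟩ := ENNReal.exists_pos_sum_of_countable' hε' ℕ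
  rw [hausdorffMeasure_apply] at h0
  have h1 := ENNReal.iSup_eq_zero.1 (ENNReal.iSup_eq_zero.1 h0 1) one_pos
  obtain ⟨A, hA⟩ := iInf_lt_iff.1 (h1.trans_lt (bot_lt_iff_ne_bot.2 hε'))
  obtain ⟨hAE, hA⟩ := iInf_lt_iff.1 hA
  obtain ⟨hA1, hA⟩ := iInf_lt_iff.1 hA
  have hfin : ∀ n, Metric.ediam (A n) ≠ ⊤ := fun n => ne_top_of_le_ne_top ENNReal.one_ne_top (hA1 n)
  have hscale : ∀ n, ∃ k : ℕ, (Metric.ediam (A n)).toReal ≤ (2 ^ k)⁻¹ ∧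
      ENNReal.ofReal (((2 ^ k)⁻¹ : ℝ) ^ (t : ℝ)) ≤
        ENNReal.ofReal (2 ^ (t : ℝ)) * Metric.ediam (A n) ^ (t : ℝ) + η n := by
    intro n
    obtain ⟨k, hk1, hk2⟩ := exists_dyadic_scale ht' (δ := (Metric.ediam (A n)).toReal)
      ENNReal.toReal_nonneg (ENNReal.toReal_le_of_le_ofReal zero_le_one (by simpa using hA1 n))
      (hη n).ne'
    refine ⟨k, hk1, hk2.trans_eq ?_⟩
    rw [← ENNReal.ofReal_rpow_of_nonneg ENNReal.toReal_nonneg ht'.le,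
      ENNReal.ofReal_toReal (hfin n)]
  choose k hk1 hk2 using hscale
  have hcov : ∀ n, ∃ N : Finset (ℕ × (Fin d → ℤ)), (A n ⊆ ⋃ c ∈ N, dyadicCube c) ∧
      ∑ c ∈ N, ENNReal.ofReal (((2 ^ c.1)⁻¹ : ℝ) ^ (t : ℝ)) ≤
        3 ^ d * (ENNReal.ofReal (2 ^ (t : ℝ)) *
          (⨆ _ : (A n).Nonempty, Metric.ediam (A n) ^ (t : ℝ)) + η n) := by
    intro n
    rcases (A n).eq_empty_or_nonempty with h | ⟨x, hx⟩
    · exact ⟨∅, by simp [h], by simp⟩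
    · refine ⟨neighbours (k n) x, fun y hy => ?_, ?_⟩
      · have hxy : dist x y ≤ (2 ^ k n)⁻¹ := by
          refine le_trans ?_ (hk1 n)
          rw [dist_edist]
          exact ENNReal.toReal_mono (hfin n) (Metric.edist_le_ediam_of_mem hx hy)
        obtain ⟨c, hc, hyc⟩ := exists_mem_neighbours hxy
        exact mem_iUnion₂.2 ⟨c, hc, hyc⟩
      · have hne : (A n).Nonempty := ⟨x, hx⟩
        rw [Finset.sum_congr rfl fun c hc => by
          rw [Finset.mem_singleton.1 (Finset.mem_product.1 hc).1], Finset.sum_const,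
          card_neighbours, nsmul_eq_mul]
        simp only [hne, iSup_pos]
        push_cast
        gcongr
        exact hk2 n
  choose N hN1 hN2 using hcov
  refine absurd hεD (not_lt.2 ?_)
  calc netContent t E ≤ ∑' c : (⋃ n, (N n : Set (ℕ × (Fin d → ℤ)))),
        ENNReal.ofReal ((((2 : ℝ) ^ (c : ℕ × (Fin d → ℤ)).1)⁻¹) ^ (t : ℝ)) := by
        refine iInf₂_le (⋃ n, (N n : Set (ℕ × (Fin d → ℤ))))
          (hAE.trans (iUnion_subset fun n => (hN1 n).trans ?_))
        exact iUnion₂_subset fun c hc x hx => mem_iUnion₂.2 ⟨c, mem_iUnion.2 ⟨n, hc⟩, hx⟩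
    _ ≤ ∑' n, ∑' c : (N n : Set (ℕ × (Fin d → ℤ))),
        ENNReal.ofReal ((((2 : ℝ) ^ (c : ℕ × (Fin d → ℤ)).1)⁻¹) ^ (t : ℝ)) :=
        ENNReal.tsum_iUnion_le_tsum
          (fun c : ℕ × (Fin d → ℤ) => ENNReal.ofReal ((((2 : ℝ) ^ c.1)⁻¹) ^ (t : ℝ))) _
    _ ≤ ∑' n, 3 ^ d * (ENNReal.ofReal (2 ^ (t : ℝ)) *
          (⨆ _ : (A n).Nonempty, Metric.ediam (A n) ^ (t : ℝ)) + η n) := by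
        refine ENNReal.tsum_le_tsum fun n => le_trans (le_of_eq ?_) (hN2 n)
        exact Finset.tsum_subtype' (N n)
          (fun c : ℕ × (Fin d → ℤ) => ENNReal.ofReal ((((2 : ℝ) ^ c.1)⁻¹) ^ (t : ℝ)))
    _ = 3 ^ d * (ENNReal.ofReal (2 ^ (t : ℝ)) *
          ∑' n, (⨆ _ : (A n).Nonempty, Metric.ediam (A n) ^ (t : ℝ)) + ∑' n, η n) := by
        rw [ENNReal.tsum_mul_left, ENNReal.tsum_add, ENNReal.tsum_mul_left]
    _ ≤ 3 ^ d * (ENNReal.ofReal (2 ^ (t : ℝ)) * ε + ε) := by gcongr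
    _ = ε * D := by rw [hD]; ring

/-! ### Bi-Lipschitz invariance -/

/-- `U` carries spread measures in all cubes inside the unit cube. -/
def IsBoxSpread (t : ℝ) (U : Set (EuclideanSpace ℝ (Fin d))) : Prop :=
  ∃ C : ℝ, ∀ (p : Fin d → ℝ) (ℓ : ℝ), 0 < ℓ → (∀ i, 0 ≤ p i ∧ p i + ℓ ≤ 1) →
    IsSpreadOn t C ℓ (U ∩ box p ℓ)

theorem mem_interior_dyadicCube {c : ℕ × (Fin d → ℤ)} {x : EuclideanSpace ℝ (Fin d)}
    (hx : ∀ i, (c.2 i : ℝ) / 2 ^ c.1 < x i ∧ x i < ((c.2 i : ℝ) + 1) / 2 ^ c.1) :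
    x ∈ interior (dyadicCube c) := by
  have ho : IsOpen {x : EuclideanSpace ℝ (Fin d) |
      ∀ i, (c.2 i : ℝ) / 2 ^ c.1 < x i ∧ x i < ((c.2 i : ℝ) + 1) / 2 ^ c.1} := by
    simp only [ofPred_forall]
    refine isOpen_iInter_of_finite fun i => ?_
    have hc : Continuous fun x : EuclideanSpace ℝ (Fin d) => x i := by fun_prop
    exact (isOpen_lt continuous_const hc).inter (isOpen_lt hc continuous_const)
  exact interior_maximal (fun y hy i => ⟨(hy i).1.le, (hy i).2⟩) ho hx

theorem IsSpreadOn.rescale {t C ℓ κ : ℝ} (hℓ : 0 < ℓ) (hκ : 0 < κ)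
    {A : Set (EuclideanSpace ℝ (Fin d))} (h : IsSpreadOn t C ℓ A) :
    IsSpreadOn t (C * κ ^ t) (κ * ℓ) A := by
  obtain ⟨ν, h1, h2, h3⟩ := h
  refine ⟨ν, h1, h2, fun y r hr => (h3 y r hr).trans_eq ?_⟩
  rw [mul_assoc, ← Real.mul_rpow hκ.le (by positivity)]
  congr 3
  field_simp

theorem dyadicCube_le_one {k : ℕ} {z : Fin d → ℤ} (h : dyadicCube (k, z) ⊆ unitCube d) (i : Fin d) :
    0 ≤ (z i : ℝ) / 2 ^ k ∧ (z i : ℝ) / 2 ^ k + (2 ^ k)⁻¹ ≤ 1 := by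
  have hp : (0 : ℝ) < 2 ^ k := by positivity
  have hmem : WithLp.toLp 2 (fun i => (z i : ℝ) / 2 ^ k) ∈ dyadicCube (k, z) := fun i =>
    ⟨le_rfl, (div_lt_div_iff_of_pos_right hp).2 (by linarith)⟩
  have h1 := h hmem i
  refine ⟨h1.1, ?_⟩
  have h2 : (z i : ℝ) < 2 ^ k := (div_lt_one hp).1 h1.2
  have h3 : z i + 1 ≤ 2 ^ k := by exact_mod_cast h2
  have h4 : (z i : ℝ) + 1 ≤ 2 ^ k := by exact_mod_cast h3
  rw [← one_div, ← add_div]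
  exact (div_le_one hp).2 h4

/-- The concentric box of half the side lies in the interior of the dyadic cube, at the price of a
factor `2 ^ t`. -/
theorem IsBoxSpread.isDyadicSpread {t : ℝ} {U : Set (EuclideanSpace ℝ (Fin d))}
    (h : IsBoxSpread t U) {c₀ : ℕ × (Fin d → ℤ)} (hc₀ : dyadicCube c₀ ⊆ unitCube d) :
    IsDyadicSpread t c₀ U := by
  obtain ⟨C, hC⟩ := h
  refine ⟨C * 2 ^ t, 0, fun k _ z hz => ?_⟩
  have hp : (0 : ℝ) < (2 ^ k)⁻¹ := by positivity
  have hz1 := dyadicCube_le_one (hz.trans hc₀)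
  have h1 := (hC (fun i => (z i : ℝ) / 2 ^ k + (2 ^ k)⁻¹ / 4) ((2 ^ k)⁻¹ / 2) (by positivity)
    fun i => ⟨by linarith [hz1 i], by linarith [hz1 i]⟩).rescale (by positivity) two_pos
  rw [mul_div_cancel₀ _ (by norm_num : (2 : ℝ) ≠ 0)] at h1
  refine h1.mono (inter_subset_inter_right _ fun x hx => mem_interior_dyadicCube fun i => ?_)
  have := hx i
  rw [add_div, one_div]
  constructor <;> linarith [this.1, this.2]

theorem IsBiLipschitzOn.injOn {g : EuclideanSpace ℝ (Fin d) → EuclideanSpace ℝ (Fin d)}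
    {S : Set (EuclideanSpace ℝ (Fin d))} (hg : IsBiLipschitzOn g S) : InjOn g S := by
  obtain ⟨K, -, hK⟩ := hg
  exact injOn_iff_injective.2 hK.injective

theorem IsBiLipschitzOn.exists_bounds {g : EuclideanSpace ℝ (Fin d) → EuclideanSpace ℝ (Fin d)}
    {S : Set (EuclideanSpace ℝ (Fin d))} (hg : IsBiLipschitzOn g S) :
    ∃ K : ℝ, 0 < K ∧ ∀ x ∈ S, ∀ y ∈ S, dist (g x) (g y) ≤ K * dist x y ∧
      dist x y ≤ K * dist (g x) (g y) := by
  obtain ⟨K, h1, h2⟩ := hg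
  refine ⟨K + 1, by positivity, fun x hx y hy => ⟨(h1.dist_le_mul x hx y hy).trans ?_, ?_⟩⟩
  · gcongr; linarith
  · have := h2.le_mul_dist ⟨x, hx⟩ ⟨y, hy⟩
    refine this.trans ?_
    change (K : ℝ) * dist (g x) (g y) ≤ _
    gcongr
    linarith

theorem IsBiLipschitzOn.continuousOn_invFunOn
    {g : EuclideanSpace ℝ (Fin d) → EuclideanSpace ℝ (Fin d)}
    {S : Set (EuclideanSpace ℝ (Fin d))} (hg : IsBiLipschitzOn g S) :
    ContinuousOn (Function.invFunOn g S) (g '' S) := by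
  obtain ⟨K, hK, h⟩ := hg.exists_bounds
  have : LipschitzOnWith ⟨K, hK.le⟩ (Function.invFunOn g S) (g '' S) := by
    refine LipschitzOnWith.of_dist_le_mul fun x hx y hy => ?_
    have := (h _ (Function.invFunOn_mem hx) _ (Function.invFunOn_mem hy)).2
    rwa [Function.invFunOn_eq hx, Function.invFunOn_eq hy] at this
  exact this.continuousOn

/-- Inside the image the set is a preimage under the inverse map, which is Lipschitz there.
Intersecting with an open subset of the image avoids invariance of domain. -/
theorem IsBiLipschitzOn.isOpen_inter_image
    {g : EuclideanSpace ℝ (Fin d) → EuclideanSpace ℝ (Fin d)}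
    {S : Set (EuclideanSpace ℝ (Fin d))} (hg : IsBiLipschitzOn g S)
    {O W : Set (EuclideanSpace ℝ (Fin d))} (hO : IsOpen O) (hOS : O ⊆ g '' S) (hW : IsOpen W) :
    IsOpen (O ∩ g '' (W ∩ S)) := by
  have : O ∩ g '' (W ∩ S) = O ∩ Function.invFunOn g S ⁻¹' W := by
    ext y
    refine and_congr_right fun hy => ⟨?_, fun h => ?_⟩
    · rintro ⟨x, ⟨hxW, hxS⟩, rfl⟩
      rw [mem_preimage, hg.injOn.leftInvOn_invFunOn hxS]
      exact hxW
    · exact ⟨_, ⟨h, Function.invFunOn_mem (hOS hy)⟩, Function.invFunOn_eq (hOS hy)⟩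
  rw [this]
  exact (hg.continuousOn_invFunOn.mono hOS).isOpen_inter_preimage hO hW

/-- Spread measures can be transported by bi-Lipschitz maps. -/
theorem IsBoxSpread.image [NeZero d] {t : ℝ} {W : Set (EuclideanSpace ℝ (Fin d))}
    (h : IsBoxSpread t W) (hW : IsOpen W)
    {g : EuclideanSpace ℝ (Fin d) → EuclideanSpace ℝ (Fin d)}
    (hg : IsBiLipschitzOn g (openCube d)) {c₀ : ℕ × (Fin d → ℤ)}
    (hc₀ : closedDyadic c₀ ⊆ g '' openCube d) :
    IsDyadicSpread t c₀ (g '' (W ∩ openCube d)) := by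
  obtain ⟨C, hC⟩ := h
  obtain ⟨K, hK, hKg⟩ := hg.exists_bounds
  have hd : (0 : ℝ) < d := by exact_mod_cast Nat.pos_of_neZero d
  have hd1 : (1 : ℝ) ≤ d := by exact_mod_cast NeZero.one_le
  -- The preimage of the closed cube is compact, so small boxes around its points stay in the open
  -- cube uniformly.
  obtain ⟨δ, hδ, hδO⟩ := ((isCompact_closedDyadic c₀).image_of_continuousOn
    (hg.continuousOn_invFunOn.mono hc₀)).exists_thickening_subset_open isOpen_openCube (by
      rintro _ ⟨y, hy, rfl⟩
      exact Function.invFunOn_mem (hc₀ hy))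
  have hlim : Tendsto (fun k : ℕ => d * ((2 ^ k)⁻¹ / (4 * K * d))) atTop (nhds 0) := by
    simpa using (tendsto_inv_two_pow.div_const (4 * K * d)).const_mul (d : ℝ)
  obtain ⟨k₀, hk₀⟩ := eventually_atTop.1 (hlim.eventually_lt_const hδ)
  -- A globally continuous extension, so that measures can be pushed forward.
  obtain ⟨g', hg'⟩ : ∃ g' : EuclideanSpace ℝ (Fin d) → EuclideanSpace ℝ (Fin d),
      Continuous g' ∧ EqOn g g' (openCube d) := by
    obtain ⟨K', hK', -⟩ := hg
    obtain ⟨g', h1, h2⟩ := hK'.extend_finite_dimension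
    exact ⟨g', h1.continuous, h2⟩
  refine ⟨C * (2 * K * (2 * K * d)) ^ t, k₀, fun k hk z hz => ?_⟩
  set ℓ : ℝ := (2 ^ k)⁻¹ with hℓ
  have hℓ0 : 0 < ℓ := by positivity
  -- With this half-side, `g` displaces points of the box by at most `K * d * r₀ = ℓ / 4` from the
  -- centre `y`, whose distance to the boundary is `ℓ / 2`.
  set r₀ : ℝ := ℓ / (4 * K * d) with hr₀
  have hr₀0 : 0 < r₀ := by positivity
  set y : EuclideanSpace ℝ (Fin d) := WithLp.toLp 2 fun i => (z i : ℝ) / 2 ^ k + ℓ / 2 with hy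
  have hyz : y ∈ dyadicCube (k, z) := by
    intro i
    change (z i : ℝ) / 2 ^ k ≤ (z i : ℝ) / 2 ^ k + ℓ / 2 ∧
      (z i : ℝ) / 2 ^ k + ℓ / 2 < ((z i : ℝ) + 1) / 2 ^ k
    rw [add_div, one_div]
    constructor <;> linarith
  have hyc : y ∈ closedDyadic c₀ := dyadicCube_subset_closedDyadic _ (hz hyz)
  set x := Function.invFunOn g (openCube d) y with hx
  have hxy : g x = y := Function.invFunOn_eq (hc₀ hyc)
  have hxS : x ∈ openCube d := Function.invFunOn_mem (hc₀ hyc)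
  have hball : ∀ x' : EuclideanSpace ℝ (Fin d), (∀ i, |x' i - x i| ≤ r₀) →
      dist x' x ≤ d * r₀ ∧ x' ∈ openCube d := by
    intro x' hx'
    have h1 : dist x' x ≤ d * r₀ := by
      rw [dist_eq_norm]
      exact norm_le_card_mul fun i => hx' i
    exact ⟨h1, hδO (Metric.mem_thickening_iff.2 ⟨x, ⟨y, hyc, rfl⟩, h1.trans_lt (hk₀ k hk)⟩)⟩
  have hbox : box (fun i => x i - r₀) (2 * r₀) ⊆
      openCube d ∩ g ⁻¹' interior (dyadicCube (k, z)) := by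
    intro x' hx'
    obtain ⟨h1, h2⟩ := hball x' fun i => abs_le.2
      ⟨by linarith [(hx' i).1], by linarith [(hx' i).2]⟩
    refine ⟨h2, mem_interior_dyadicCube fun i => ?_⟩
    have h3 := (hKg x' h2 x hxS).1
    have h4 : K * dist x' x ≤ ℓ / 4 := by
      calc K * dist x' x ≤ K * (d * r₀) := by gcongr
        _ = ℓ / 4 := by rw [hr₀]; field_simp
    have h5 : |g x' i - y i| ≤ ℓ / 4 := by
      have := PiLp.norm_apply_le (g x' - g x) i
      rw [← dist_eq_norm] at this
      rw [← hxy]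
      exact this.trans (h3.trans h4)
    have h6 : y i = (z i : ℝ) / 2 ^ k + ℓ / 2 := rfl
    rw [abs_le, h6] at h5
    change (z i : ℝ) / 2 ^ k < g x' i ∧ g x' i < ((z i : ℝ) + 1) / 2 ^ k
    rw [add_div, one_div]
    constructor <;> linarith [h5.1, h5.2]
  have hone : ∀ s : ℝ, |s| ≤ r₀ → ∀ i, 0 < x i + s ∧ x i + s < 1 := by
    intro s hs i
    exact (hball (WithLp.toLp 2 fun i => x i + s) fun i => by simpa using hs).2 i
  obtain ⟨ν, hν1, hν2, hν3⟩ := hC (fun i => x i - r₀) (2 * r₀) (by positivity) fun i =>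
    ⟨by linarith [(hone (-r₀) (by rw [abs_neg, abs_of_pos hr₀0]) i).1],
      by linarith [(hone r₀ (by rw [abs_of_pos hr₀0]) i).2]⟩
  have hopen : IsOpen (interior (dyadicCube (k, z)) ∩ g '' (W ∩ openCube d)) :=
    hg.isOpen_inter_image isOpen_interior ((interior_subset.trans hz).trans
      ((dyadicCube_subset_closedDyadic c₀).trans hc₀)) hW
  refine ⟨ν.map g', Measure.isProbabilityMeasure_map hg'.1.measurable.aemeasurable, ?_,
    fun y' r hr => ?_⟩
  · rw [inter_comm, Measure.map_apply hg'.1.measurable hopen.measurableSet.compl]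
    refine measure_mono_null (t := (W ∩ box (fun i => x i - r₀) (2 * r₀))ᶜ)
      (fun x' hx' hx'' => ?_) hν2
    obtain ⟨h1, h2⟩ := hbox hx''.2
    refine hx' ?_
    rw [← hg'.2 h1]
    exact ⟨h2, ⟨x', ⟨hx''.1, h1⟩, rfl⟩⟩
  · rw [Measure.map_apply hg'.1.measurable Metric.isClosed_closedBall.measurableSet]
    have hν4 : ν (openCube d)ᶜ = 0 := measure_mono_null
      (compl_subset_compl.2 (inter_subset_right.trans (hbox.trans inter_subset_left))) hν2
    have hle : ν (g' ⁻¹' Metric.closedBall y' r) ≤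
        ν (g' ⁻¹' Metric.closedBall y' r ∩ openCube d) := by
      rw [measure_inter_conull hν4]
    refine hle.trans ?_
    rcases (g' ⁻¹' Metric.closedBall y' r ∩ openCube d).eq_empty_or_nonempty
      with he | ⟨x₁, hx₁, hx₁'⟩
    · rw [he, measure_empty]; exact bot_le
    -- The ball is recentred at a point of its preimage, as `y'` need not lie in the image. The
    -- factor `2 * K`, divided by the side `2 * r₀`, gives the constant.
    · have hsub : g' ⁻¹' Metric.closedBall y' r ∩ openCube d ⊆
          Metric.closedBall x₁ (2 * K * r) := by
        rintro x₂ ⟨hx₂, hx₂'⟩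
        rw [Metric.mem_closedBall]
        refine (hKg x₂ hx₂' x₁ hx₁').2.trans ?_
        rw [hg'.2 hx₁', hg'.2 hx₂']
        have a1 : dist (g' x₂) y' ≤ r := hx₂
        have a2 : dist (g' x₁) y' ≤ r := hx₁
        nlinarith [dist_triangle_right (g' x₂) (g' x₁) y']
      refine (measure_mono hsub).trans ((hν3 x₁ (2 * K * r) (by positivity)).trans_eq ?_)
      rw [mul_assoc C, ← Real.mul_rpow (by positivity) (by positivity)]
      congr 3
      rw [hr₀]
      field_simp
      ring

/-! ### Limsup sets as countable intersections, and the theorem -/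

/-- Starting at `N + 1` leaves out `n = 0`, where nothing is assumed about the target. -/
theorem isOpen_iUnion_hitSet (β : Fin d → ℝ) {P : ℕ → Set (EuclideanSpace ℝ (Fin d))}
    (hcube : ∀ n, 1 ≤ n → P n ⊆ unitCube d) (N : ℕ) :
    IsOpen (⋃ n ≥ N + 1, hitSet β n (interior (P n))) :=
  isOpen_biUnion fun n hn => (hitSet_subset_openCube_and_isOpen β n isOpen_interior
    ((interior_mono (hcube n (by have : N + 1 ≤ n := hn; omega))).trans
      interior_unitCube_subset)).2

theorem limsupSet_eq_iInter (β : Fin d → ℝ) (Q : ℕ → Set (EuclideanSpace ℝ (Fin d))) :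
    limsupSet β Q = ⋂ N : ℕ, ⋃ n ≥ N + 1, hitSet β n (Q n) := by
  ext x
  simp only [mem_iInter, mem_iUnion]
  constructor
  · rintro ⟨hx, hf⟩ N
    obtain ⟨n, hn, hxn⟩ := frequently_atTop.1 hf (N + 1)
    exact ⟨n, hn, hx, hxn⟩
  · intro h
    obtain ⟨n, -, hx, -⟩ := h 0
    refine ⟨hx, frequently_atTop.2 fun N => ?_⟩
    obtain ⟨n, hn, -, hxn⟩ := h N
    exact ⟨n, (Nat.le_succ N).trans hn, hxn⟩

theorem exists_closedDyadic_subset {U : Set (EuclideanSpace ℝ (Fin d))} (hU : IsOpen U)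
    (hne : U.Nonempty) : ∃ c : ℕ × (Fin d → ℤ), closedDyadic c ⊆ U := by
  obtain ⟨y, hy⟩ := hne
  obtain ⟨ε, hε, hεU⟩ := Metric.isOpen_iff.1 hU y hy
  have hlim : Tendsto (fun k : ℕ => (d : ℝ) * (2 ^ k)⁻¹) atTop (nhds 0) := by
    simpa using tendsto_inv_two_pow.const_mul (d : ℝ)
  obtain ⟨k, hk⟩ := (hlim.eventually_lt_const hε).exists
  refine ⟨(k, fun i => ⌊y i * 2 ^ k⌋), fun x hx => hεU ?_⟩
  exact (dist_le_of_mem_closedDyadic hx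
    (dyadicCube_subset_closedDyadic _ (mem_dyadicCube_floor k y))).trans_lt hk

/-- All pairs (map, open set) are enumerated as one sequence of open sets inside `U`, to which the
Cantor construction applies. Injectivity of the maps lets images commute with the intersection over
`N`. -/
theorem le_dimH_inter_images [NeZero d] {t : ℝ≥0} (ht : 0 < t) (htd : (t : ℝ) < d)
    {W : ℕ → Set (EuclideanSpace ℝ (Fin d))} (hW : ∀ N, IsOpen (W N))
    (hspread : ∀ N, IsBoxSpread t (W N))
    {g : ℕ → EuclideanSpace ℝ (Fin d) → EuclideanSpace ℝ (Fin d)}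
    (hg : ∀ j, IsBiLipschitzOn (g j) (openCube d)) {U : Set (EuclideanSpace ℝ (Fin d))}
    (hU : IsOpen U) (hne : U.Nonempty) (hUg : ∀ j, U ⊆ g j '' openCube d) :
    (t : ℝ≥0∞) ≤ dimH (U ∩ ⋂ j, g j '' ((⋂ N, W N) ∩ openCube d)) := by
  obtain ⟨c, hc⟩ := exists_closedDyadic_subset hU hne
  set V : ℕ → Set (EuclideanSpace ℝ (Fin d)) := fun m =>
    U ∩ g (Nat.unpair m).1 '' (W (Nat.unpair m).2 ∩ openCube d) with hV
  have hVo : ∀ m, IsOpen (V m) := fun m => (hg _).isOpen_inter_image hU (hUg _) (hW _)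
  have hVs : ∀ m, IsDyadicSpread t c (V m) := by
    intro m
    obtain ⟨C, k₀, h⟩ := (hspread (Nat.unpair m).2).image (hW _) (hg (Nat.unpair m).1)
      (hc.trans (hUg _))
    refine ⟨C, k₀, fun k hk z hz => (h k hk z hz).mono fun x hx => ⟨⟨?_, hx.1⟩, hx.2⟩⟩
    exact hc (dyadicCube_subset_closedDyadic _ (hz (interior_subset hx.2)))
  have hle := le_netContent_iInter t.coe_nonneg htd hVo hVs
  refine (le_dimH_of_netContent_ne_zero ht (ne_of_gt (lt_of_lt_of_le ?_ hle))).trans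
    (dimH_mono fun y hy => ?_)
  · exact ENNReal.ofReal_pos.2 (by positivity)
  · have hy' : ∀ j N, y ∈ U ∩ g j '' (W N ∩ openCube d) := fun j N => by
      have := mem_iInter.1 hy.1 (Nat.pair j N)
      simpa [hV] using this
    refine ⟨(hy' 0 0).1, mem_iInter.2 fun j => ?_⟩
    obtain ⟨x, ⟨-, hx⟩, rfl⟩ := (hy' j 0).2
    refine ⟨x, ⟨mem_iInter.2 fun N => ?_, hx⟩, rfl⟩
    obtain ⟨x', ⟨hx'W, hx'⟩, he⟩ := (hy' j N).2
    exact (hg j).injOn hx' hx he ▸ hx'W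

theorem dyadicCube_zero : dyadicCube ((0, 0) : ℕ × (Fin d → ℤ)) = unitCube d := by
  ext x
  simp [dyadicCube, unitCube]

theorem limsupSet_mono (β : Fin d → ℝ) {P Q : ℕ → Set (EuclideanSpace ℝ (Fin d))}
    (h : ∀ n, P n ⊆ Q n) : limsupSet β P ⊆ limsupSet β Q :=
  fun _ hx => ⟨hx.1, hx.2.mono fun n hn => h n hn⟩

end BetaTarget

open BetaTarget in
theorem theorem1p1 {d : ℕ} [NeZero d] (β : Fin d → ℝ) (hβ : ∀ i, 1 < β i)
    (P : ℕ → Set (EuclideanSpace ℝ (Fin d)))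
    (v : ℕ → EuclideanSpace ℝ (Fin d))
    (α γ : ℕ → Fin d → EuclideanSpace ℝ (Fin d))
    (hP : ∀ n, 1 ≤ n → BetaTarget.IsParallelepiped (P n) (v n) (α n))
    (hcube : ∀ n, 1 ≤ n → P n ⊆ BetaTarget.unitCube d)
    (hγ : ∀ n, 1 ≤ n →
      BetaTarget.IsPivotedGramSchmidt (fun j => BetaTarget.contraction β n (α n j)) (γ n)) :
    ∃ s : ℝ≥0,
      Filter.limsup (fun n : ℕ => ((BetaTarget.minExponent β n (γ n) : ℝ) : EReal)) Filter.atTop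
        = ((s : ℝ) : EReal) ∧
      dimH (BetaTarget.limsupSet β P) = (s : ℝ≥0∞) ∧
      BetaTarget.LargeIntersectionClass (s : ℝ)
        (BetaTarget.limsupSet β (fun n => interior (P n))) ∧
      (IsGδ (BetaTarget.limsupSet β P) →
        BetaTarget.LargeIntersectionClass (s : ℝ) (BetaTarget.limsupSet β P)) ∧
      BetaTarget.HasLargeIntersections s (BetaTarget.limsupSet β P) := by
  obtain ⟨ρ, hρ0, hρ1, hρ⟩ := exists_inv_le_lt_one hβ
  have hev : ∀ᶠ n in atTop, minExponent β n (γ n) ∈ Icc (0 : ℝ) d := by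
    have lim : Tendsto (fun n : ℕ => (d : ℝ) * (2 * ρ ^ n)) atTop (nhds 0) := by
      simpa using
        ((tendsto_pow_atTop_nhds_zero_of_lt_one hρ0.le hρ1).const_mul 2).const_mul (d : ℝ)
    filter_upwards [lim.eventually_lt_const one_pos, eventually_ge_atTop 1] with n hn hn1
    obtain ⟨w, M, hF⟩ := exists_isFrame hβ (hP n hn1) (hγ n hn1)
    exact minExponent_mem_Icc hβ hF.ne_zero fun τ hτ =>
      (scales_le hβ (hP n hn1) (hcube n hn1) (hγ n hn1) hρ hτ).trans_lt hn
  obtain ⟨s, hs⟩ : ∃ s : ℝ≥0,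
      limsup (fun n : ℕ => ((minExponent β n (γ n) : ℝ) : EReal)) atTop = ((s : ℝ) : EReal) := by
    set L := limsup (fun n : ℕ => ((minExponent β n (γ n) : ℝ) : EReal)) atTop
    have h1 : L ≤ ((d : ℝ) : EReal) :=
      limsup_le_of_le (h := hev.mono fun n hn => EReal.coe_le_coe_iff.2 hn.2)
    have h0 : ((0 : ℝ) : EReal) ≤ L :=
      le_limsup_of_frequently_le (hev.frequently.mono fun n hn => EReal.coe_le_coe_iff.2 hn.1)
    have hL : ((L.toReal : ℝ) : EReal) = L := EReal.coe_toReal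
      (ne_top_of_le_ne_top (EReal.coe_ne_top _) h1) (ne_bot_of_le_ne_bot (EReal.coe_ne_bot _) h0)
    exact ⟨⟨L.toReal, EReal.toReal_nonneg h0⟩, hL.symm⟩
  have hfreq : ∀ t : ℝ, t < s → ∃ᶠ n in atTop, t < minExponent β n (γ n) := by
    intro t ht
    have h : ((t : ℝ) : EReal) <
        limsup (fun n : ℕ => ((minExponent β n (γ n) : ℝ) : EReal)) atTop := by
      rw [hs]; exact EReal.coe_lt_coe_iff.2 ht
    exact (frequently_lt_of_lt_limsup (h := h)).mono fun n hn => EReal.coe_lt_coe_iff.1 hn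
  have hevs : ∀ t : ℝ, s < t → ∀ᶠ n in atTop, minExponent β n (γ n) < t := by
    intro t ht
    have h : limsup (fun n : ℕ => ((minExponent β n (γ n) : ℝ) : EReal)) atTop <
        ((t : ℝ) : EReal) := by
      rw [hs]; exact EReal.coe_lt_coe_iff.2 ht
    exact (eventually_lt_of_limsup_lt h).mono fun n hn => EReal.coe_lt_coe_iff.1 hn
  -- The strict inequality is what the splitting of cubes needs.
  have htd : ∀ t : ℝ, t < s → t < d := fun t ht => by
    obtain ⟨n, h1, h2⟩ := ((hfreq t ht).and_eventually hev).exists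
    exact h1.trans_le h2.2
  set W : ℕ → Set (EuclideanSpace ℝ (Fin d)) := fun N =>
    ⋃ n ≥ N + 1, hitSet β n (interior (P n))
  have hWo : ∀ N, IsOpen (W N) := isOpen_iUnion_hitSet β hcube
  have hWe : limsupSet β (fun n => interior (P n)) = ⋂ N, W N := limsupSet_eq_iInter β _
  have hWP : limsupSet β (fun n => interior (P n)) ⊆ limsupSet β P :=
    limsupSet_mono β fun n => interior_subset
  have hbox : ∀ t : ℝ, 0 ≤ t → t < s → ∀ N, IsBoxSpread t (W N) := by
    intro t ht hts N
    -- The gap between `t` and `t'` pays for the polynomial factors.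
    obtain ⟨t', htt', ht's⟩ := exists_between hts
    exact ⟨_, fun p ℓ hℓ hp => isSpreadOn_hitSet hβ hP hcube hγ ht htt' (hfreq t' ht's)
      (N + 1) hℓ hp⟩
  have hcontent : ∀ t : ℝ, 0 < t → t < s → ∀ c : ℕ × (Fin d → ℤ), dyadicCube c ⊆ unitCube d →
      ENNReal.ofReal (((2 ^ c.1)⁻¹ : ℝ) ^ t) ≤
        netContent t (limsupSet β (fun n => interior (P n)) ∩ dyadicCube c) := by
    intro t ht hts c hc
    rw [hWe]
    exact le_netContent_iInter ht.le (htd t hts) hWo fun N =>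
      (hbox t ht.le hts N).isDyadicSpread hc
  -- The cube itself is a cover of cost side length to the power `t`, and the Cantor construction
  -- shows that the smaller set already needs that much. Hence full content passes to every set in
  -- between.
  have hclass : ∀ F, limsupSet β (fun n => interior (P n)) ⊆ F → F ⊆ unitCube d → IsGδ F →
      LargeIntersectionClass (s : ℝ) F := fun F hF hFc hFδ =>
    ⟨hFc.trans fun x hx i => ⟨(hx i).1, (hx i).2.le⟩, hFδ, fun t ht hts c hc =>
      le_antisymm (netContent_mono t inter_subset_right)
        ((netContent_dyadicCube_le t c).trans ((hcontent t ht hts c hc).trans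
          (netContent_mono t (inter_subset_inter_left _ hF))))⟩
  refine ⟨s, hs, le_antisymm ?_ ?_, ?_, fun hδ => ?_, ?_⟩
  · refine le_of_forall_gt_imp_ge_of_dense fun a ha => ?_
    obtain ⟨t, hst, hta⟩ := ENNReal.lt_iff_exists_nnreal_btwn.1 ha
    have hst' : (s : ℝ) < t := by exact_mod_cast hst
    obtain ⟨t', hst'', ht't⟩ := exists_between hst'
    exact (dimH_limsupSet_le hβ hP hcube hγ ht't (hevs t' hst'')).trans hta.le
  · refine ENNReal.le_of_forall_nnreal_lt fun t hts => ?_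
    rcases eq_zero_or_pos t with rfl | ht
    · simp
    have hts' : (t : ℝ) < s := by exact_mod_cast hts
    have h := hcontent t ht hts' (0, 0) dyadicCube_zero.subset
    refine (le_dimH_of_netContent_ne_zero ht (ne_of_gt (lt_of_lt_of_le ?_ h))).trans
      (dimH_mono (inter_subset_left.trans hWP))
    exact ENNReal.ofReal_pos.2 (by positivity)
  · refine hclass _ subset_rfl (fun x hx => hx.1) ?_
    rw [hWe]
    exact IsGδ.iInter_of_isOpen hWo
  · exact hclass _ hWP (fun x hx => hx.1) hδ
  · intro g hg U hU hne hUg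
    refine ENNReal.le_of_forall_nnreal_lt fun t hts => ?_
    rcases eq_zero_or_pos t with rfl | ht
    · simp
    have hts' : (t : ℝ) < s := by exact_mod_cast hts
    refine (le_dimH_inter_images ht (htd t hts') hWo (hbox t t.coe_nonneg hts') hg hU hne hUg).trans
      (dimH_mono (inter_subset_inter_right _ (iInter_mono fun j => image_mono ?_)))
    rw [← hWe]
    exact inter_subset_inter_left _ hWP
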